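/- Let $M$ be a $(2n+1)$-dimensional manifold (smooth, Hausdorff, second countable, without boundary, not necessarily closed) with a contact form $\alpha$ and the co-oriented contact structure $\xi=\ker\alpha$. Let $L\subset M$ be a closed (i.e. compact, without boundary) connected Legendrian submanifold and let $\mathcal L$ be its Legendrian isotopy class, that is, the set of all Legendrian submanifolds $L'=l_1(\Lambda)$, where $l_t:\Lambda\to M$, $t\in[0,1]$, is a smooth family of Legendrian embeddings with $l_0(\Lambda)=L$. A Legendrian isotopy $l_t$ is non-negative if $\alpha(X_t^l)\ge 0$ for all $t$, where $X^l_t(l_t(p)):=\frac{d}{ds}\big|_{s=t}l_s(p)$. For $L_0,L_1\in\mathcal L$ write $L_0\preccurlyeq L_1$ if there is a non-negative Legendrian isotopy from $L_0$ to $L_1$. The class $\mathcal L$ is called orderable if $\preccurlyeq$ is a partial order on $\mathcal L$. Define $\tau_\alpha:\mathcal L\times\mathcal L\to[0,\infty]$ by $$\tau_\alpha(L_0,L_1):=\sup\left\{\int_0^1\min_{L_t}\alpha(X_t^{l})\,dt\right\}\quad\text{if }L_0\preccurlyeq L_1,\qquad \tau_\alpha(L_0,L_1):=0\quad\text{otherwise},$$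 where the supremum is over all Legendrian isotopies $l_t=\phi_t|_{L_0}$, $L_t=\phi_t(L_0)$, with $\phi_t$, $t\in[0,1]$, a smooth compactly supported path of contactomorphisms of $(M,\xi)$ which is non-negative (i.e. $\alpha(\frac{d}{dt}\phi_t(x))\ge 0$ for all $t$ and $x$) and satisfies $\phi_0(L_0)=L_0$, $\phi_1(L_0)=L_1$. Then $\mathcal L$ is orderable if and only if $\tau_\alpha(L_0,L_1)<\infty$ for all $L_0,L_1\in\mathcal L$. Moreover, let $\phi^\alpha_t$ denote the flow of the Reeb vector field $R$ of $\alpha$ (given by $\alpha(R)=1$, $d\alpha(R,\cdot)=0$). If $\mathcal L$ is orderable, then for all $L_0\in\mathcal L$ and all $t\ge 0$ such that the Reeb flow is defined on $[0,t]$ at every point of $L_0$ (which is automatic if $R$ is complete, e.g. if $M$ is closed), one has $\phi_t^\alpha(L_0)\in\mathcal L$ and $$\tau_\alpha(L_0,\phi_t^\alpha(L_0))=t .$$ -/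

import Mathlib

open Set MeasureTheory
open scoped Manifold ContDiff Topology ENNReal Bundle

noncomputable section

namespace LegendrianOrder

section ContactForm

variable {n : ℕ} {M : Type*} [TopologicalSpace M]
  [ChartedSpace (EuclideanSpace ℝ (Fin (2 * n + 1))) M]

/-- The coordinate expression of the `1`-form `α` in the preferred chart at `x`, i.e. the
pull-back of `α` by the inverse of that chart. -/
def coordForm (α : ∀ x : M, TangentSpace (𝓡 (2 * n + 1)) x →L[ℝ] ℝ) (x : M)
    (y : EuclideanSpace ℝ (Fin (2 * n + 1))) : EuclideanSpace ℝ (Fin (2 * n + 1)) →L[ℝ] ℝ :=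
  (α ((extChartAt (𝓡 (2 * n + 1)) x).symm y)).comp
    (mfderiv 𝓘(ℝ, EuclideanSpace ℝ (Fin (2 * n + 1))) (𝓡 (2 * n + 1))
      (extChartAt (𝓡 (2 * n + 1)) x).symm y)

/-- The exterior derivative `dα` at `x`, computed in the preferred chart at `x`, which identifies
`T_x M` with the model space: `dα(u, v) = u(α(v)) - v(α(u))` for constant `u`, `v`. -/
def dForm (α : ∀ x : M, TangentSpace (𝓡 (2 * n + 1)) x →L[ℝ] ℝ) (x : M)
    (u v : TangentSpace (𝓡 (2 * n + 1)) x) : ℝ :=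
  let D : EuclideanSpace ℝ (Fin (2 * n + 1)) →L[ℝ] EuclideanSpace ℝ (Fin (2 * n + 1)) →L[ℝ] ℝ :=
    fderiv ℝ (coordForm α x) (extChartAt (𝓡 (2 * n + 1)) x x)
  D u v - D v u

/-- `α` is a contact form on the `(2n+1)`-dimensional manifold `M`: a smooth, nowhere vanishing
`1`-form such that `dα` is nondegenerate on the hyperplane field `ξ = ker α`
(equivalently, `α ∧ (dα)^n` vanishes nowhere). -/
structure IsContactForm [IsManifold (𝓡 (2 * n + 1)) ∞ M]
    (α : ∀ x : M, TangentSpace (𝓡 (2 * n + 1)) x →L[ℝ] ℝ) : Prop where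
  contMDiff : ContMDiff (𝓡 (2 * n + 1))
    ((𝓡 (2 * n + 1)).prod 𝓘(ℝ, EuclideanSpace ℝ (Fin (2 * n + 1)) →L[ℝ] ℝ)) ∞
    (fun x : M ↦ Bundle.TotalSpace.mk' (EuclideanSpace ℝ (Fin (2 * n + 1)) →L[ℝ] ℝ)
      (E := fun x : M ↦ TangentSpace (𝓡 (2 * n + 1)) x →L[ℝ] ℝ) x (α x))
  ne_zero : ∀ x, α x ≠ 0
  nondegenerate : ∀ (x : M) (u : TangentSpace (𝓡 (2 * n + 1)) x), α x u = 0 →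
    (∀ v : TangentSpace (𝓡 (2 * n + 1)) x, α x v = 0 → dForm α x u v = 0) → u = 0

/-- `v` is the value at `x` of the Reeb vector field of `α`: `α(v) = 1` and `dα(v, ·) = 0`. -/
def IsReebVector (α : ∀ x : M, TangentSpace (𝓡 (2 * n + 1)) x →L[ℝ] ℝ) (x : M)
    (v : TangentSpace (𝓡 (2 * n + 1)) x) : Prop :=
  α x v = 1 ∧ ∀ w : TangentSpace (𝓡 (2 * n + 1)) x, dForm α x v w = 0

open Classical in
/-- The Reeb vector field of `α` (for a contact form there is exactly one Reeb vector at each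
point; where there is none, the value is `0`). -/
def reebField (α : ∀ x : M, TangentSpace (𝓡 (2 * n + 1)) x →L[ℝ] ℝ) (x : M) :
    TangentSpace (𝓡 (2 * n + 1)) x :=
  if h : ∃ v, IsReebVector α x v then h.choose else 0

/-- The Reeb flow of `α` is defined on `[0, t]` at every point of `S` (automatic if the Reeb flow
is complete, for instance if `M` is closed). -/
def ReebFlowDefinedOn (α : ∀ x : M, TangentSpace (𝓡 (2 * n + 1)) x →L[ℝ] ℝ) (t : ℝ)
    (S : Set M) : Prop :=
  ∀ p ∈ S, ∃ γ : ℝ → M, γ 0 = p ∧ IsMIntegralCurveOn γ (reebField α) (Icc 0 t)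

/-- The image `φ_t^α(S)` of `S` under the time-`t` map of the Reeb flow of `α`, for `t ≥ 0`. -/
def reebImage (α : ∀ x : M, TangentSpace (𝓡 (2 * n + 1)) x →L[ℝ] ℝ) (t : ℝ)
    (S : Set M) : Set M :=
  {q | ∃ γ : ℝ → M, γ 0 ∈ S ∧ IsMIntegralCurveOn γ (reebField α) (Icc 0 t) ∧ γ t = q}

/-- The velocity `d/ds|_{s=t} l_s(p)` of a family of maps `l_t : X → M`. -/
def velocity {X : Type*} (l : ℝ → X → M) (t : ℝ) (p : X) :
    TangentSpace (𝓡 (2 * n + 1)) (l t p) :=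
  mfderiv 𝓘(ℝ, ℝ) (𝓡 (2 * n + 1)) (fun s ↦ l s p) t (1 : ℝ)

/-- `φ_t`, `t ∈ [0, 1]`, is a smooth, compactly supported path of contactomorphisms of
`(M, ker α)`. (Smoothness on `[0, 1] × M` means, as usual, that the family is the restriction of
a smooth one with a larger time interval; values at times outside `[0, 1]` play no role.) -/
structure IsContactPath (α : ∀ x : M, TangentSpace (𝓡 (2 * n + 1)) x →L[ℝ] ℝ)
    (φ : ℝ → M → M) : Prop where
  contMDiff : ContMDiff (𝓘(ℝ, ℝ).prod (𝓡 (2 * n + 1))) (𝓡 (2 * n + 1)) ∞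
    (fun q : ℝ × M ↦ φ q.1 q.2)
  diffeo : ∀ t ∈ Icc (0 : ℝ) 1,
    ∃ Φ : Diffeomorph (𝓡 (2 * n + 1)) (𝓡 (2 * n + 1)) M M ∞, ⇑Φ = φ t
  contact : ∀ t ∈ Icc (0 : ℝ) 1, ∀ (x : M) (v : TangentSpace (𝓡 (2 * n + 1)) x),
    α (φ t x) (mfderiv (𝓡 (2 * n + 1)) (𝓡 (2 * n + 1)) (φ t) x v) = 0 ↔ α x v = 0
  compactSupport : ∃ K : Set M, IsCompact K ∧ ∀ t ∈ Icc (0 : ℝ) 1, ∀ x ∉ K, φ t x = x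

/-- The path of contactomorphisms `φ_t` is non-negative: `α(X_t^φ) ≥ 0`, where
`X_t^φ(φ_t(x)) = d/dt φ_t(x)`. -/
def IsNonnegPath (α : ∀ x : M, TangentSpace (𝓡 (2 * n + 1)) x →L[ℝ] ℝ)
    (φ : ℝ → M → M) : Prop :=
  ∀ t ∈ Icc (0 : ℝ) 1, ∀ x : M, 0 ≤ α (φ t x) (velocity φ t x)

end ContactForm

section Legendrian

variable {n : ℕ} {M : Type*} [TopologicalSpace M]
  [ChartedSpace (EuclideanSpace ℝ (Fin (2 * n + 1))) M]
  {Λ : Type*} [TopologicalSpace Λ] [ChartedSpace (EuclideanSpace ℝ (Fin n)) Λ]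

/-- `f : Λ → M` is a Legendrian embedding of the `n`-manifold `Λ` into the `(2n+1)`-manifold `M`
with contact form `α`: a smooth embedding (an injective immersion that is a homeomorphism onto
its image) which is tangent to `ker α`. -/
structure IsLegendrianEmbedding (α : ∀ x : M, TangentSpace (𝓡 (2 * n + 1)) x →L[ℝ] ℝ)
    (f : Λ → M) : Prop where
  contMDiff : ContMDiff (𝓡 n) (𝓡 (2 * n + 1)) ∞ f
  isEmbedding : Topology.IsEmbedding f
  immersion : ∀ p : Λ, Function.Injective (mfderiv (𝓡 n) (𝓡 (2 * n + 1)) f p)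
  isotropic : ∀ (p : Λ) (v : TangentSpace (𝓡 n) p),
    α (f p) (mfderiv (𝓡 n) (𝓡 (2 * n + 1)) f p v) = 0

/-- `l_t`, `t ∈ [0, 1]`, is a parametrisation of a Legendrian isotopy by the manifold `Λ`.
(Smoothness on `[0, 1] × Λ` means, as usual, that the family is the restriction of a smooth one
with a larger time interval; values at times outside `[0, 1]` play no role.) -/
structure IsLegendrianIsotopy (α : ∀ x : M, TangentSpace (𝓡 (2 * n + 1)) x →L[ℝ] ℝ)
    (l : ℝ → Λ → M) : Prop where
  contMDiff : ContMDiff (𝓘(ℝ, ℝ).prod (𝓡 n)) (𝓡 (2 * n + 1)) ∞ (fun q : ℝ × Λ ↦ l q.1 q.2)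
  legendrian : ∀ t ∈ Icc (0 : ℝ) 1, IsLegendrianEmbedding α (l t)

variable (Λ) in
/-- The Legendrian isotopy class of the Legendrian submanifold `L ⊆ M` parametrised by `Λ`. -/
def isotopyClass (α : ∀ x : M, TangentSpace (𝓡 (2 * n + 1)) x →L[ℝ] ℝ) (L : Set M) :
    Set (Set M) :=
  {L' | ∃ l : ℝ → Λ → M, IsLegendrianIsotopy α l ∧ range (l 0) = L ∧ range (l 1) = L'}

variable (Λ) in
/-- The relation `L₀ ≼ L₁`: there is a non-negative Legendrian isotopy from `L₀` to `L₁`. -/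
def NonnegRel (α : ∀ x : M, TangentSpace (𝓡 (2 * n + 1)) x →L[ℝ] ℝ) (L₀ L₁ : Set M) : Prop :=
  ∃ l : ℝ → Λ → M, IsLegendrianIsotopy α l ∧ range (l 0) = L₀ ∧ range (l 1) = L₁ ∧
    ∀ t ∈ Icc (0 : ℝ) 1, ∀ p : Λ, 0 ≤ α (l t p) (velocity l t p)

variable (Λ) in
/-- A Legendrian isotopy class is orderable if `≼` is a partial order on it. -/
def IsOrderable (α : ∀ x : M, TangentSpace (𝓡 (2 * n + 1)) x →L[ℝ] ℝ) (𝓛 : Set (Set M)) :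
    Prop :=
  IsPartialOrder 𝓛 (fun L₀ L₁ ↦ NonnegRel Λ α (L₀ : Set M) (L₁ : Set M))

open Classical in
variable (Λ) in
/-- The Lorentzian distance `τ_α(L₀, L₁) ∈ [0, ∞]`. If `L₀ ≼ L₁` it is the supremum of
`∫₀¹ min_{L_t} α(X_t^l) dt` over the Legendrian isotopies `l_t = φ_t|_{L₀}`, where `φ_t` is a
compactly supported non-negative path of contactomorphisms with `φ_0(L₀) = L₀` and
`φ_1(L₀) = L₁` (such an `l_t` is automatically a non-negative Legendrian isotopy); otherwise
it is `0`. -/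
def lorentzianDistance (α : ∀ x : M, TangentSpace (𝓡 (2 * n + 1)) x →L[ℝ] ℝ)
    (L₀ L₁ : Set M) : ℝ≥0∞ :=
  if NonnegRel Λ α L₀ L₁ then
    ⨆ (φ : ℝ → M → M) (_ : IsContactPath α φ) (_ : IsNonnegPath α φ)
      (_ : φ 0 '' L₀ = L₀) (_ : φ 1 '' L₀ = L₁),
      ENNReal.ofReal (∫ t in (0 : ℝ)..1, ⨅ p : L₀, α (φ t p) (velocity φ t (p : M)))
  else 0

end Legendrian

end LegendrianOrder

end

set_option linter.unusedSectionVars false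

universe u

noncomputable section

/-! Everything rests on one formula (`IsPosPath.form_velocity_comp`): if ψ_s multiplies `α` by a
positive conformal factor λ, then t ↦ ψ_{θ(t)} ∘ φ_t has `α`-speed θ' α(∂ψ) + λ α(∂φ). Two motions
can therefore run simultaneously, and positivity of one pays for negativity of the other.

Orderable implies finite (`IsOrderable.lorentzianDistance_lt_top`): fix a contact isotopy ψ from L₁
back to L₀, with speed at least -κ and conformal factor at least c > 0. Suppose a competitor φ has
minimal speed m(t) with ∫ m > κ/c. Choose s with 0 ≤ s' ≤ m, s(0) = 0 and s(1) = κ/c, and follow φ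
while running ψ at time s/(κ/c). The result is a loop at L₀ of speed at least c(m - s') ≥ 0. By
antisymmetry each stage of a non-negative loop has the same image, so its speed vanishes
(`IsOrderable.form_velocity_eq_zero`). Hence m ≤ s' and ∫ m ≤ κ/c, a contradiction.

Finite implies orderable (`IsContactForm.isOrderable_of_lt_top`): if antisymmetry fails, L₀ ≼ L₁ ≼
L₀ with L₀ ≠ L₁ gives a non-negative loop at some S in the class that is positive at time 0 at one
point of S (`IsContactForm.exists_loop`). Contactomorphisms preserving S act transitively on it,
because Λ is connected. Composing finitely many conjugates of the loop makes it positive on all of S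
at time 0 (`IsNonnegLoop.exists_pos`). Its k-fold concatenations then have arbitrarily large
minimal-speed integral, so τ(S, S) = ∞.

Reeb translates (`IsOrderable.lorentzianDistance_reebImage`): the Reeb flow, cut off to compact
support, realises the value t. The upper bound repeats the first argument with the backward cut-off
flow as ψ. There the Hamiltonian is transported by the conformal factor itself, so the factor
cancels and no constant is lost.

The supporting geometry is built on the way: smooth dependence of flows, contact Hamiltonians, and
the extension of Legendrian isotopies to contact isotopies
(`IsContactForm.exists_posPath_of_isotopy`). -/

namespace LegendrianOrder
-- Smoothness of post-composition on spaces of continuous maps.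
section SuperpositionOperator

variable {K : Type*} [TopologicalSpace K] [CompactSpace K]

set_option synthInstance.maxHeartbeats 200000 in
/-- The pointwise extension of a bounded bilinear map to continuous families. -/
def pointwiseBilin {E F G : Type*} [NormedAddCommGroup E] [NormedSpace ℝ E]
    [NormedAddCommGroup F] [NormedSpace ℝ F] [NormedAddCommGroup G] [NormedSpace ℝ G]
    (B : G →L[ℝ] E →L[ℝ] F) :
    C(K, G) →L[ℝ] C(K, E) →L[ℝ] C(K, F) :=
  LinearMap.mkContinuous₂
    (LinearMap.mk₂ ℝ (fun (A : C(K, G)) (v : C(K, E)) ↦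
        (⟨fun k ↦ B (A k) (v k), (B.continuous.comp A.continuous).clm_apply v.continuous⟩ :
          C(K, F)))
      (fun _ _ _ ↦ by ext; simp) (fun _ _ _ ↦ by ext; simp)
      (fun _ _ _ ↦ by ext; simp) (fun _ _ _ ↦ by ext; simp)) ‖B‖
    (fun A v ↦ by
      rw [ContinuousMap.norm_le _ (by positivity)]
      intro k
      simp only [LinearMap.mk₂_apply, ContinuousMap.coe_mk]
      exact (B.le_opNorm₂ _ _).trans
        (mul_le_mul (mul_le_mul_of_nonneg_left (A.norm_coe_le_norm k) B.opNorm_nonneg)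
          (v.norm_coe_le_norm k) (norm_nonneg _) (mul_nonneg B.opNorm_nonneg (norm_nonneg _))))

theorem pointwiseBilin_apply {E F G : Type*} [NormedAddCommGroup E] [NormedSpace ℝ E]
    [NormedAddCommGroup F] [NormedSpace ℝ F] [NormedAddCommGroup G] [NormedSpace ℝ G]
    (B : G →L[ℝ] E →L[ℝ] F) (A : C(K, G)) (v : C(K, E)) (k : K) :
    pointwiseBilin B A v k = B (A k) (v k) := rfl

/-- The range of γ is compact, so f' varies by at most ε on balls of one common radius around its
points. The mean value inequality on these balls bounds the remainder uniformly in k, as the sup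
norm requires. -/
theorem hasFDerivAt_postcomp {E F : Type*} [NormedAddCommGroup E] [NormedSpace ℝ E]
    [NormedAddCommGroup F] [NormedSpace ℝ F] (f : C(E, F)) (f' : C(E, E →L[ℝ] F))
    (hf : ∀ x, HasFDerivAt f (f' x) x) (γ : C(K, E)) :
    HasFDerivAt (fun γ : C(K, E) ↦ f.comp γ) (pointwiseBilin (ContinuousLinearMap.id ℝ (E →L[ℝ] F)) (f'.comp γ)) γ := by
  rw [hasFDerivAt_iff_isLittleO_nhds_zero, Asymptotics.isLittleO_iff]
  intro ε hε
  have hK : IsCompact (range γ) := isCompact_range γ.continuous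
  have hu := hK.uniformContinuousAt_of_continuousAt f'
    (fun x _ ↦ f'.continuous.continuousAt) (Metric.dist_mem_uniformity hε)
  obtain ⟨δ, hδ, hδ'⟩ := Metric.mem_uniformity_dist.1 hu
  filter_upwards [Metric.ball_mem_nhds (0 : C(K, E)) hδ] with v hv
  rw [ContinuousMap.norm_le _ (by positivity)]
  intro k
  have hvk : ‖v k‖ < δ := (v.norm_coe_le_norm k).trans_lt (by simpa using hv)
  have := (convex_ball (γ k) δ).norm_image_sub_le_of_norm_hasFDerivWithin_le'
    (f := f) (f' := f') (φ := f' (γ k)) (C := ε) (x := γ k) (y := γ k + v k)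
    (fun x _ ↦ (hf x).hasFDerivWithinAt)
    (fun x hx ↦ by
      have := hδ' (a := γ k) (b := x) (by rwa [dist_comm]) ⟨k, rfl⟩
      rw [← dist_eq_norm, dist_comm]; exact le_of_lt this)
    (Metric.mem_ball_self hδ) (by simpa using hvk)
  simp only [add_sub_cancel_left] at this
  simpa [pointwiseBilin_apply] using this.trans
    (mul_le_mul_of_nonneg_left (v.norm_coe_le_norm k) hε.le)

-- The derivative is post-composition with f', followed by a bounded bilinear operation, so the
-- statement for n applied to f' gives n + 1. The target F changes in the induction, and a common
-- universe keeps `E →L[ℝ] F` admissible.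
set_option synthInstance.maxHeartbeats 400000 in
theorem contDiff_postcomp_nat {E : Type u} [NormedAddCommGroup E] [NormedSpace ℝ E] (n : ℕ) :
    ∀ {F : Type u} [NormedAddCommGroup F] [NormedSpace ℝ F] (f : C(E, F)), ContDiff ℝ ∞ f →
      ContDiff ℝ n (fun γ : C(K, E) ↦ f.comp γ) := by
  induction n with
  | zero =>
    intro F _ _ f _
    exact contDiff_zero.2 (ContinuousMap.continuous_postcomp f)
  | succ n ih =>
    intro F _ _ f hf
    have hf' := (contDiff_infty_iff_fderiv.1 hf)
    let f' : C(E, E →L[ℝ] F) := ⟨fderiv ℝ f, hf'.2.continuous⟩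
    have hd := hasFDerivAt_postcomp (K := K) f f' (fun x ↦ (hf'.1 x).hasFDerivAt)
    push_cast
    rw [contDiff_succ_iff_fderiv]
    refine ⟨fun γ ↦ (hd γ).differentiableAt, by simp, ?_⟩
    have : fderiv ℝ (fun γ : C(K, E) ↦ f.comp γ) = 
        fun γ ↦ pointwiseBilin (ContinuousLinearMap.id ℝ (E →L[ℝ] F)) (f'.comp γ) :=
      funext fun γ ↦ (hd γ).fderiv
    rw [this]
    exact (pointwiseBilin (ContinuousLinearMap.id ℝ (E →L[ℝ] F))).contDiff.comp (ih f' hf'.2)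

theorem contDiff_postcomp {E F : Type u} [NormedAddCommGroup E] [NormedSpace ℝ E]
    [NormedAddCommGroup F] [NormedSpace ℝ F] (f : C(E, F)) (hf : ContDiff ℝ ∞ f) :
    ContDiff ℝ ∞ (fun γ : C(K, E) ↦ f.comp γ) :=
  contDiff_infty.2 fun n ↦ contDiff_postcomp_nat n f hf

end SuperpositionOperator

/-! ### Local flows in Banach spaces by the inverse function theorem. -/

section LocalFlow

variable {E : Type*} [NormedAddCommGroup E] [NormedSpace ℝ E] [CompleteSpace E]

/-- Extension of a curve on `[-2, 2]` to `ℝ`, constant outside. -/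
def extendCurve (γ : C(Icc (-2 : ℝ) 2, E)) (t : ℝ) : E :=
  γ (projIcc (-2 : ℝ) 2 (by norm_num) t)

theorem continuous_extendCurve (γ : C(Icc (-2 : ℝ) 2, E)) : Continuous (extendCurve γ) :=
  γ.continuous.comp continuous_projIcc

/-- The primitive vanishing at `0`, as a bounded operator on curves. -/
def primitive (E : Type*) [NormedAddCommGroup E] [NormedSpace ℝ E] [CompleteSpace E] :
    C(Icc (-2 : ℝ) 2, E) →L[ℝ] C(Icc (-2 : ℝ) 2, E) :=
  LinearMap.mkContinuous
    { toFun := fun γ ↦ ⟨fun s ↦ ∫ u in (0 : ℝ)..s, extendCurve γ u,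
        (intervalIntegral.continuous_primitive
          (fun a b ↦ (continuous_extendCurve γ).intervalIntegrable a b) 0).comp
          continuous_subtype_val⟩
      map_add' := fun γ η ↦ by
        ext s
        exact intervalIntegral.integral_add ((continuous_extendCurve γ).intervalIntegrable _ _)
          ((continuous_extendCurve η).intervalIntegrable _ _)
      map_smul' := fun c γ ↦ by
        ext s
        exact intervalIntegral.integral_smul c _ } 2
    (fun γ ↦ by
      rw [ContinuousMap.norm_le _ (by positivity)]
      intro s
      have := intervalIntegral.norm_integral_le_of_norm_le_const (a := 0) (b := (s : ℝ))
        (f := extendCurve γ) (C := ‖γ‖) (fun u _ ↦ γ.norm_coe_le_norm _)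
      refine this.trans ?_
      rw [mul_comm]
      refine mul_le_mul_of_nonneg_right ?_ (norm_nonneg _)
      rw [sub_zero, abs_le]
      exact ⟨s.2.1, s.2.2⟩)

/-- The constant curves, as a bounded operator. -/
def constCurve (E : Type*) [NormedAddCommGroup E] [NormedSpace ℝ E] :
    E →L[ℝ] C(Icc (-2 : ℝ) 2, E) :=
  LinearMap.mkContinuous
    { toFun := fun x ↦ ContinuousMap.const _ x
      map_add' := fun _ _ ↦ rfl
      map_smul' := fun _ _ ↦ rfl } 1
    (fun x ↦ by
      rw [ContinuousMap.norm_le _ (by positivity)]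
      intro s
      rw [one_mul]
      exact le_rfl)

/-- Smooth dependence on the initial value and on a time scaling, for short times. -/
theorem exists_local_flow_curve {f : E → E} (hf : ContDiff ℝ ∞ f) (x₀ : E) :
    ∃ c : ℝ × E → ℝ → E,
      (∀ᶠ q in 𝓝 ((0 : ℝ), x₀), c q 0 = q.2 ∧
        (∀ s ∈ Ioo (-2 : ℝ) 2, HasDerivAt (c q) (q.1 • f (c q s)) s)) ∧
      ContDiffAt ℝ ∞ (fun q ↦ c q 1) (0, x₀) ∧
      ∀ U ∈ 𝓝 x₀, ∀ᶠ q in 𝓝 ((0 : ℝ), x₀), ∀ s ∈ Ioo (-2 : ℝ) 2, c q s ∈ U := by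
  let fc : C(E, E) := ⟨f, hf.continuous⟩
  let N : C(Icc (-2 : ℝ) 2, E) → C(Icc (-2 : ℝ) 2, E) := fun γ ↦ fc.comp γ
  have hN : ContDiff ℝ ∞ N := contDiff_postcomp fc hf
  -- The second component vanishes exactly when γ solves the integral equation γ = x + τ ∫ f(γ).
  -- Scaling the field by τ keeps the time interval fixed, and small τ replaces short time.
  let Ψ : (ℝ × E) × C(Icc (-2 : ℝ) 2, E) → (ℝ × E) × C(Icc (-2 : ℝ) 2, E) := fun w ↦
    (w.1, w.2 - constCurve E w.1.2 - w.1.1 • primitive E (N w.2))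
  have hΨ : ContDiff ℝ ∞ Ψ := by
    refine contDiff_fst.prodMk ((contDiff_snd.sub
      ((constCurve E).contDiff.comp (contDiff_snd.comp contDiff_fst))).sub
      ((contDiff_fst.comp contDiff_fst).smul
        ((primitive E).contDiff.comp (hN.comp contDiff_snd))))
  let γ₀ := constCurve E x₀
  let A : (ℝ × E) →L[ℝ] C(Icc (-2 : ℝ) 2, E) :=
    -((constCurve E).comp (ContinuousLinearMap.snd ℝ ℝ E)) -
      (ContinuousLinearMap.fst ℝ ℝ E).smulRight (primitive E (N γ₀))
  -- At τ = 0 the derivative in γ is the identity, so the full derivative is triangular and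
  -- invertible without any smallness estimate.
  let e : ((ℝ × E) × C(Icc (-2 : ℝ) 2, E)) ≃L[ℝ] ((ℝ × E) × C(Icc (-2 : ℝ) 2, E)) :=
    (ContinuousLinearEquiv.refl ℝ _).skewProd (ContinuousLinearEquiv.refl ℝ _) A
  have hd : HasFDerivAt Ψ (e : _ →L[ℝ] _) ((0, x₀), γ₀) := by
    have h1 : HasFDerivAt (fun w : (ℝ × E) × C(Icc (-2 : ℝ) 2, E) ↦ primitive E (N w.2))
        (fderiv ℝ (fun w : (ℝ × E) × C(Icc (-2 : ℝ) 2, E) ↦ primitive E (N w.2)) ((0, x₀), γ₀))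
        ((0, x₀), γ₀) :=
      ((((primitive E).contDiff.comp (hN.comp contDiff_snd)).differentiable
        (by simp)) _).hasFDerivAt
    have h2 := (((hasFDerivAt_snd (𝕜 := ℝ) (p := (((0 : ℝ), x₀), γ₀))).sub
      ((constCurve E).hasFDerivAt.comp _ ((hasFDerivAt_snd (𝕜 := ℝ)).comp _
        (hasFDerivAt_fst (𝕜 := ℝ) (p := (((0 : ℝ), x₀), γ₀)))))).sub
      (((hasFDerivAt_fst (𝕜 := ℝ)).comp _
        (hasFDerivAt_fst (𝕜 := ℝ) (p := (((0 : ℝ), x₀), γ₀)))).smul h1))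
    have h3 := (hasFDerivAt_fst (𝕜 := ℝ) (p := (((0 : ℝ), x₀), γ₀))).prodMk h2
    refine h3.congr_fderiv ?_
    ext w <;> simp [e, A]
  have hs : HasStrictFDerivAt Ψ (e : _ →L[ℝ] _) ((0, x₀), γ₀) :=
    hΨ.contDiffAt.hasStrictFDerivAt' hd (by simp)
  have hΨ₀ : Ψ ((0, x₀), γ₀) = ((0, x₀), 0) := by simp [Ψ, γ₀]
  let G : ℝ × E → C(Icc (-2 : ℝ) 2, E) := fun q ↦ (hs.localInverse Ψ e _ (q, 0)).2
  have hG : ContDiffAt ℝ ∞ G (0, x₀) := by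
    have := hΨ.contDiffAt.to_localInverse (n := ∞) (a := ((0, x₀), γ₀)) hd (by simp)
    rw [hΨ₀] at this
    exact contDiffAt_snd.comp _ (this.comp (0, x₀) (contDiffAt_id.prodMk contDiffAt_const))
  have hG₀ : G (0, x₀) = γ₀ := by
    have := hs.localInverse_apply_image
    rw [hΨ₀] at this
    simp only [G, this]
  have hcont : Filter.Tendsto (fun q : ℝ × E ↦ (q, (0 : C(Icc (-2 : ℝ) 2, E))))
      (𝓝 (0, x₀)) (𝓝 (Ψ ((0, x₀), γ₀))) := by
    rw [hΨ₀]
    exact (Continuous.prodMk continuous_id continuous_const).tendsto _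
  have hG' : ∀ᶠ q in 𝓝 ((0 : ℝ), x₀),
      G q = constCurve E q.2 + q.1 • primitive E (N (G q)) := by
    filter_upwards [hcont.eventually hs.eventually_right_inverse] with q hq
    have h1 := congrArg Prod.fst hq
    have h2 := congrArg Prod.snd hq
    simp only [Ψ] at h1 h2
    rw [h1, sub_sub, sub_eq_zero] at h2
    exact h2
  let c : ℝ × E → ℝ → E := fun q s ↦ q.2 + q.1 • ∫ u in (0 : ℝ)..s, extendCurve (N (G q)) u
  have hc : ∀ᶠ q in 𝓝 ((0 : ℝ), x₀), ∀ s (hs : s ∈ Icc (-2 : ℝ) 2), c q s = G q ⟨s, hs⟩ := by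
    filter_upwards [hG'] with q hq s hs
    conv_rhs => rw [hq]
    rfl
  refine ⟨c, ?_, ?_, ?_⟩
  · filter_upwards [hc] with q hq
    refine ⟨by simp [c], fun s hs ↦ ?_⟩
    have hs' : s ∈ Icc (-2 : ℝ) 2 := Ioo_subset_Icc_self hs
    have h1 : HasDerivAt (fun s ↦ ∫ u in (0 : ℝ)..s, extendCurve (N (G q)) u)
        (extendCurve (N (G q)) s) s :=
      intervalIntegral.integral_hasDerivAt_right
        ((continuous_extendCurve _).intervalIntegrable _ _)
        ((continuous_extendCurve _).stronglyMeasurableAtFilter _ _)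
        (continuous_extendCurve _).continuousAt
    have h2 : extendCurve (N (G q)) s = f (c q s) := by
      rw [hq s hs', extendCurve, projIcc_of_mem _ hs']
      rfl
    rw [← h2]
    exact (h1.const_smul q.1).const_add q.2
  -- The scaled curve at s = 1 is the flow at time τ. The interval [-2, 2] is used so that 1 is an
  -- interior point.
  · have h1 : (1 : ℝ) ∈ Icc (-2 : ℝ) 2 := by constructor <;> norm_num
    have h2 : ContDiffAt ℝ ∞ (fun q ↦ G q ⟨1, h1⟩) (0, x₀) :=
      (ContinuousMap.evalCLM (M := E) ℝ (⟨1, h1⟩ : Icc (-2 : ℝ) 2)).contDiff.contDiffAt.comp _ hG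
    refine h2.congr_of_eventuallyEq ?_
    filter_upwards [hc] with q hq
    exact hq 1 h1
  · intro U hU
    obtain ⟨δ, hδ, hδU⟩ := Metric.mem_nhds_iff.1 hU
    have := hG.continuousAt.tendsto.eventually (Metric.ball_mem_nhds _ hδ)
    filter_upwards [this, hc] with q hq hcq s hs
    apply hδU
    rw [hcq s (Ioo_subset_Icc_self hs), Metric.mem_ball]
    rw [hG₀] at hq
    exact (ContinuousMap.dist_apply_le_dist (f := G q) (g := γ₀) _).trans_lt hq

end LocalFlow

/-! ### Smoothness of tangent maps on open sets. -/

section TangentMaps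

variable {E : Type*} [NormedAddCommGroup E] [NormedSpace ℝ E]
  {H : Type*} [TopologicalSpace H] {I : ModelWithCorners ℝ E H}
  {N : Type*} [TopologicalSpace N] [ChartedSpace H N] [IsManifold I ∞ N]
  {E' : Type*} [NormedAddCommGroup E'] [NormedSpace ℝ E']
  {H' : Type*} [TopologicalSpace H'] {I' : ModelWithCorners ℝ E' H'}
  {N' : Type*} [TopologicalSpace N'] [ChartedSpace H' N'] [IsManifold I' ∞ N']

theorem contMDiffAt_tangentMap {f : N → N'} {U : Set N} (hU : IsOpen U)
    (hf : ContMDiffOn I I' ∞ f U) (v : TangentBundle I N) (hv : v.proj ∈ U) :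
    ContMDiffAt I.tangent I'.tangent ∞ (tangentMap I I' f) v := by
  have h1 := hf.contMDiffOn_tangentMapWithin (m := ∞) (by simp) hU.uniqueMDiffOn
  have h2 : (Bundle.TotalSpace.proj ⁻¹' U : Set (TangentBundle I N)) ∈ 𝓝 v :=
    (hU.preimage (FiberBundle.continuous_proj E (TangentSpace I))).mem_nhds hv
  refine (h1.contMDiffAt h2).congr_of_eventuallyEq ?_
  filter_upwards [h2] with w hw
  simp only [tangentMap, tangentMapWithin, mfderivWithin_of_isOpen hU hw]

end TangentMaps

/-! ### Local flows on manifolds. -/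

section ManifoldFlow

variable {E : Type*} [NormedAddCommGroup E] [NormedSpace ℝ E] [FiniteDimensional ℝ E]
  {H : Type*} [TopologicalSpace H] {I : ModelWithCorners ℝ E H}
  {N : Type*} [TopologicalSpace N] [ChartedSpace H N] [IsManifold I ∞ N]
  [I.Boundaryless]

/-- The coordinate expression, in the chart at `x₀`, of a smooth vector field is smooth. -/
theorem contMDiffAt_coord_vectorField {v : ∀ x : N, TangentSpace I x} {x₀ x : N}
    (hv : ContMDiffAt I I.tangent ∞ (fun x ↦ (⟨x, v x⟩ : TangentBundle I N)) x)
    (hx : x ∈ (chartAt H x₀).source) :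
    ContMDiffAt I 𝓘(ℝ, E) ∞
      (fun x ↦ (mfderiv I 𝓘(ℝ, E) (extChartAt I x₀) x (v x) : E)) x := by
  have h2 := contMDiffAt_tangentMap (chartAt H x₀).open_source
    (contMDiffOn_extChartAt (I := I) (n := ∞) (x := x₀)) ⟨x, v x⟩ hx
  have h3 := h2.comp x hv
  exact (contMDiff_snd_tangentBundle_modelSpace E 𝓘(ℝ, E) (n := ∞)).contMDiffAt.comp x h3

theorem hasMFDerivAt_extChartAt_symm {x₀ : N} {y : E} (hy : y ∈ (extChartAt I x₀).target) :
    HasMFDerivAt 𝓘(ℝ, E) I (extChartAt I x₀).symm y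
      (mfderiv 𝓘(ℝ, E) I (extChartAt I x₀).symm y) := by
  have := (contMDiffOn_extChartAt_symm (I := I) (n := ∞) x₀).contMDiffAt
    ((isOpen_extChartAt_target (I := I) x₀).mem_nhds hy)
  exact (this.mdifferentiableAt (by simp)).hasMFDerivAt

theorem mfderiv_extChartAt_symm_comp {x₀ x : N} (hx : x ∈ (extChartAt I x₀).source)
    (u : TangentSpace I x) :
    mfderiv 𝓘(ℝ, E) I (extChartAt I x₀).symm (extChartAt I x₀ x)
      (mfderiv I 𝓘(ℝ, E) (extChartAt I x₀) x u) = u := by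
  have h1 := hasMFDerivAt_extChartAt (I := I) (x := x₀) (y := x)
    (by rwa [extChartAt_source] at hx)
  have h2 := hasMFDerivAt_extChartAt_symm (I := I) ((extChartAt I x₀).map_source hx)
  have h3 := h2.comp x h1
  have h4 : HasMFDerivAt I I ((extChartAt I x₀).symm ∘ extChartAt I x₀) x
      (ContinuousLinearMap.id ℝ (TangentSpace I x)) := by
    refine (hasMFDerivAt_id (I := I) x).congr_of_eventuallyEq ?_
    filter_upwards [(isOpen_extChartAt_source (I := I) x₀).mem_nhds hx] with z hz
    exact (extChartAt I x₀).left_inv hz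
  have h5 := hasMFDerivAt_unique h3 h4
  have h6 := congrArg (fun L : E →L[ℝ] E ↦ L u) h5
  rw [h1.mfderiv]
  exact h6

/-- Short integral curves through the points near `x₀`, depending smoothly on the time scaling
and on the initial point. -/
theorem exists_local_integralCurves {v : ∀ x : N, TangentSpace I x}
    (hv : ContMDiff I I.tangent ∞ (fun x ↦ (⟨x, v x⟩ : TangentBundle I N))) (x₀ : N) :
    ∃ c : ℝ × N → ℝ → N,
      (∀ᶠ q in 𝓝 ((0 : ℝ), x₀), c q 0 = q.2 ∧
        IsMIntegralCurveOn (c q) (fun x ↦ q.1 • v x) (Ioo (-2 : ℝ) 2)) ∧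
      ContMDiffAt (𝓘(ℝ, ℝ).prod I) I ∞ (fun q ↦ c q 1) (0, x₀) := by
  set e := extChartAt I x₀ with he
  let f₀ : E → E := fun y ↦ mfderiv I 𝓘(ℝ, E) e (e.symm y) (v (e.symm y))
  have hT : IsOpen e.target := isOpen_extChartAt_target (I := I) x₀
  have hx₀ : e x₀ ∈ e.target := mem_extChartAt_target (I := I) x₀
  have hf₀ : ∀ y ∈ e.target, ContDiffAt ℝ ∞ f₀ y := by
    intro y hy
    rw [← contMDiffAt_iff_contDiffAt]
    have h1 : e.symm y ∈ (chartAt H x₀).source := by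
      rw [← extChartAt_source I]; exact e.map_target hy
    exact (contMDiffAt_coord_vectorField (x₀ := x₀) hv.contMDiffAt h1).comp y
      ((contMDiffOn_extChartAt_symm (I := I) (n := ∞) x₀).contMDiffAt (hT.mem_nhds hy))
  obtain ⟨r, hr, hrT⟩ := Metric.isOpen_iff.1 hT _ hx₀
  -- The field is known only on the chart target. The bump extends it by zero to the model space and
  -- equals 1 on the ball of radius r/3, where the short curves will stay.
  let b : ContDiffBump (e x₀) := ⟨r / 3, r / 2, by positivity, by linarith⟩
  let f : E → E := fun y ↦ b y • f₀ y
  have hf : ContDiff ℝ ∞ f := by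
    rw [contDiff_iff_contDiffAt]
    intro y
    by_cases hy : y ∈ Metric.ball (e x₀) r
    · exact b.contDiff.contDiffAt.smul (hf₀ y (hrT hy))
    · have : ∀ᶠ z in 𝓝 y, z ∉ tsupport b := by
        refine (isClosed_tsupport b).isOpen_compl.mem_nhds ?_
        rw [b.tsupport_eq]
        intro h
        exact hy (Metric.closedBall_subset_ball (by simp only [b]; linarith) h)
      refine (contDiffAt_const (c := (0 : E))).congr_of_eventuallyEq ?_
      filter_upwards [this] with z hz
      simp only [f, image_eq_zero_of_notMem_tsupport hz, zero_smul]
  obtain ⟨c, hc, hcs, hcU⟩ := exists_local_flow_curve hf (e x₀)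
  have hU : Metric.ball (e x₀) (r / 3) ∈ 𝓝 (e x₀) := Metric.ball_mem_nhds _ (by positivity)
  have hcont : ContMDiffAt (𝓘(ℝ, ℝ).prod I) 𝓘(ℝ, ℝ × E) ∞
      (fun q : ℝ × N ↦ (q.1, e q.2)) ((0 : ℝ), x₀) := by
    refine contMDiffAt_fst.prodMk_space ?_
    exact (contMDiffAt_extChartAt (I := I) (n := ∞) (x := x₀)).comp _ contMDiffAt_snd
  have ht := hcont.continuousAt.tendsto
  refine ⟨fun q s ↦ e.symm (c (q.1, e q.2) s), ?_, ?_⟩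
  · filter_upwards [ht.eventually hc, ht.eventually (hcU _ hU),
      continuousAt_snd.tendsto.eventually (extChartAt_source_mem_nhds (I := I) x₀)]
      with q h1 h2 h3
    refine ⟨by rw [h1.1]; exact e.left_inv h3, fun s hs ↦ ?_⟩
    have hys : c (q.1, e q.2) s ∈ e.target := by
      apply hrT
      exact Metric.ball_subset_ball (by linarith) (h2 s hs)
    have hb : b (c (q.1, e q.2) s) = 1 :=
      b.one_of_mem_closedBall (Metric.ball_subset_closedBall (h2 s hs))
    have hd := (h1.2 s hs).hasFDerivAt.hasMFDerivAt
    have h5 := (hasMFDerivAt_extChartAt_symm (I := I) hys).comp s hd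
    refine (h5.congr_mfderiv ?_).hasMFDerivWithinAt
    ext
    have h6 := mfderiv_extChartAt_symm_comp (I := I) (x₀ := x₀) (e.map_target hys)
      (v (e.symm (c (q.1, e q.2) s)))
    rw [← he, e.right_inv hys] at h6
    simp only [f, hb, f₀]
    let L : E →L[ℝ] E := mfderiv 𝓘(ℝ, E) I e.symm (c (q.1, e q.2) s)
    let w : E := mfderiv I 𝓘(ℝ, E) e (e.symm (c (q.1, e q.2) s)) (v (e.symm (c (q.1, e q.2) s)))
    let w' : E := v (e.symm (c (q.1, e q.2) s))
    have h7 : L w = w' := h6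
    change L ((1 : ℝ) • (q.1 • (1 : ℝ) • w)) = (1 : ℝ) • (q.1 • w')
    rw [one_smul, one_smul, one_smul, map_smul, h7]
  · have h1 : ContMDiffAt 𝓘(ℝ, E) I ∞ e.symm (c (0, e x₀) 1) := by
      refine (contMDiffOn_extChartAt_symm (I := I) (n := ∞) x₀).contMDiffAt (hT.mem_nhds ?_)
      apply hrT
      exact Metric.ball_subset_ball (by linarith) ((hcU _ hU).self_of_nhds 1 ⟨by norm_num, by norm_num⟩)
    exact ContMDiffAt.comp (g := e.symm) (f := fun q : ℝ × N ↦ c (q.1, e q.2) 1) ((0 : ℝ), x₀) h1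
      (ContMDiffAt.comp (g := fun q ↦ c q 1) (f := fun q : ℝ × N ↦ (q.1, e q.2)) ((0 : ℝ), x₀)
        hcs.contMDiffAt hcont)

end ManifoldFlow

/-! ### Global flows, autonomous and time-dependent. -/

section GlobalFlow

variable {E : Type*} [NormedAddCommGroup E] [NormedSpace ℝ E] [FiniteDimensional ℝ E]
  {H : Type*} [TopologicalSpace H] {I : ModelWithCorners ℝ E H}
  {N : Type*} [TopologicalSpace N] [ChartedSpace H N] [IsManifold I ∞ N]
  [I.Boundaryless] [T2Space N]

theorem contMDiff_one_vectorField {v : ∀ x : N, TangentSpace I x}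
    (hv : ContMDiff I I.tangent ∞ (fun x ↦ (⟨x, v x⟩ : TangentBundle I N))) :
    ContMDiff I I.tangent 1 (fun x ↦ (⟨x, v x⟩ : TangentBundle I N)) :=
  hv.of_le (by simp)

theorem contMDiff_smul_vectorField {v : ∀ x : N, TangentSpace I x}
    (hv : ContMDiff I I.tangent ∞ (fun x ↦ (⟨x, v x⟩ : TangentBundle I N))) (a : ℝ) :
    ContMDiff I I.tangent ∞ (fun x ↦ (⟨x, a • v x⟩ : TangentBundle I N)) :=
  fun x ↦ (hv x).const_smul_section (V := TangentSpace I) (a := a)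

/-- A family of integral curves of a smooth vector field is jointly smooth near time `0`. -/
theorem contMDiffAt_flow_zero {v : ∀ x : N, TangentSpace I x}
    (hv : ContMDiff I I.tangent ∞ (fun x ↦ (⟨x, v x⟩ : TangentBundle I N)))
    {Φ : ℝ → N → N} (h0 : ∀ x, Φ 0 x = x) (hΦ : ∀ x, IsMIntegralCurve (fun t ↦ Φ t x) v)
    (x₀ : N) :
    ContMDiffAt (𝓘(ℝ, ℝ).prod I) I ∞ (fun q : ℝ × N ↦ Φ q.1 q.2) (0, x₀) := by
  obtain ⟨c, hc, hcs⟩ := exists_local_integralCurves hv x₀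
  refine hcs.congr_of_eventuallyEq ?_
  filter_upwards [hc] with q hq
  -- Slowing the orbit by q.1 makes it comparable with the local solution c q; at parameter 1 it is
  -- at time q.1.
  have h1 : IsMIntegralCurve ((fun t ↦ Φ t q.2) ∘ (· * q.1)) (q.1 • v) := (hΦ q.2).comp_mul q.1
  have h2 := isMIntegralCurveOn_Ioo_eqOn_of_contMDiff_boundaryless (t₀ := 0) (a := -2) (b := 2)
    (by simp) (contMDiff_one_vectorField (contMDiff_smul_vectorField hv q.1))
    (h1.isMIntegralCurveOn _) hq.2 (by simp [h0, hq.1])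
  have h3 := h2 (x := 1) ⟨by norm_num, by norm_num⟩
  simpa using h3

theorem flow_add {v : ∀ x : N, TangentSpace I x}
    (hv : ContMDiff I I.tangent ∞ (fun x ↦ (⟨x, v x⟩ : TangentBundle I N)))
    {Φ : ℝ → N → N} (h0 : ∀ x, Φ 0 x = x) (hΦ : ∀ x, IsMIntegralCurve (fun t ↦ Φ t x) v)
    (s t : ℝ) (x : N) : Φ (s + t) x = Φ s (Φ t x) := by
  have h1 : IsMIntegralCurve ((fun t ↦ Φ t x) ∘ (· + t)) v := (hΦ x).comp_add t
  have h2 := isMIntegralCurve_Ioo_eq_of_contMDiff_boundaryless (t₀ := 0)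
    (contMDiff_one_vectorField hv) h1 (hΦ (Φ t x)) (by simp [h0])
  exact congrFun h2 s

/-- The times t at which the flow is smooth near (t, x) form a clopen set. The group law writes the
flow near a later time as the flow near time 0, known to be smooth, composed with an earlier time
map. -/
theorem contMDiff_flow {v : ∀ x : N, TangentSpace I x}
    (hv : ContMDiff I I.tangent ∞ (fun x ↦ (⟨x, v x⟩ : TangentBundle I N)))
    {Φ : ℝ → N → N} (h0 : ∀ x, Φ 0 x = x) (hΦ : ∀ x, IsMIntegralCurve (fun t ↦ Φ t x) v) :
    ContMDiff (𝓘(ℝ, ℝ).prod I) I ∞ (fun q : ℝ × N ↦ Φ q.1 q.2) := by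
  -- Finite orders are treated one at a time: differentiability of finite order at a point spreads
  -- to a neighbourhood, order ∞ need not.
  rw [contMDiff_infty]
  intro n
  have hloc : ∀ y : N, ContMDiffAt (𝓘(ℝ, ℝ).prod I) I n (fun q : ℝ × N ↦ Φ q.1 q.2) (0, y) :=
    fun y ↦ (contMDiffAt_flow_zero hv h0 hΦ y).of_le (by exact_mod_cast le_top)
  rintro ⟨t, x⟩
  let S : Set ℝ := {t | ContMDiffAt (𝓘(ℝ, ℝ).prod I) I n (fun q : ℝ × N ↦ Φ q.1 q.2) (t, x)}
  -- One two-sided statement serves both halves: t = t₀ gives openness of S, and t' = t₀ gives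
  -- openness of its complement.
  have hev : ∀ t₀ : ℝ, ∀ᶠ t in 𝓝 t₀, ∀ᶠ t' in 𝓝 t₀, t ∈ S → t' ∈ S := by
    intro t₀
    have h1 : ∀ᶠ q in 𝓝 ((0 : ℝ), Φ t₀ x),
        ContMDiffAt (𝓘(ℝ, ℝ).prod I) I n (fun q : ℝ × N ↦ Φ q.1 q.2) q :=
      (contMDiffAt_iff_contMDiffAt_nhds (by simp)).1 (hloc (Φ t₀ x))
    have hcx : Continuous fun t ↦ Φ t x := (hΦ x).continuous
    have h2 : Filter.Tendsto (fun p : ℝ × ℝ ↦ (p.2 - p.1, Φ p.1 x)) (𝓝 (t₀, t₀))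
        (𝓝 ((0 : ℝ), Φ t₀ x)) := by
      have : Continuous (fun p : ℝ × ℝ ↦ (p.2 - p.1, Φ p.1 x)) := by fun_prop
      simpa using this.tendsto (t₀, t₀)
    have h3 := h2.eventually h1
    rw [nhds_prod_eq] at h3
    filter_upwards [h3.curry] with t ht
    filter_upwards [ht] with t' ht' htS
    have heq : (fun q : ℝ × N ↦ Φ q.1 q.2) =
        (fun q : ℝ × N ↦ Φ q.1 q.2) ∘ (fun q : ℝ × N ↦ (q.1 - t, Φ t q.2)) := by
      funext q
      simp only [Function.comp]
      rw [← flow_add hv h0 hΦ, sub_add_cancel]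
    have htS' : ContMDiffAt (𝓘(ℝ, ℝ).prod I) I n (fun q : ℝ × N ↦ Φ t q.2) (t', x) :=
      ContMDiffAt.comp (g := fun q : ℝ × N ↦ Φ q.1 q.2) (f := fun q : ℝ × N ↦ (t, q.2)) (t', x)
        htS (contMDiffAt_const.prodMk contMDiffAt_snd)
    change ContMDiffAt _ _ _ _ _
    rw [heq]
    refine ContMDiffAt.comp (t', x) ht' (ContMDiffAt.prodMk ?_ htS')
    exact contMDiffAt_fst.sub contMDiffAt_const
  have hopen : IsOpen S := by
    rw [isOpen_iff_mem_nhds]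
    intro t₀ ht₀
    have := (hev t₀).self_of_nhds
    filter_upwards [this] with t' h
    exact h ht₀
  have hclosed : IsClosed S := by
    rw [← isOpen_compl_iff, isOpen_iff_mem_nhds]
    intro t₀ ht₀
    filter_upwards [hev t₀] with t ht htS
    exact ht₀ (ht.self_of_nhds htS)
  have : S = univ := IsClopen.eq_univ ⟨hclosed, hopen⟩ ⟨0, hloc x⟩
  exact (this ▸ mem_univ t : t ∈ S)

/-- A smooth vector field whose integral curves exist for a uniform time outside of a compact set
is complete, and has a smooth flow. -/
theorem exists_flow {v : ∀ x : N, TangentSpace I x}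
    (hv : ContMDiff I I.tangent ∞ (fun x ↦ (⟨x, v x⟩ : TangentBundle I N)))
    {K : Set N} (hK : IsCompact K)
    (hKv : ∀ x ∉ K, ∃ γ : ℝ → N, γ 0 = x ∧ IsMIntegralCurveOn γ v (Ioo (-1) 1)) :
    ∃ Φ : ℝ → N → N, ContMDiff (𝓘(ℝ, ℝ).prod I) I ∞ (fun q : ℝ × N ↦ Φ q.1 q.2) ∧
      (∀ x, Φ 0 x = x) ∧ (∀ s t x, Φ (s + t) x = Φ s (Φ t x)) ∧
      ∀ x, IsMIntegralCurve (fun t ↦ Φ t x) v := by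
  have hloc : ∀ x₀ : N, ∃ ε > (0 : ℝ), ∀ᶠ x in 𝓝 x₀, ∃ γ : ℝ → N, γ 0 = x ∧
      IsMIntegralCurveOn γ v (Ioo (-ε) ε) := by
    intro x₀
    obtain ⟨c, hc, -⟩ := exists_local_integralCurves hv x₀
    rw [nhds_prod_eq] at hc
    have h1 := hc.curry
    obtain ⟨δ, hδ, h2⟩ := Metric.eventually_nhds_iff.1 h1
    have h3 := h2 (y := δ / 2) (by simp [abs_of_pos hδ, hδ])
    refine ⟨δ / 2, by positivity, ?_⟩
    filter_upwards [h3] with x hx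
    have hd : δ / 2 ≠ 0 := by positivity
    refine ⟨c (δ / 2, x) ∘ (· * (δ / 2)⁻¹), by simp [hx.1], ?_⟩
    have h4 := hx.2.comp_mul (δ / 2)⁻¹
    have h5 : ((δ / 2)⁻¹ • fun y ↦ ((δ / 2, x).1 • v y : TangentSpace I y)) = v := by
      funext y
      change (δ / 2)⁻¹ • ((δ / 2) • v y) = v y
      rw [smul_smul, inv_mul_cancel₀ hd, one_smul]
    rw [h5] at h4
    refine h4.mono fun t ht ↦ ?_
    simp only [mem_ofPred_eq, mem_Ioo, ← div_eq_mul_inv] at ht ⊢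
    rw [lt_div_iff₀ (by positivity), div_lt_iff₀ (by positivity)]
    constructor <;> linarith [ht.1, ht.2]
  choose ε hε hεx using hloc
  obtain ⟨T, -, hT⟩ := hK.elim_nhds_subcover
    (fun x₀ ↦ {x | ∃ γ : ℝ → N, γ 0 = x ∧ IsMIntegralCurveOn γ v (Ioo (-(ε x₀)) (ε x₀))})
    (fun x₀ _ ↦ hεx x₀)
  obtain ⟨δ, hδ, hδT⟩ : ∃ δ > (0 : ℝ), δ ≤ 1 ∧ ∀ x ∈ T, δ ≤ ε x := by
    rcases T.eq_empty_or_nonempty with h | h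
    · exact ⟨1, one_pos, le_rfl, by simp [h]⟩
    · refine ⟨min 1 (T.inf' h ε), ?_, min_le_left _ _, fun x hx ↦
        (min_le_right _ _).trans (Finset.inf'_le _ hx)⟩
      rw [gt_iff_lt, lt_min_iff, Finset.lt_inf'_iff]
      exact ⟨one_pos, fun x _ ↦ hε x⟩
  have hunif : ∀ x : N, ∃ γ : ℝ → N, γ 0 = x ∧ IsMIntegralCurveOn γ v (Ioo (-δ) δ) := by
    intro x
    by_cases hx : x ∈ K
    · obtain ⟨y, hy⟩ := mem_iUnion.1 (hT hx)
      obtain ⟨hyT, γ, h0, hγ⟩ := mem_iUnion.1 hy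
      exact ⟨γ, h0, hγ.mono (Ioo_subset_Ioo (by linarith [hδT.2 y hyT]) (hδT.2 y hyT))⟩
    · obtain ⟨γ, h0, hγ⟩ := hKv x hx
      exact ⟨γ, h0, hγ.mono (Ioo_subset_Ioo (by linarith [hδT.1]) hδT.1)⟩
  have hglob := exists_isMIntegralCurve_of_isMIntegralCurveOn (contMDiff_one_vectorField hv) hδ
    hunif
  choose γ hγ0 hγ using hglob
  exact ⟨fun t x ↦ γ x t, contMDiff_flow hv hγ0 hγ, hγ0, flow_add hv hγ0 hγ, hγ⟩

/-- The flow of a compactly supported time-dependent vector field. -/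
theorem exists_flow_timeDependent {X : ℝ → ∀ x : N, TangentSpace I x}
    (hX : ContMDiff (𝓘(ℝ, ℝ).prod I) I.tangent ∞
      (fun q : ℝ × N ↦ (⟨q.2, X q.1 q.2⟩ : TangentBundle I N)))
    {K : Set N} (hK : IsCompact K) {a : ℝ} (hXK : ∀ t, ∀ x ∉ K, X t x = 0)
    (hXa : ∀ t, a < |t| → ∀ x, X t x = 0) :
    ∃ φ : ℝ → N → N, ContMDiff (𝓘(ℝ, ℝ).prod I) I ∞ (fun q : ℝ × N ↦ φ q.1 q.2) ∧
      (∀ x, φ 0 x = x) ∧ (∀ t, ∃ Φ : Diffeomorph I I N N ∞, ⇑Φ = φ t) ∧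
      (∀ t x, HasMFDerivAt 𝓘(ℝ, ℝ) I (fun s ↦ φ s x) t
        ((1 : ℝ →L[ℝ] ℝ).smulRight (X t (φ t x)))) ∧
      ∀ t, ∀ x ∉ K, φ t x = x := by
  -- The suspension ∂_t + X on ℝ × N turns the time-dependent field into an autonomous one.
  let v : ∀ q : ℝ × N, TangentSpace (𝓘(ℝ, ℝ).prod I) q := fun q ↦ ((1 : ℝ), X q.1 q.2)
  have hv : ContMDiff (𝓘(ℝ, ℝ).prod I) (𝓘(ℝ, ℝ).prod I).tangent ∞
      (fun q ↦ (⟨q, v q⟩ : TangentBundle (𝓘(ℝ, ℝ).prod I) (ℝ × N))) := by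
    have h1 : ContMDiff 𝓘(ℝ, ℝ) 𝓘(ℝ, ℝ).tangent ∞
        (fun t : ℝ ↦ (⟨t, (1 : ℝ)⟩ : TangentBundle 𝓘(ℝ, ℝ) ℝ)) :=
      (contMDiff_vectorSpace_iff_contDiff (V := fun _ ↦ (1 : ℝ))).2 contDiff_const
    have h2 : ContMDiff (𝓘(ℝ, ℝ).prod I) (𝓘(ℝ, ℝ).tangent.prod I.tangent) ∞
        (fun q : ℝ × N ↦ ((⟨q.1, (1 : ℝ)⟩ : TangentBundle 𝓘(ℝ, ℝ) ℝ),
          (⟨q.2, X q.1 q.2⟩ : TangentBundle I N))) :=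
      (h1.comp contMDiff_fst).prodMk hX
    exact (contMDiff_equivTangentBundleProd_symm (I := 𝓘(ℝ, ℝ)) (M := ℝ) (I' := I)
      (M' := N) (n := ∞)).comp h2
  have hline : ∀ (t₀ : ℝ) (x : N) (s : ℝ), X (s + t₀) x = 0 →
      HasMFDerivAt 𝓘(ℝ, ℝ) (𝓘(ℝ, ℝ).prod I) (fun s : ℝ ↦ (s + t₀, x)) s
        ((1 : ℝ →L[ℝ] ℝ).smulRight (v (s + t₀, x))) := by
    intro t₀ x s hs
    have h1 : HasMFDerivAt 𝓘(ℝ, ℝ) 𝓘(ℝ, ℝ) (fun s : ℝ ↦ s + t₀) s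
        (ContinuousLinearMap.toSpanSingleton ℝ (1 : ℝ)) :=
      ((hasDerivAt_id s).add_const t₀).hasFDerivAt.hasMFDerivAt
    refine (h1.prodMk (hasMFDerivAt_const x s)).congr_mfderiv ?_
    refine ContinuousLinearMap.ext fun (w : ℝ) ↦ ?_
    refine Prod.ext ?_ ?_
    · rfl
    · change (0 : E) = w • (X (s + t₀) x : E)
      rw [hs]
      exact (smul_zero w).symm
  -- The extra margin 1 in time ensures that, from a starting time outside the interval, X stays
  -- zero for |s| < 1. The suspended orbit is then a straight line, as it also is off K.
  obtain ⟨Φ, hΦs, hΦ0, hΦadd, hΦ⟩ := exists_flow hv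
    (K := Icc (-a - 1) (a + 1) ×ˢ K) (isCompact_Icc.prod hK) (by
      rintro ⟨t, x⟩ hq
      refine ⟨fun s ↦ (s + t, x), by simp, fun s hs ↦ (hline t x s ?_).hasMFDerivWithinAt⟩
      by_cases hx : x ∈ K
      · apply hXa
        have ht : t ∉ Icc (-a - 1) (a + 1) := fun h ↦ hq ⟨h, hx⟩
        rw [lt_abs]
        rw [mem_Icc, not_and_or, not_le, not_le] at ht
        rcases ht with h | h
        · right; linarith [hs.2]
        · left; linarith [hs.1]
      · exact hXK _ x hx)
  have hfst : ∀ t q, (Φ t q).1 = t + q.1 := by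
    intro t q
    have h1 : ∀ t, HasDerivAt (fun t ↦ (Φ t q).1 - t) 0 t := by
      intro t
      have h2 := (hasMFDerivAt_fst (I := 𝓘(ℝ, ℝ)) (I' := I) (x := Φ t q)).comp t (hΦ q t)
      have h3 : HasDerivAt (fun t ↦ (Φ t q).1) (1 : ℝ) t := by
        let L : ℝ →L[ℝ] ℝ := (ContinuousLinearMap.fst ℝ ℝ E).comp
          ((1 : ℝ →L[ℝ] ℝ).smulRight ((1 : ℝ), (X (Φ t q).1 (Φ t q).2 : E)))
        have h4 : HasFDerivAt (fun t ↦ (Φ t q).1) L t := hasMFDerivAt_iff_hasFDerivAt.1 h2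
        have h5 : L 1 = 1 := by simp [L]
        exact h5 ▸ h4.hasDerivAt
      have h6 := h3.sub (hasDerivAt_id t)
      rw [sub_self] at h6
      exact h6
    have h2 := is_const_of_deriv_eq_zero (fun t ↦ (h1 t).differentiableAt)
      (fun t ↦ (h1 t).deriv) t 0
    simp only [hΦ0] at h2
    linarith
  have hφs : ContMDiff (𝓘(ℝ, ℝ).prod I) I ∞ (fun q : ℝ × N ↦ (Φ q.1 (0, q.2)).2) :=
    contMDiff_snd.comp (hΦs.comp (contMDiff_fst.prodMk (contMDiff_const.prodMk contMDiff_snd)))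
  have hpair : ∀ t x, Φ t (0, x) = (t, (Φ t (0, x)).2) := fun t x ↦
    Prod.ext (by simp [hfst]) rfl
  refine ⟨fun t x ↦ (Φ t (0, x)).2, hφs, fun x ↦ by simp [hΦ0], fun t ↦ ?_, fun t x ↦ ?_, ?_⟩
  · refine ⟨⟨⟨fun x ↦ (Φ t (0, x)).2, fun x ↦ (Φ (-t) (t, x)).2, fun x ↦ ?_, fun x ↦ ?_⟩,
      ?_, ?_⟩, rfl⟩
    · simp only
      rw [← hpair, ← hΦadd, neg_add_cancel, hΦ0]
    · have h1 : Φ (-t) (t, x) = (0, (Φ (-t) (t, x)).2) := Prod.ext (by simp [hfst]) rfl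
      simp only
      rw [← h1, ← hΦadd, add_neg_cancel, hΦ0]
    · exact hφs.comp (contMDiff_const.prodMk contMDiff_id)
    · exact contMDiff_snd.comp (hΦs.comp
        (contMDiff_const.prodMk (contMDiff_const.prodMk contMDiff_id)))
  · have h2 := (hasMFDerivAt_snd (I := 𝓘(ℝ, ℝ)) (I' := I) (x := Φ t (0, x))).comp t
      (hΦ (0, x) t)
    refine h2.congr_mfderiv ?_
    refine ContinuousLinearMap.ext fun (w : ℝ) ↦ ?_
    change w • (X (Φ t (0, x)).1 (Φ t (0, x)).2 : E) = w • (X t (Φ t (0, x)).2 : E)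
    have h3 : (Φ t (0, x)).1 = t := by simp [hfst]
    rw [h3]
  · intro t x hx
    have h1 : IsMIntegralCurve (fun s : ℝ ↦ (s + 0, x)) v := fun s ↦
      hline 0 x s (hXK _ x hx)
    have h2 := isMIntegralCurve_Ioo_eq_of_contMDiff_boundaryless (t₀ := 0)
      (contMDiff_one_vectorField hv) h1 (hΦ (0, x)) (by simp [hΦ0])
    have h3 := congrFun h2 t
    exact (congrArg Prod.snd h3).symm

end GlobalFlow

/-! ### Linear algebra of contact forms. -/

section ContactLinearAlgebra

variable {E : Type*} [NormedAddCommGroup E] [NormedSpace ℝ E] [FiniteDimensional ℝ E]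

/-- The operator `u ↦ D(u, ·) + A(u) A`, where `D` is the skew-symmetrisation of `B`. -/
def contactOp (B : E →L[ℝ] E →L[ℝ] ℝ) (A : E →L[ℝ] ℝ) : E →L[ℝ] E →L[ℝ] ℝ :=
  B - B.flip + A.smulRight A

theorem contactOp_apply (B : E →L[ℝ] E →L[ℝ] ℝ) (A : E →L[ℝ] ℝ) (u v : E) :
    contactOp B A u v = (B u v - B v u) + A u * A v := rfl

/-- The algebraic contact condition: the skew-symmetrisation of `B` is nondegenerate on the
kernel of `A ≠ 0`. -/
structure IsContactPair (B : E →L[ℝ] E →L[ℝ] ℝ) (A : E →L[ℝ] ℝ) : Prop where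
  ne_zero : A ≠ 0
  nondegenerate : ∀ u, A u = 0 → (∀ v, A v = 0 → B u v - B v u = 0) → u = 0

variable {B : E →L[ℝ] E →L[ℝ] ℝ} {A : E →L[ℝ] ℝ}

/-- If u is in the kernel, evaluating on u kills the skew part and leaves A(u)² = 0. Nondegeneracy
on ker A then gives u = 0, and the dimensions agree. -/
theorem IsContactPair.exists_equiv (h : IsContactPair B A) :
    ∃ e : E ≃L[ℝ] (E →L[ℝ] ℝ), (e : E →L[ℝ] (E →L[ℝ] ℝ)) = contactOp B A := by
  have hinj : Function.Injective (contactOp B A : E →ₗ[ℝ] (E →L[ℝ] ℝ)) := by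
    rw [injective_iff_map_eq_zero]
    intro u hu
    have hu' : ∀ v, (B u v - B v u) + A u * A v = 0 := fun v ↦ by
      rw [← contactOp_apply]
      exact congrArg (fun L : E →L[ℝ] ℝ ↦ L v) hu
    have h0 : A u = 0 := by
      have := hu' u
      rw [sub_self, zero_add] at this
      exact mul_self_eq_zero.1 this
    refine h.nondegenerate u h0 fun v _ ↦ ?_
    have := hu' v
    rwa [h0, zero_mul, add_zero] at this
  have hdim : Module.finrank ℝ E = Module.finrank ℝ (E →L[ℝ] ℝ) := by
    rw [← (LinearMap.toContinuousLinearMap : (E →ₗ[ℝ] ℝ) ≃ₗ[ℝ] E →L[ℝ] ℝ).finrank_eq]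
    exact (Subspace.dual_finrank_eq (K := ℝ) (V := E)).symm
  let l := LinearEquiv.ofInjectiveOfFinrankEq _ hinj hdim
  refine ⟨l.toContinuousLinearEquiv, ?_⟩
  ext u v
  rfl

/-- The Reeb vector of a contact pair. -/
def linReeb (B : E →L[ℝ] E →L[ℝ] ℝ) (A : E →L[ℝ] ℝ) : E := (contactOp B A).inverse A

/-- The contact Hamiltonian vector of a contact pair for the value `h` and the differential `β`
of the Hamiltonian. -/
def linHam (B : E →L[ℝ] E →L[ℝ] ℝ) (A : E →L[ℝ] ℝ) (h : ℝ) (β : E →L[ℝ] ℝ) : E :=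
  (contactOp B A).inverse (-β + (β (linReeb B A) + h) • A)

theorem IsContactPair.contactOp_inverse (h : IsContactPair B A) (β : E →L[ℝ] ℝ) :
    contactOp B A ((contactOp B A).inverse β) = β := by
  obtain ⟨e, he⟩ := h.exists_equiv
  rw [← he, ContinuousLinearMap.inverse_equiv]
  exact e.apply_symm_apply β

/-- Evaluating the defining equation on R gives A(R)² = A(R). The root 0 is excluded, since
nondegeneracy would give R = 0 and then A = 0. So A(R) = 1, and the rest of the equation reads dα(R,
·) = 0. -/
theorem IsContactPair.linReeb_spec (h : IsContactPair B A) :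
    A (linReeb B A) = 1 ∧ ∀ v, B (linReeb B A) v - B v (linReeb B A) = 0 := by
  set R := linReeb B A
  have h1 : ∀ v, (B R v - B v R) + A R * A v = A v := fun v ↦ by
    rw [← contactOp_apply]
    exact congrArg (fun L : E →L[ℝ] ℝ ↦ L v) (h.contactOp_inverse A)
  have h2 : A R * A R = A R := by simpa using h1 R
  have h3 : A R ≠ 0 := by
    intro h0
    have hR : R = 0 := h.nondegenerate R h0 fun v hv ↦ by simpa [hv] using h1 v
    apply h.ne_zero
    ext v
    simpa [hR] using (h1 v).symm
  have h4 : A R = 1 := mul_left_cancel₀ h3 (by rw [h2, mul_one])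
  exact ⟨h4, fun v ↦ by simpa [h4] using h1 v⟩

/-- The coefficient of A in `linHam` is chosen so that evaluation on the Reeb vector cancels both
β-terms and leaves A(Z) = h. -/
theorem IsContactPair.linHam_spec (hc : IsContactPair B A) (h : ℝ) (β : E →L[ℝ] ℝ) :
    A (linHam B A h β) = h ∧ ∀ v, B (linHam B A h β) v - B v (linHam B A h β) =
      -β v + β (linReeb B A) * A v := by
  obtain ⟨hR, hDR⟩ := hc.linReeb_spec
  set R := linReeb B A
  set Z := linHam B A h β
  have h1 : ∀ v, (B Z v - B v Z) + A Z * A v = -β v + (β R + h) * A v := fun v ↦ by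
    rw [← contactOp_apply]
    exact congrArg (fun L : E →L[ℝ] ℝ ↦ L v) (hc.contactOp_inverse _)
  have h2 : A Z = h := by
    have := h1 R
    rw [hR] at this
    linarith [hDR Z]
  refine ⟨h2, fun v ↦ ?_⟩
  have := h1 v
  rw [h2] at this
  linarith

theorem IsContactPair.eq_of_forall (hc : IsContactPair B A) {u u' : E} (h : A u = A u')
    (h' : ∀ v, A v = 0 → B u v - B v u = B u' v - B v u') : u = u' := by
  refine sub_eq_zero.1 (hc.nondegenerate (u - u') (by simp [h]) fun v hv ↦ ?_)
  have := h' v hv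
  simp only [map_sub, sub_apply]
  linarith

set_option synthInstance.maxHeartbeats 200000 in
theorem contDiffAt_linHam {P : Type*} [NormedAddCommGroup P] [NormedSpace ℝ P]
    {B : P → E →L[ℝ] E →L[ℝ] ℝ} {A : P → E →L[ℝ] ℝ} {h : P → ℝ} {β : P → E →L[ℝ] ℝ} {p : P}
    (hc : IsContactPair (B p) (A p)) (hB : ContDiffAt ℝ ∞ B p) (hA : ContDiffAt ℝ ∞ A p)
    (hh : ContDiffAt ℝ ∞ h p) (hβ : ContDiffAt ℝ ∞ β p) :
    ContDiffAt ℝ ∞ (fun p ↦ linHam (B p) (A p) (h p) (β p)) p := by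
  have hbdd : IsBoundedLinearMap ℝ (fun L : E →L[ℝ] E →L[ℝ] ℝ ↦ L.flip) :=
    ⟨⟨fun _ _ ↦ rfl, fun _ _ ↦ rfl⟩, 1, one_pos, fun L ↦ by rw [L.opNorm_flip, one_mul]⟩
  have hbdd' : ContDiff ℝ ∞ (fun L : E →L[ℝ] E →L[ℝ] ℝ ↦ L.flip) := hbdd.contDiff
  have hflip : ContDiffAt ℝ ∞ (fun p ↦ (B p).flip) p := hbdd'.contDiffAt.comp p hB
  have hop : ContDiffAt ℝ ∞ (fun p ↦ contactOp (B p) (A p)) p :=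
    (hB.sub hflip).add (hA.smulRight hA)
  obtain ⟨j, hj⟩ := hc.exists_equiv
  have hinv : ContDiffAt ℝ ∞ (fun p ↦ (contactOp (B p) (A p)).inverse) p := by
    refine ContDiffAt.comp (g := ContinuousLinearMap.inverse) _ ?_ hop
    rw [← hj]
    exact contDiffAt_map_inverse j
  exact hinv.clm_apply (hβ.neg.add (((hβ.clm_apply (hinv.clm_apply hA)).add hh).smul hA))

/-- An isotropic subspace of half dimension in the kernel of `A` is its own symplectic
complement. -/
theorem IsContactPair.mem_range_of_isotropic (hc : IsContactPair B A)
    {F : Type*} [NormedAddCommGroup F] [NormedSpace ℝ F] [FiniteDimensional ℝ F]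
    (hdim : Module.finrank ℝ E = 2 * Module.finrank ℝ F + 1)
    {W : F →L[ℝ] E} (hW : Function.Injective W) (hAW : ∀ a, A (W a) = 0)
    (hDW : ∀ a b, B (W a) (W b) - B (W b) (W a) = 0) {u : E} (hu : A u = 0)
    (hDu : ∀ a, B u (W a) - B (W a) u = 0) : u ∈ range W := by
  obtain ⟨hR, hDR⟩ := hc.linReeb_spec
  set R := linReeb B A
  obtain ⟨e, he⟩ := hc.exists_equiv
  have heu : ∀ u v, e u v = (B u v - B v u) + A u * A v := fun u v ↦ by
    rw [← contactOp_apply, ← he]; rfl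
  -- The Reeb direction is added to the isotropic subspace so that its annihilator has dimension (2m
  -- + 1) - (m + 1) = m, where m is the dimension of F. The image of W lies in this annihilator and
  -- has the same dimension, hence fills it.
  let T : F × ℝ →ₗ[ℝ] E := (W : F →ₗ[ℝ] E).coprod (LinearMap.toSpanSingleton ℝ E R)
  have hT : ∀ p : F × ℝ, T p = W p.1 + p.2 • R := fun p ↦ by simp [T]
  have hTinj : Function.Injective T := by
    rw [injective_iff_map_eq_zero]
    intro p hp
    rw [hT] at hp
    have h1 : p.2 = 0 := by simpa [hAW, hR] using congrArg A hp
    have h2 : p.1 = 0 := hW (by simpa [h1] using hp)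
    exact Prod.ext h2 h1
  let Φ : E →ₗ[ℝ] Module.Dual ℝ E := LinearMap.mk₂ ℝ (fun u v ↦ e u v)
    (fun _ _ _ ↦ by simp) (fun _ _ _ ↦ by simp) (fun _ _ _ ↦ by simp) (fun _ _ _ ↦ by simp)
  have hΦ : Function.Injective Φ := by
    rw [injective_iff_map_eq_zero]
    intro u hu
    apply e.injective
    ext v
    exact (congrArg (fun L : Module.Dual ℝ E ↦ L v) hu).trans (by simp)
  let S := (LinearMap.range T).dualAnnihilator.comap Φ
  have hS : Module.finrank ℝ S ≤ Module.finrank ℝ F := by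
    have h1 : Module.finrank ℝ S ≤ Module.finrank ℝ (LinearMap.range T).dualAnnihilator := by
      refine LinearMap.finrank_le_finrank_of_injective
        (f := (Φ.restrict (p := S) (q := (LinearMap.range T).dualAnnihilator)
          fun x hx ↦ hx)) ?_
      intro x y hxy
      exact Subtype.ext (hΦ (congrArg Subtype.val hxy))
    have h2 := Subspace.finrank_add_finrank_dualAnnihilator_eq (LinearMap.range T)
    have h3 := LinearMap.finrank_range_of_inj hTinj
    rw [Module.finrank_prod, Module.finrank_self] at h3
    omega
  have hmem : ∀ u, A u = 0 → (∀ a, B u (W a) - B (W a) u = 0) → u ∈ S := by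
    intro u hu hDu
    rw [Submodule.mem_comap, Submodule.mem_dualAnnihilator]
    rintro _ ⟨p, rfl⟩
    change e u (T p) = 0
    rw [hT, map_add, map_smul, heu, heu, hu, zero_mul, zero_mul, hDu]
    have := hDR u
    have h5 : B u R - B R u = 0 := by linarith
    simp [h5]
  have hWS : LinearMap.range (W : F →ₗ[ℝ] E) ≤ S := by
    rintro _ ⟨a, rfl⟩
    exact hmem _ (hAW a) fun b ↦ hDW a b
  have hEq : LinearMap.range (W : F →ₗ[ℝ] E) = S := by
    refine Submodule.eq_of_le_of_finrank_le hWS ?_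
    rwa [LinearMap.finrank_range_of_inj hW]
  have : u ∈ LinearMap.range (W : F →ₗ[ℝ] E) := hEq ▸ hmem u hu hDu
  obtain ⟨a, ha⟩ := this
  exact ⟨a, ha⟩

end ContactLinearAlgebra

/-! ### The exterior derivative and pull-back in vector spaces. -/

section PullbackVectorSpace

variable {E F : Type*} [NormedAddCommGroup E] [NormedSpace ℝ E]
  [NormedAddCommGroup F] [NormedSpace ℝ F]

/-- The exterior derivative commutes with the pull-back of a `1`-form by a smooth map. -/
theorem fderiv_pullback_sub {A : E → E →L[ℝ] ℝ} {g : F → E} {z : F}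
    (hA : DifferentiableAt ℝ A (g z)) (hg : ContDiffAt ℝ 2 g z) :
    DifferentiableAt ℝ (fun y ↦ (A (g y)).comp (fderiv ℝ g y)) z ∧
    ∀ u v, fderiv ℝ (fun y ↦ (A (g y)).comp (fderiv ℝ g y)) z u v -
        fderiv ℝ (fun y ↦ (A (g y)).comp (fderiv ℝ g y)) z v u =
      fderiv ℝ A (g z) (fderiv ℝ g z u) (fderiv ℝ g z v) -
        fderiv ℝ A (g z) (fderiv ℝ g z v) (fderiv ℝ g z u) := by
  -- The terms with the second derivative of g are symmetric in u and v and cancel in the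
  -- difference.
  have hsymm := hg.isSymmSndFDerivAt (by simp)
  have hg1 : HasFDerivAt g (fderiv ℝ g z) z := (hg.differentiableAt (by simp)).hasFDerivAt
  have hg2 : HasFDerivAt (fderiv ℝ g) (fderiv ℝ (fderiv ℝ g) z) z :=
    ((hg.fderiv_right (m := 1) (by norm_num)).differentiableAt (by simp)).hasFDerivAt
  have h := (hA.hasFDerivAt.comp z hg1).clm_comp hg2
  refine ⟨h.differentiableAt, fun u v ↦ ?_⟩
  rw [show fderiv ℝ (fun y ↦ (A (g y)).comp (fderiv ℝ g y)) z = _ from h.fderiv]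
  simp [hsymm.eq u v]

end PullbackVectorSpace

/-! ### The contact form in charts and under pull-back. -/

section ContactCharts

variable {n : ℕ} {M : Type*} [TopologicalSpace M]
  [ChartedSpace (EuclideanSpace ℝ (Fin (2 * n + 1))) M] [IsManifold (𝓡 (2 * n + 1)) ∞ M]

variable {α : ∀ x : M, TangentSpace (𝓡 (2 * n + 1)) x →L[ℝ] ℝ}

variable {EA : Type*} [NormedAddCommGroup EA] [NormedSpace ℝ EA] {HA : Type*} [TopologicalSpace HA]
  {J : ModelWithCorners ℝ EA HA} {Q : Type*} [TopologicalSpace Q] [ChartedSpace HA Q]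

/-- Evaluating the contact form on a smooth family of tangent vectors gives a smooth function. -/
theorem IsContactForm.contMDiffAt_apply (hα : IsContactForm α) {b : Q → M}
    {v : ∀ q, TangentSpace (𝓡 (2 * n + 1)) (b q)} {q₀ : Q}
    (hv : ContMDiffAt J (𝓡 (2 * n + 1)).tangent ∞ (fun q ↦ (⟨b q, v q⟩ : TangentBundle (𝓡 (2 * n + 1)) M)) q₀) :
    ContMDiffAt J 𝓘(ℝ, ℝ) ∞ (fun q ↦ α (b q) (v q)) q₀ := by
  have hb : ContMDiffAt J (𝓡 (2 * n + 1)) ∞ b q₀ :=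
    (Bundle.contMDiff_proj (TangentSpace (𝓡 (2 * n + 1)) : M → Type _) (n := ∞)).contMDiffAt.comp q₀ hv
  have h1 := ContMDiffAt.comp (f := b) q₀ hα.contMDiff.contMDiffAt hb
  have h2 : ContMDiffAt J ((𝓡 (2 * n + 1)).prod 𝓘(ℝ, ℝ)) ∞
      (fun q ↦ (⟨b q, α (b q) (v q)⟩ : Bundle.TotalSpace ℝ (Bundle.Trivial M ℝ))) q₀ :=
    ContMDiffAt.clm_bundle_apply (E₁ := (TangentSpace (𝓡 (2 * n + 1)) : M → Type _))
      (E₂ := Bundle.Trivial M ℝ) (ϕ := fun q ↦ α (b q)) h1 hv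
  rw [Bundle.contMDiffAt_totalSpace] at h2
  exact h2.2

theorem IsContactForm.contDiffAt_coordForm (hα : IsContactForm α) {x₀ : M} {y : EuclideanSpace ℝ (Fin (2 * n + 1))}
    (hy : y ∈ (extChartAt (𝓡 (2 * n + 1)) x₀).target) : ContDiffAt ℝ ∞ (coordForm α x₀) y := by
  have h1 : ∀ u : EuclideanSpace ℝ (Fin (2 * n + 1)), ContDiffOn ℝ ∞ (fun y ↦ coordForm α x₀ y u)
      (extChartAt (𝓡 (2 * n + 1)) x₀).target := by
    intro u y hy
    apply ContDiffAt.contDiffWithinAt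
    rw [← contMDiffAt_iff_contDiffAt]
    have h2 : ContMDiffAt 𝓘(ℝ, EuclideanSpace ℝ (Fin (2 * n + 1))) 𝓘(ℝ, EuclideanSpace ℝ (Fin (2 * n + 1))).tangent ∞
        (fun y ↦ (⟨y, u⟩ : TangentBundle 𝓘(ℝ, EuclideanSpace ℝ (Fin (2 * n + 1))) (EuclideanSpace ℝ (Fin (2 * n + 1))))) y :=
      (contMDiffAt_vectorSpace_iff_contDiffAt (V := fun _ ↦ u)).2 contDiffAt_const
    have h3 := contMDiffAt_tangentMap (isOpen_extChartAt_target (I := (𝓡 (2 * n + 1))) x₀)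
      (contMDiffOn_extChartAt_symm (I := (𝓡 (2 * n + 1))) (n := ∞) x₀) (⟨y, u⟩ : TangentBundle 𝓘(ℝ, EuclideanSpace ℝ (Fin (2 * n + 1))) (EuclideanSpace ℝ (Fin (2 * n + 1)))) hy
    exact hα.contMDiffAt_apply (ContMDiffAt.comp (f := fun y ↦
      (⟨y, u⟩ : TangentBundle 𝓘(ℝ, EuclideanSpace ℝ (Fin (2 * n + 1))) (EuclideanSpace ℝ (Fin (2 * n + 1))))) y h3 h2)
  exact (contDiffOn_clm_apply.2 h1).contDiffAt
    ((isOpen_extChartAt_target (I := (𝓡 (2 * n + 1))) x₀).mem_nhds hy)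

/-- The pull-back of the contact form by a map from a vector space. -/
def pullForm (α : ∀ x : M, TangentSpace (𝓡 (2 * n + 1)) x →L[ℝ] ℝ) {F : Type*} [NormedAddCommGroup F]
    [NormedSpace ℝ F] (G : F → M) (y : F) : F →L[ℝ] ℝ :=
  (α (G y)).comp (mfderiv 𝓘(ℝ, F) (𝓡 (2 * n + 1)) G y)

/-- All tangent spaces are definitionally the model space, so a vector can be kept while its base
point is replaced by an equal one. This handles transports along equalities of points below. -/
theorem form_congr {x x' : M} (h : x = x') (u : EuclideanSpace ℝ (Fin (2 * n + 1))) :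
    α x (show TangentSpace (𝓡 (2 * n + 1)) x from u) = α x' (show TangentSpace (𝓡 (2 * n + 1)) x' from u) := by
  subst h; rfl

/-- The exterior derivative commutes with pull-backs to vector spaces. -/
theorem IsContactForm.fderiv_pullForm_sub (hα : IsContactForm α) {F : Type*}
    [NormedAddCommGroup F] [NormedSpace ℝ F] {G : F → M} {z : F}
    (hG : ∀ᶠ y in 𝓝 z, ContMDiffAt 𝓘(ℝ, F) (𝓡 (2 * n + 1)) ∞ G y) :
    DifferentiableAt ℝ (pullForm α G) z ∧
    ∀ u v : F, fderiv ℝ (pullForm α G) z u v - fderiv ℝ (pullForm α G) z v u =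
      dForm α (G z) (mfderiv 𝓘(ℝ, F) (𝓡 (2 * n + 1)) G z u) (mfderiv 𝓘(ℝ, F) (𝓡 (2 * n + 1)) G z v) := by
  set e := extChartAt (𝓡 (2 * n + 1)) (G z) with he
  have hsrc : ∀ᶠ y in 𝓝 z, G y ∈ e.source :=
    hG.self_of_nhds.continuousAt.tendsto.eventually (extChartAt_source_mem_nhds (I := (𝓡 (2 * n + 1))) (G z))
  let g : F → EuclideanSpace ℝ (Fin (2 * n + 1)) := fun y ↦ e (G y)
  have hg : ContDiffAt ℝ ∞ g z := by
    rw [← contMDiffAt_iff_contDiffAt]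
    exact (contMDiffAt_extChartAt (I := (𝓡 (2 * n + 1))) (n := ∞) (x := G z)).comp z hG.self_of_nhds
  have hgd : ∀ᶠ y in 𝓝 z, HasMFDerivAt 𝓘(ℝ, F) 𝓘(ℝ, EuclideanSpace ℝ (Fin (2 * n + 1))) g y (fderiv ℝ g y) := by
    filter_upwards [(hg.of_le (m := 1) (by simp)).eventually (by simp)] with y hy
    exact (hy.differentiableAt (by simp)).hasFDerivAt.hasMFDerivAt
  -- Near z the map G factors through the chart at G z, so its pull-back form is that of the
  -- coordinate form by g, and the vector space case applies.
  have heq : pullForm α G =ᶠ[𝓝 z] fun y ↦ (coordForm α (G z) (g y)).comp (fderiv ℝ g y) := by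
    filter_upwards [hsrc.eventually_nhds, hgd] with y hy hyd
    have hy0 := hy.self_of_nhds
    have h1 := (hasMFDerivAt_extChartAt_symm (I := (𝓡 (2 * n + 1))) (x₀ := G z) (e.map_source hy0)).comp y hyd
    have h2 : HasMFDerivAt 𝓘(ℝ, F) (𝓡 (2 * n + 1)) G y
        ((mfderiv 𝓘(ℝ, EuclideanSpace ℝ (Fin (2 * n + 1))) (𝓡 (2 * n + 1)) e.symm (g y)).comp (fderiv ℝ g y)) := by
      refine h1.congr_of_eventuallyEq ?_
      filter_upwards [hy] with y' hy'
      exact (e.left_inv hy').symm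
    ext w
    have h3 : G y = e.symm (g y) := (e.left_inv hy0).symm
    rw [pullForm, h2.mfderiv]
    exact form_congr h3 _
  have hA : DifferentiableAt ℝ (coordForm α (G z)) (g z) :=
    (hα.contDiffAt_coordForm (mem_extChartAt_target (I := (𝓡 (2 * n + 1))) (G z))).differentiableAt (by simp)
  obtain ⟨h1, h2⟩ := fderiv_pullback_sub hA (hg.of_le (m := 2) (by exact WithTop.coe_le_coe.2 le_top))
  refine ⟨heq.symm.differentiableAt_iff.1 h1, fun u v ↦ ?_⟩
  rw [heq.fderiv_eq, h2]
  have h4 : mfderiv 𝓘(ℝ, F) (𝓡 (2 * n + 1)) G z = fderiv ℝ g z := by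
    rw [(hG.self_of_nhds.mdifferentiableAt (by simp)).mfderiv]
    simp only [writtenInExtChartAt, mfld_simps]
    rw [fderivWithin_univ]
    rfl
  rw [h4]
  rfl

end ContactCharts

/-! ### Contact Hamiltonian vector fields. -/

section HamiltonianField

variable {n : ℕ} {M : Type*} [TopologicalSpace M]
  [ChartedSpace (EuclideanSpace ℝ (Fin (2 * n + 1))) M] [IsManifold (𝓡 (2 * n + 1)) ∞ M]
  {α : ∀ x : M, TangentSpace (𝓡 (2 * n + 1)) x →L[ℝ] ℝ}

theorem eventually_contMDiffAt_extChartAt_symm {x₀ : M} {y : EuclideanSpace ℝ (Fin (2 * n + 1))}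
    (hy : y ∈ (extChartAt (𝓡 (2 * n + 1)) x₀).target) :
    ∀ᶠ y' in 𝓝 y, ContMDiffAt 𝓘(ℝ, EuclideanSpace ℝ (Fin (2 * n + 1))) (𝓡 (2 * n + 1)) ∞
      (extChartAt (𝓡 (2 * n + 1)) x₀).symm y' := by
  filter_upwards [(isOpen_extChartAt_target (I := 𝓡 (2 * n + 1)) x₀).mem_nhds hy] with y' hy'
  exact (contMDiffOn_extChartAt_symm (I := 𝓡 (2 * n + 1)) (n := ∞) x₀).contMDiffAt
    ((isOpen_extChartAt_target (I := 𝓡 (2 * n + 1)) x₀).mem_nhds hy')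

/-- `dα` may be computed in any chart. -/
theorem IsContactForm.dForm_extChartAt_symm (hα : IsContactForm α) {x₀ : M}
    {y : EuclideanSpace ℝ (Fin (2 * n + 1))}
    (hy : y ∈ (extChartAt (𝓡 (2 * n + 1)) x₀).target)
    (u v : EuclideanSpace ℝ (Fin (2 * n + 1))) :
    dForm α ((extChartAt (𝓡 (2 * n + 1)) x₀).symm y)
      (mfderiv 𝓘(ℝ, EuclideanSpace ℝ (Fin (2 * n + 1))) (𝓡 (2 * n + 1))
        (extChartAt (𝓡 (2 * n + 1)) x₀).symm y u)
      (mfderiv 𝓘(ℝ, EuclideanSpace ℝ (Fin (2 * n + 1))) (𝓡 (2 * n + 1))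
        (extChartAt (𝓡 (2 * n + 1)) x₀).symm y v) =
    fderiv ℝ (coordForm α x₀) y u v - fderiv ℝ (coordForm α x₀) y v u :=
  ((hα.fderiv_pullForm_sub (eventually_contMDiffAt_extChartAt_symm hy)).2 u v).symm

/-- The derivative of the inverse of a chart, as a map of the model space. -/
def symmDeriv (x₀ : M) (y : EuclideanSpace ℝ (Fin (2 * n + 1))) :
    EuclideanSpace ℝ (Fin (2 * n + 1)) →L[ℝ] EuclideanSpace ℝ (Fin (2 * n + 1)) :=
  mfderiv 𝓘(ℝ, EuclideanSpace ℝ (Fin (2 * n + 1))) (𝓡 (2 * n + 1))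
    (extChartAt (𝓡 (2 * n + 1)) x₀).symm y

theorem symmDeriv_surjective {x₀ : M} {y : EuclideanSpace ℝ (Fin (2 * n + 1))}
    (hy : y ∈ (extChartAt (𝓡 (2 * n + 1)) x₀).target) :
    Function.Surjective (symmDeriv (n := n) x₀ y) := by
  intro u
  have h := mfderiv_extChartAt_symm_comp (I := 𝓡 (2 * n + 1)) (x₀ := x₀)
    ((extChartAt (𝓡 (2 * n + 1)) x₀).map_target hy) u
  rw [(extChartAt (𝓡 (2 * n + 1)) x₀).right_inv hy] at h
  exact ⟨_, h⟩

theorem symmDeriv_injective {x₀ : M} {y : EuclideanSpace ℝ (Fin (2 * n + 1))}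
    (hy : y ∈ (extChartAt (𝓡 (2 * n + 1)) x₀).target) :
    Function.Injective (symmDeriv (n := n) x₀ y) :=
  LinearMap.injective_iff_surjective.2 (symmDeriv_surjective hy)

theorem IsContactForm.isContactPair_dForm (hα : IsContactForm α) (x : M) :
    IsContactPair (fderiv ℝ (coordForm α x) (extChartAt (𝓡 (2 * n + 1)) x x)) (α x) :=
  ⟨hα.ne_zero x, fun u hu h ↦ hα.nondegenerate x u hu h⟩

/-- `dForm` at a point uses the preferred chart of that point. This moves the contact condition to a
fixed chart, whose inverse has invertible derivative at every point of its target. -/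
theorem IsContactForm.isContactPair_coordForm (hα : IsContactForm α) {x₀ : M}
    {y : EuclideanSpace ℝ (Fin (2 * n + 1))}
    (hy : y ∈ (extChartAt (𝓡 (2 * n + 1)) x₀).target) :
    IsContactPair (fderiv ℝ (coordForm α x₀) y) (coordForm α x₀ y) := by
  constructor
  · intro h0
    apply hα.ne_zero ((extChartAt (𝓡 (2 * n + 1)) x₀).symm y)
    ext u
    obtain ⟨w, rfl⟩ := symmDeriv_surjective hy u
    exact congrArg (fun L : EuclideanSpace ℝ (Fin (2 * n + 1)) →L[ℝ] ℝ ↦ L w) h0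
  · intro u hu h
    apply symmDeriv_injective hy
    rw [map_zero]
    refine hα.nondegenerate _ _ hu fun v hv ↦ ?_
    obtain ⟨w, rfl⟩ := symmDeriv_surjective hy v
    exact (hα.dForm_extChartAt_symm hy u w).trans (h w hv)

/-- The differential of a real function. -/
def differential (F : M → ℝ) (x : M) : TangentSpace (𝓡 (2 * n + 1)) x →L[ℝ] ℝ :=
  mfderiv (𝓡 (2 * n + 1)) 𝓘(ℝ, ℝ) F x

/-- The contact vector field of the Hamiltonian `F`. -/
def hamField (α : ∀ x : M, TangentSpace (𝓡 (2 * n + 1)) x →L[ℝ] ℝ) (F : M → ℝ) (x : M) :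
    TangentSpace (𝓡 (2 * n + 1)) x :=
  linHam (E := EuclideanSpace ℝ (Fin (2 * n + 1)))
    (fderiv ℝ (coordForm α x) (extChartAt (𝓡 (2 * n + 1)) x x)) (α x) (F x) (differential F x)

theorem IsContactForm.isReebVector_reebField (hα : IsContactForm α) (x : M) :
    IsReebVector α x (reebField α x) := by
  have h : ∃ v, IsReebVector α x v := ⟨_, (hα.isContactPair_dForm x).linReeb_spec⟩
  rw [reebField, dif_pos h]
  exact h.choose_spec

theorem IsContactForm.eq_of_dForm (hα : IsContactForm α) {x : M}
    {u u' : TangentSpace (𝓡 (2 * n + 1)) x} (h : α x u = α x u')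
    (h' : ∀ v, α x v = 0 → dForm α x u v = dForm α x u' v) : u = u' :=
  (hα.isContactPair_dForm x).eq_of_forall h h'

theorem IsContactForm.reebField_eq (hα : IsContactForm α) (x : M) :
    reebField α x =
      linReeb (fderiv ℝ (coordForm α x) (extChartAt (𝓡 (2 * n + 1)) x x)) (α x) := by
  obtain ⟨h1, h2⟩ := (hα.isContactPair_dForm x).linReeb_spec
  obtain ⟨h3, h4⟩ := hα.isReebVector_reebField x
  exact hα.eq_of_dForm (h3.trans h1.symm) fun v _ ↦ (h4 v).trans (h2 v).symm

theorem IsContactForm.form_hamField (hα : IsContactForm α) (F : M → ℝ) (x : M) :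
    α x (hamField α F x) = F x :=
  ((hα.isContactPair_dForm x).linHam_spec _ _).1

theorem IsContactForm.dForm_hamField (hα : IsContactForm α) (F : M → ℝ) (x : M)
    (v : TangentSpace (𝓡 (2 * n + 1)) x) :
    dForm α x (hamField α F x) v = -differential F x v +
      differential F x (reebField α x) * α x v := by
  rw [hα.reebField_eq]
  exact ((hα.isContactPair_dForm x).linHam_spec _ _).2 v

/-- Nondegeneracy on ker α makes the contact field unique with these data, so it is enough to test
on ker α. The Reeb term of `dForm_hamField` disappears there. -/
theorem IsContactForm.hamField_eq_of_forall (hα : IsContactForm α) {F : M → ℝ} {x : M}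
    {u : TangentSpace (𝓡 (2 * n + 1)) x} (h : α x u = F x)
    (h' : ∀ v, α x v = 0 → dForm α x u v = -differential F x v) :
    u = hamField α F x := by
  refine hα.eq_of_dForm (h.trans (hα.form_hamField F x).symm) fun v hv ↦ ?_
  rw [h' v hv, hα.dForm_hamField, hv, mul_zero, add_zero]

theorem IsContactForm.hamField_eq_zero (hα : IsContactForm α) {F : M → ℝ} {x : M}
    (h : ∀ᶠ y in 𝓝 x, F y = 0) : hamField α F x = 0 := by
  have h1 : HasMFDerivAt (𝓡 (2 * n + 1)) 𝓘(ℝ, ℝ) F x 0 :=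
    (hasMFDerivAt_const (0 : ℝ) x).congr_of_eventuallyEq h
  refine (hα.hamField_eq_of_forall ?_ fun v _ ↦ ?_).symm
  · rw [map_zero, h.self_of_nhds]
  · rw [differential, h1.mfderiv]
    let D := fderiv ℝ (coordForm α x) (extChartAt (𝓡 (2 * n + 1)) x x)
    let w : EuclideanSpace ℝ (Fin (2 * n + 1)) := v
    change D 0 w - D w 0 = -(0 : ℝ)
    simp

theorem IsContactForm.hamField_eq_reebField (hα : IsContactForm α) {F : M → ℝ} {x : M}
    (h : ∀ᶠ y in 𝓝 x, F y = 1) : hamField α F x = reebField α x := by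
  have h1 : HasMFDerivAt (𝓡 (2 * n + 1)) 𝓘(ℝ, ℝ) F x 0 :=
    (hasMFDerivAt_const (1 : ℝ) x).congr_of_eventuallyEq h
  obtain ⟨h3, h4⟩ := hα.isReebVector_reebField x
  refine (hα.hamField_eq_of_forall ?_ fun v _ ↦ ?_).symm
  · rw [h3, h.self_of_nhds]
  · rw [differential, h1.mfderiv, h4]
    change _ = -(0 : ℝ)
    simp

/-- The contact vector field of a smooth time-dependent Hamiltonian is smooth. -/
theorem IsContactForm.contMDiff_hamField (hα : IsContactForm α) {F : ℝ → M → ℝ}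
    (hF : ContMDiff (𝓘(ℝ, ℝ).prod (𝓡 (2 * n + 1))) 𝓘(ℝ, ℝ) ∞ (fun q : ℝ × M ↦ F q.1 q.2)) :
    ContMDiff (𝓘(ℝ, ℝ).prod (𝓡 (2 * n + 1))) (𝓡 (2 * n + 1)).tangent ∞
      (fun q : ℝ × M ↦ (⟨q.2, hamField α (F q.1) q.2⟩ : TangentBundle (𝓡 (2 * n + 1)) M)) := by
  rintro ⟨t₀, x₀⟩
  set e := extChartAt (𝓡 (2 * n + 1)) x₀ with he
  have hT : IsOpen e.target := isOpen_extChartAt_target (I := 𝓡 (2 * n + 1)) x₀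
  have hy₀ : e x₀ ∈ e.target := mem_extChartAt_target (I := 𝓡 (2 * n + 1)) x₀
  let A := coordForm α x₀
  let B := fderiv ℝ (coordForm α x₀)
  let Fc : ℝ × EuclideanSpace ℝ (Fin (2 * n + 1)) → ℝ := fun p ↦ F p.1 (e.symm p.2)
  have hFc : ∀ t, ∀ y ∈ e.target, ContDiffAt ℝ ∞ Fc (t, y) := by
    intro t y hy
    rw [← contMDiffAt_iff_contDiffAt]
    have h1 := (eventually_contMDiffAt_extChartAt_symm hy).self_of_nhds
    have h2 : ContMDiffAt 𝓘(ℝ, ℝ × EuclideanSpace ℝ (Fin (2 * n + 1)))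
        (𝓘(ℝ, ℝ).prod (𝓡 (2 * n + 1))) ∞
        (fun p : ℝ × EuclideanSpace ℝ (Fin (2 * n + 1)) ↦ (p.1, e.symm p.2)) (t, y) :=
      (contDiff_fst.contMDiff.contMDiffAt).prodMk
        (ContMDiffAt.comp (g := e.symm) (f := Prod.snd) (t, y) h1
          contDiff_snd.contMDiff.contMDiffAt)
    exact ContMDiffAt.comp (g := fun q : ℝ × M ↦ F q.1 q.2) (t, y) hF.contMDiffAt h2
  let β : ℝ × EuclideanSpace ℝ (Fin (2 * n + 1)) → EuclideanSpace ℝ (Fin (2 * n + 1)) →L[ℝ] ℝ :=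
    fun p ↦ (fderiv ℝ Fc p).comp (ContinuousLinearMap.inr ℝ ℝ _)
  -- Z solves the Hamiltonian equation in the one chart at x₀, where all data depend smoothly on the
  -- point. The definition of `hamField` uses a chart that changes with the point.
  let Z : ℝ × EuclideanSpace ℝ (Fin (2 * n + 1)) → EuclideanSpace ℝ (Fin (2 * n + 1)) := fun p ↦
    linHam (B p.2) (A p.2) (Fc p) (β p)
  have hZ : ContDiffAt ℝ ∞ Z (t₀, e x₀) := by
    have hA : ContDiffAt ℝ ∞ (fun p : ℝ × EuclideanSpace ℝ (Fin (2 * n + 1)) ↦ A p.2)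
        (t₀, e x₀) := ContDiffAt.comp (f := Prod.snd) (t₀, e x₀) (hα.contDiffAt_coordForm hy₀) contDiffAt_snd
    have hB : ContDiffAt ℝ ∞ (fun p : ℝ × EuclideanSpace ℝ (Fin (2 * n + 1)) ↦ B p.2)
        (t₀, e x₀) := ContDiffAt.comp (f := Prod.snd) (t₀, e x₀)
          ((hα.contDiffAt_coordForm hy₀).fderiv_right (m := ∞) (by simp)) contDiffAt_snd
    have hβ : ContDiffAt ℝ ∞ β (t₀, e x₀) :=
      ((hFc t₀ _ hy₀).fderiv_right (m := ∞) (by simp)).clm_comp contDiffAt_const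
    exact contDiffAt_linHam (hα.isContactPair_coordForm hy₀) hB hA (hFc t₀ _ hy₀) hβ
  have hlift : ContMDiffAt (𝓘(ℝ, ℝ).prod (𝓡 (2 * n + 1)))
      𝓘(ℝ, EuclideanSpace ℝ (Fin (2 * n + 1))).tangent ∞
      (fun q : ℝ × M ↦ (⟨e q.2, Z (q.1, e q.2)⟩ :
        TangentBundle 𝓘(ℝ, EuclideanSpace ℝ (Fin (2 * n + 1)))
          (EuclideanSpace ℝ (Fin (2 * n + 1))))) (t₀, x₀) := by
    have h1 : ContMDiffAt (𝓘(ℝ, ℝ).prod (𝓡 (2 * n + 1)))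
        𝓘(ℝ, EuclideanSpace ℝ (Fin (2 * n + 1))) ∞ (fun q : ℝ × M ↦ e q.2) (t₀, x₀) :=
      (contMDiffAt_extChartAt (I := 𝓡 (2 * n + 1)) (n := ∞) (x := x₀)).comp _ contMDiffAt_snd
    have h2 : ContMDiffAt (𝓘(ℝ, ℝ).prod (𝓡 (2 * n + 1)))
        𝓘(ℝ, ℝ × EuclideanSpace ℝ (Fin (2 * n + 1))) ∞ (fun q : ℝ × M ↦ (q.1, e q.2)) (t₀, x₀) :=
      contMDiffAt_fst.prodMk_space h1
    have h3 := ContMDiffAt.comp (f := fun q : ℝ × M ↦ (q.1, e q.2)) (t₀, x₀) hZ.contMDiffAt h2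
    rw [Bundle.contMDiffAt_totalSpace]
    refine ⟨h1, h3.congr_of_eventuallyEq ?_⟩
    filter_upwards with q
    simp
  have h4 := ContMDiffAt.comp (t₀, x₀) (contMDiffAt_tangentMap hT
    (contMDiffOn_extChartAt_symm (I := 𝓡 (2 * n + 1)) (n := ∞) x₀) _ hy₀) hlift
  refine h4.congr_of_eventuallyEq ?_
  have hsrc : ∀ᶠ q in 𝓝 (t₀, x₀), q.2 ∈ e.source :=
    continuousAt_snd.tendsto.eventually (extChartAt_source_mem_nhds (I := 𝓡 (2 * n + 1)) x₀)
  filter_upwards [hsrc] with q hq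
  obtain ⟨t, x⟩ := q
  obtain ⟨y, hy, rfl⟩ : ∃ y ∈ e.target, e.symm y = x := ⟨e x, e.map_source hq, e.left_inv hq⟩
  have hZs := (hα.isContactPair_coordForm hy).linHam_spec (Fc (t, y)) (β (t, y))
  -- The two solutions agree by uniqueness, since α, dα and the differential of F are all natural
  -- under the chart.
  have key : symmDeriv x₀ y (Z (t, y)) = hamField α (F t) (e.symm y) := ?_
  · have hr : e (e.symm y) = y := e.right_inv hy
    simp only [Function.comp]
    rw [hr]
    exact congrArg (fun w : EuclideanSpace ℝ (Fin (2 * n + 1)) ↦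
      (⟨e.symm y, w⟩ : TangentBundle (𝓡 (2 * n + 1)) M)) key.symm
  refine hα.hamField_eq_of_forall hZs.1 fun v hv ↦ ?_
  obtain ⟨w, rfl⟩ := symmDeriv_surjective hy v
  refine (hα.dForm_extChartAt_symm hy _ w).trans ((hZs.2 w).trans ?_)
  have hv' : coordForm α x₀ y w = 0 := hv
  rw [hv', mul_zero, add_zero]
  have h5 : HasMFDerivAt (𝓡 (2 * n + 1)) 𝓘(ℝ, ℝ) (F t) (e.symm y)
      (mfderiv (𝓡 (2 * n + 1)) 𝓘(ℝ, ℝ) (F t) (e.symm y)) := by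
    have : ContMDiff (𝓡 (2 * n + 1)) 𝓘(ℝ, ℝ) ∞ (F t) :=
      hF.comp (contMDiff_const.prodMk contMDiff_id)
    exact (this.mdifferentiable (by simp) _).hasMFDerivAt
  let L : EuclideanSpace ℝ (Fin (2 * n + 1)) →L[ℝ] ℝ :=
    ContinuousLinearMap.comp (M₂ := EuclideanSpace ℝ (Fin (2 * n + 1)))
      (differential (F t) (e.symm y)) (symmDeriv x₀ y)
  have h6 : HasFDerivAt (fun y ↦ Fc (t, y)) L y := hasMFDerivAt_iff_hasFDerivAt.1
    (h5.comp y (hasMFDerivAt_extChartAt_symm (I := 𝓡 (2 * n + 1)) hy))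
  have h7 : HasFDerivAt (fun y ↦ Fc (t, y)) (β (t, y)) y :=
    ((hFc t y hy).differentiableAt (by simp)).hasFDerivAt.comp y (hasFDerivAt_prodMk_right t y)
  have h8 := h6.unique h7
  have h9 : β (t, y) w = differential (F t) (e.symm y) (symmDeriv x₀ y w) :=
    congrArg (fun L : EuclideanSpace ℝ (Fin (2 * n + 1)) →L[ℝ] ℝ ↦ L w) h8.symm
  rw [h9]

end HamiltonianField

/-! ### Calculus of one-parameter families of maps. -/

section Families

variable {E : Type*} [NormedAddCommGroup E] [NormedSpace ℝ E]
  {H : Type*} [TopologicalSpace H] {I : ModelWithCorners ℝ E H}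
  {N : Type*} [TopologicalSpace N] [ChartedSpace H N] [IsManifold I ∞ N]
  {E' : Type*} [NormedAddCommGroup E'] [NormedSpace ℝ E']
  {H' : Type*} [TopologicalSpace H'] {I' : ModelWithCorners ℝ E' H'}
  {N' : Type*} [TopologicalSpace N'] [ChartedSpace H' N'] [IsManifold I' ∞ N']

/-- The partial derivative in the direction of the parameter. -/
theorem hasMFDerivAt_family_fst {l : ℝ → N → N'} {t : ℝ} {p : N}
    (hl : MDifferentiableAt (𝓘(ℝ, ℝ).prod I) I' (fun q : ℝ × N ↦ l q.1 q.2) (t, p)) :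
    HasMFDerivAt 𝓘(ℝ, ℝ) I' (fun s ↦ l s p) t
      ((mfderiv (𝓘(ℝ, ℝ).prod I) I' (fun q : ℝ × N ↦ l q.1 q.2) (t, p)).comp
        (ContinuousLinearMap.inl ℝ ℝ E)) :=
  HasMFDerivAt.comp (g := fun q : ℝ × N ↦ l q.1 q.2) t hl.hasMFDerivAt
    ((hasMFDerivAt_id (I := 𝓘(ℝ, ℝ)) t).prodMk (hasMFDerivAt_const p t))

/-- The partial derivative in the direction of the manifold. -/
theorem hasMFDerivAt_family_snd {l : ℝ → N → N'} {t : ℝ} {p : N}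
    (hl : MDifferentiableAt (𝓘(ℝ, ℝ).prod I) I' (fun q : ℝ × N ↦ l q.1 q.2) (t, p)) :
    HasMFDerivAt I I' (l t) p
      ((mfderiv (𝓘(ℝ, ℝ).prod I) I' (fun q : ℝ × N ↦ l q.1 q.2) (t, p)).comp
        (ContinuousLinearMap.inr ℝ ℝ E)) :=
  HasMFDerivAt.comp (g := fun q : ℝ × N ↦ l q.1 q.2) p hl.hasMFDerivAt
    ((hasMFDerivAt_const t p).prodMk (hasMFDerivAt_id (I := I) p))

/-- The derivative of `l_{θ(s)}(γ(s))`. -/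
theorem hasMFDerivAt_family_curve {l : ℝ → N → N'} {F : Type*} [NormedAddCommGroup F]
    [NormedSpace ℝ F] {HF : Type*} [TopologicalSpace HF] {J : ModelWithCorners ℝ F HF}
    {P : Type*} [TopologicalSpace P] [ChartedSpace HF P] {θ : P → ℝ} {γ : P → N} {t : P}
    (hl : MDifferentiableAt (𝓘(ℝ, ℝ).prod I) I' (fun q : ℝ × N ↦ l q.1 q.2) (θ t, γ t))
    {θ' : TangentSpace J t →L[ℝ] ℝ} {γ' : TangentSpace J t →L[ℝ] TangentSpace I (γ t)}
    (hθ : HasMFDerivAt J 𝓘(ℝ, ℝ) θ t θ') (hγ : HasMFDerivAt J I γ t γ') :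
    HasMFDerivAt J I' (fun s ↦ l (θ s) (γ s)) t
      ((mfderiv 𝓘(ℝ, ℝ) I' (fun s ↦ l s (γ t)) (θ t)).comp θ' +
        (mfderiv I I' (l (θ t)) (γ t)).comp γ') := by
  have h := HasMFDerivAt.comp (g := fun q : ℝ × N ↦ l q.1 q.2) (f := fun s ↦ (θ s, γ s)) t
    hl.hasMFDerivAt (hθ.prodMk hγ)
  refine h.congr_mfderiv ?_
  rw [(hasMFDerivAt_family_fst hl).mfderiv, (hasMFDerivAt_family_snd hl).mfderiv]
  let L : ℝ × E →L[ℝ] E' :=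
    mfderiv (𝓘(ℝ, ℝ).prod I) I' (fun q : ℝ × N ↦ l q.1 q.2) (θ t, γ t)
  let a : F →L[ℝ] ℝ := θ'
  let b : F →L[ℝ] E := γ'
  change L.comp (a.prod b) = (L.comp (ContinuousLinearMap.inl ℝ ℝ E)).comp a +
    (L.comp (ContinuousLinearMap.inr ℝ ℝ E)).comp b
  ext w
  simp [← map_add]

variable {A : Type*} [NormedAddCommGroup A] [NormedSpace ℝ A] {HA : Type*} [TopologicalSpace HA]
  {J : ModelWithCorners ℝ A HA} {Q : Type*} [TopologicalSpace Q] [ChartedSpace HA Q]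

theorem contMDiffAt_tangent_prodMk {s : Q → ℝ} {c : Q → ℝ} {b : Q → N}
    {w : ∀ q, TangentSpace I (b q)} {q₀ : Q} (hs : ContMDiffAt J 𝓘(ℝ, ℝ) ∞ s q₀)
    (hc : ContMDiffAt J 𝓘(ℝ, ℝ) ∞ c q₀)
    (hw : ContMDiffAt J I.tangent ∞ (fun q ↦ (⟨b q, w q⟩ : TangentBundle I N)) q₀) :
    ContMDiffAt J (𝓘(ℝ, ℝ).prod I).tangent ∞ (fun q ↦
      (⟨(s q, b q), (c q, w q)⟩ : TangentBundle (𝓘(ℝ, ℝ).prod I) (ℝ × N))) q₀ := by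
  have h1 : ContMDiffAt J 𝓘(ℝ, ℝ).tangent ∞
      (fun q ↦ (⟨s q, c q⟩ : TangentBundle 𝓘(ℝ, ℝ) ℝ)) q₀ := by
    rw [Bundle.contMDiffAt_totalSpace]
    refine ⟨hs, hc.congr_of_eventuallyEq ?_⟩
    filter_upwards with q
    simp
  exact (contMDiff_equivTangentBundleProd_symm (I := 𝓘(ℝ, ℝ)) (M := ℝ) (I' := I)
      (M' := N) (n := ∞)).contMDiffAt.comp q₀ (h1.prodMk hw)

/-- Applying the derivative of a smooth family of maps to a smooth family of tangent vectors. -/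
theorem contMDiffAt_family_derivative {l : ℝ → N → N'} {U : Set (ℝ × N)} (hU : IsOpen U)
    (hl : ContMDiffOn (𝓘(ℝ, ℝ).prod I) I' ∞ (fun q : ℝ × N ↦ l q.1 q.2) U)
    {s : Q → ℝ} {b : Q → N}
    {w : ∀ q, TangentSpace I (b q)} {q₀ : Q} (hs : ContMDiffAt J 𝓘(ℝ, ℝ) ∞ s q₀)
    (hw : ContMDiffAt J I.tangent ∞ (fun q ↦ (⟨b q, w q⟩ : TangentBundle I N)) q₀)
    (hq₀ : (s q₀, b q₀) ∈ U) :
    ContMDiffAt J I'.tangent ∞ (fun q ↦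
      (⟨l (s q) (b q), mfderiv I I' (l (s q)) (b q) (w q)⟩ : TangentBundle I' N')) q₀ := by
  have h1 := contMDiffAt_tangent_prodMk hs (contMDiffAt_const (c := (0 : ℝ))) hw
  have h2 := (contMDiffAt_tangentMap hU hl
    (⟨(s q₀, b q₀), (0, w q₀)⟩ : TangentBundle (𝓘(ℝ, ℝ).prod I) (ℝ × N)) hq₀).comp q₀ h1
  refine h2.congr_of_eventuallyEq ?_
  have hb : ContinuousAt b q₀ :=
    ((Bundle.contMDiff_proj (TangentSpace I : N → Type _) (n := ∞)).contMDiffAt.comp q₀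
      hw).continuousAt
  filter_upwards [(hs.continuousAt.prodMk hb).preimage_mem_nhds (hU.mem_nhds hq₀)] with q hq
  have h3 := (hasMFDerivAt_family_snd
    ((hl.contMDiffAt (hU.mem_nhds hq)).mdifferentiableAt (by simp))).mfderiv
  rw [h3]
  rfl

end Families

/-! ### Velocities of families. -/

section Velocity

variable {n : ℕ} {M : Type*} [TopologicalSpace M]
  [ChartedSpace (EuclideanSpace ℝ (Fin (2 * n + 1))) M] [IsManifold (𝓡 (2 * n + 1)) ∞ M]
  {α : ∀ x : M, TangentSpace (𝓡 (2 * n + 1)) x →L[ℝ] ℝ}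
  {E : Type*} [NormedAddCommGroup E] [NormedSpace ℝ E]
  {H : Type*} [TopologicalSpace H] {I : ModelWithCorners ℝ E H}
  {N : Type*} [TopologicalSpace N] [ChartedSpace H N] [IsManifold I ∞ N]

theorem contMDiff_velocity {l : ℝ → N → M}
    (hl : ContMDiff (𝓘(ℝ, ℝ).prod I) (𝓡 (2 * n + 1)) ∞ (fun q : ℝ × N ↦ l q.1 q.2)) :
    ContMDiff (𝓘(ℝ, ℝ).prod I) (𝓡 (2 * n + 1)).tangent ∞
      (fun q : ℝ × N ↦ (⟨l q.1 q.2, velocity l q.1 q.2⟩ :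
        TangentBundle (𝓡 (2 * n + 1)) M)) := by
  intro q₀
  have h0 : ContMDiffAt (𝓘(ℝ, ℝ).prod I) I.tangent ∞
      (fun q : ℝ × N ↦ (⟨q.2, (0 : E)⟩ : TangentBundle I N)) q₀ :=
    (Bundle.contMDiff_zeroSection ℝ (TangentSpace I : N → Type _)).contMDiffAt.comp q₀
      contMDiffAt_snd
  have h1 := contMDiffAt_tangent_prodMk (I := I) (b := fun q : ℝ × N ↦ q.2)
    (w := fun _ ↦ (0 : E)) contMDiffAt_fst (contMDiffAt_const (c := (1 : ℝ))) h0
  have h2 := (contMDiffAt_tangentMap isOpen_univ hl.contMDiffOn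
    (⟨(q₀.1, q₀.2), ((1 : ℝ), (0 : E))⟩ : TangentBundle (𝓘(ℝ, ℝ).prod I) (ℝ × N))
    (mem_univ _)).comp q₀ h1
  refine h2.congr_of_eventuallyEq ?_
  filter_upwards with q
  have h3 := (hasMFDerivAt_family_fst (hl.mdifferentiableAt (by simp) (x := (q.1, q.2)))).mfderiv
  rw [velocity, h3]
  rfl

theorem velocity_eq {l : ℝ → N → M} {t : ℝ} {p : N} {v : TangentSpace (𝓡 (2 * n + 1)) (l t p)}
    (h : HasMFDerivAt 𝓘(ℝ, ℝ) (𝓡 (2 * n + 1)) (fun s ↦ l s p) t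
      ((1 : ℝ →L[ℝ] ℝ).smulRight v)) : velocity l t p = v := by
  rw [velocity, h.mfderiv]
  exact one_smul ℝ (v : EuclideanSpace ℝ (Fin (2 * n + 1)))

/-- The velocity of `l_{θ(t)}(m_t(p))`. -/
theorem velocity_comp {P : Type*} {l : ℝ → N → M} {m : ℝ → P → N}
    (hl : ContMDiff (𝓘(ℝ, ℝ).prod I) (𝓡 (2 * n + 1)) ∞ (fun q : ℝ × N ↦ l q.1 q.2))
    {θ : ℝ → ℝ} {θ' : ℝ} {t : ℝ} (hθ : HasDerivAt θ θ' t) {p : P}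
    (hm : MDifferentiableAt 𝓘(ℝ, ℝ) I (fun s ↦ m s p) t) :
    velocity (n := n) (fun s p ↦ l (θ s) (m s p)) t p =
      θ' • velocity l (θ t) (m t p) + mfderiv I (𝓡 (2 * n + 1)) (l (θ t)) (m t p)
        (mfderiv 𝓘(ℝ, ℝ) I (fun s ↦ m s p) t (1 : ℝ)) := by
  have h := hasMFDerivAt_family_curve (l := l) (J := 𝓘(ℝ, ℝ))
    (hl.mdifferentiableAt (by simp) (x := (θ t, m t p))) hθ.hasFDerivAt.hasMFDerivAt
    hm.hasMFDerivAt
  rw [velocity, h.mfderiv]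
  let L : ℝ →L[ℝ] EuclideanSpace ℝ (Fin (2 * n + 1)) :=
    mfderiv 𝓘(ℝ, ℝ) (𝓡 (2 * n + 1)) (fun s ↦ l s (m t p)) (θ t)
  let w : EuclideanSpace ℝ (Fin (2 * n + 1)) := mfderiv I (𝓡 (2 * n + 1)) (l (θ t)) (m t p)
        (mfderiv 𝓘(ℝ, ℝ) I (fun s ↦ m s p) t (1 : ℝ))
  change L ((1 : ℝ) • θ') + w = θ' • L 1 + w
  rw [one_smul, ← map_smul, smul_eq_mul, mul_one]

theorem velocity_reparam {l : ℝ → N → M}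
    (hl : ContMDiff (𝓘(ℝ, ℝ).prod I) (𝓡 (2 * n + 1)) ∞ (fun q : ℝ × N ↦ l q.1 q.2))
    {θ : ℝ → ℝ} {θ' : ℝ} {t : ℝ} (hθ : HasDerivAt θ θ' t) (p : N) :
    velocity (n := n) (fun s p ↦ l (θ s) p) t p = θ' • velocity l (θ t) p := by
  have h := velocity_comp (m := fun _ p ↦ p) (p := p) hl hθ mdifferentiableAt_const
  rw [h, mfderiv_const]
  let L : E →L[ℝ] EuclideanSpace ℝ (Fin (2 * n + 1)) := mfderiv I (𝓡 (2 * n + 1)) (l (θ t)) p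
  let w : EuclideanSpace ℝ (Fin (2 * n + 1)) := θ' • velocity l (θ t) p
  change w + L 0 = w
  rw [map_zero, add_zero]

/-- The Reeb field is the contact field of the constant Hamiltonian 1. -/
theorem IsContactForm.contMDiff_reebField (hα : IsContactForm α) :
    ContMDiff (𝓡 (2 * n + 1)) (𝓡 (2 * n + 1)).tangent ∞
      (fun x : M ↦ (⟨x, reebField α x⟩ : TangentBundle (𝓡 (2 * n + 1)) M)) := by
  have h := (hα.contMDiff_hamField (F := fun _ _ ↦ 1) contMDiff_const).comp
    ((contMDiff_const (c := (0 : ℝ))).prodMk contMDiff_id)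
  refine h.congr fun x ↦ ?_
  simp only [Function.comp]
  rw [hα.hamField_eq_reebField (Filter.Eventually.of_forall fun _ ↦ rfl)]
  rfl

theorem IsContactForm.contMDiff_form_velocity (hα : IsContactForm α) {l : ℝ → N → M}
    (hl : ContMDiff (𝓘(ℝ, ℝ).prod I) (𝓡 (2 * n + 1)) ∞ (fun q : ℝ × N ↦ l q.1 q.2)) :
    ContMDiff (𝓘(ℝ, ℝ).prod I) 𝓘(ℝ, ℝ) ∞
      (fun q : ℝ × N ↦ α (l q.1 q.2) (velocity l q.1 q.2)) :=
  fun q ↦ hα.contMDiffAt_apply (contMDiff_velocity hl q)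

end Velocity

/-! ### Variation of the contact form along a family. -/

section ConformalFactor

variable {n : ℕ} {M : Type*} [TopologicalSpace M]
  [ChartedSpace (EuclideanSpace ℝ (Fin (2 * n + 1))) M] [IsManifold (𝓡 (2 * n + 1)) ∞ M]
  {α : ∀ x : M, TangentSpace (𝓡 (2 * n + 1)) x →L[ℝ] ℝ}

/-- Along a two-parameter family `G(t, s)`: if `α(∂_t G) = h`, then
`∂_t (α(∂_s G)) = ∂_s h + dα(∂_t G, ∂_s G)`. -/
theorem IsContactForm.hasDerivAt_form_family (hα : IsContactForm α) {G : ℝ × ℝ → M} {t s : ℝ}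
    (hG : ∀ᶠ y in 𝓝 (t, s), ContMDiffAt 𝓘(ℝ, ℝ × ℝ) (𝓡 (2 * n + 1)) ∞ G y)
    {h : ℝ → ℝ} {h' : ℝ} (hh : HasDerivAt h h' s)
    (hP : ∀ᶠ s' in 𝓝 s, pullForm α G (t, s') (1, 0) = h s') :
    HasDerivAt (fun t' ↦ pullForm α G (t', s) (0, 1))
      (h' + dForm α (G (t, s)) (mfderiv 𝓘(ℝ, ℝ × ℝ) (𝓡 (2 * n + 1)) G (t, s) ((1, 0) : ℝ × ℝ))
        (mfderiv 𝓘(ℝ, ℝ × ℝ) (𝓡 (2 * n + 1)) G (t, s) ((0, 1) : ℝ × ℝ))) t := by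
  -- For the pulled-back form P the fields ∂_t and ∂_s commute, so dP(∂_t, ∂_s) = ∂_t P(∂_s) - ∂_s
  -- P(∂_t).
  obtain ⟨hd, hB⟩ := hα.fderiv_pullForm_sub hG
  have h1 : HasDerivAt (fun t' ↦ pullForm α G (t', s)) (fderiv ℝ (pullForm α G) (t, s) (1, 0))
      t := by
    have := hd.hasFDerivAt.comp_hasDerivAt t ((hasDerivAt_id t).prodMk (hasDerivAt_const t s))
    exact this
  have h2 : HasDerivAt (fun s' ↦ pullForm α G (t, s')) (fderiv ℝ (pullForm α G) (t, s) (0, 1))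
      s := by
    have := hd.hasFDerivAt.comp_hasDerivAt s ((hasDerivAt_const s t).prodMk (hasDerivAt_id s))
    exact this
  have h3 := h1.clm_apply (hasDerivAt_const t ((0, 1) : ℝ × ℝ))
  have h4 := h2.clm_apply (hasDerivAt_const s ((1, 0) : ℝ × ℝ))
  have h5 : h' = fderiv ℝ (pullForm α G) (t, s) (0, 1) (1, 0) := by
    have := (h4.congr_of_eventuallyEq (hP.mono fun _ h ↦ h.symm)).unique hh
    simpa using this.symm
  refine h3.congr_deriv ?_
  rw [h5, ← hB]
  simp

theorem exists_curve_through {E : Type*} [NormedAddCommGroup E] [NormedSpace ℝ E]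
    [FiniteDimensional ℝ E] {H : Type*} [TopologicalSpace H] {I : ModelWithCorners ℝ E H}
    [I.Boundaryless] {N : Type*} [TopologicalSpace N] [ChartedSpace H N] [IsManifold I ∞ N]
    (x : N) (v : TangentSpace I x) :
    ∃ c : ℝ → N, c 0 = x ∧ (∀ᶠ s in 𝓝 0, ContMDiffAt 𝓘(ℝ, ℝ) I ∞ c s) ∧
      (mfderiv 𝓘(ℝ, ℝ) I c 0 (1 : ℝ) : E) = v := by
  set e := extChartAt I x with he
  have hT : IsOpen e.target := isOpen_extChartAt_target (I := I) x
  have hy : e x ∈ e.target := mem_extChartAt_target (I := I) x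
  have hxs : x ∈ e.source := mem_extChartAt_source (I := I) x
  have hx : e.symm (e x) = x := e.left_inv hxs
  let w : E := mfderiv I 𝓘(ℝ, E) e x v
  have hw : (mfderiv 𝓘(ℝ, E) I e.symm (e x) w : E) = v := mfderiv_extChartAt_symm_comp hxs v
  have hc : ContDiff ℝ ∞ (fun s : ℝ ↦ e x + s • w) := by fun_prop
  have h0 : Filter.Tendsto (fun s : ℝ ↦ e x + s • w) (𝓝 0) (𝓝 (e x)) := by
    simpa using hc.continuous.tendsto 0
  refine ⟨fun s ↦ e.symm (e x + s • w), by simpa using hx, ?_, ?_⟩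
  · filter_upwards [h0.eventually (hT.mem_nhds hy)] with s hs
    exact ContMDiffAt.comp (f := fun s : ℝ ↦ e x + s • w) s
      ((contMDiffOn_extChartAt_symm (I := I) (n := ∞) x).contMDiffAt (hT.mem_nhds hs))
      hc.contMDiff.contMDiffAt
  · have h1 : HasDerivAt (fun s : ℝ ↦ e x + s • w) w 0 := by
      simpa using ((hasDerivAt_id (0 : ℝ)).smul_const w).const_add (e x)
    have hy' : e x + (0 : ℝ) • w ∈ e.target := by simpa using hy
    have h2 := HasMFDerivAt.comp (f := fun s : ℝ ↦ e x + s • w) 0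
      (hasMFDerivAt_extChartAt_symm (I := I) hy') h1.hasFDerivAt.hasMFDerivAt
    have h3 : mfderiv 𝓘(ℝ, ℝ) I (fun s : ℝ ↦ e.symm (e x + s • w)) 0 = _ :=
      h2.mfderiv
    rw [h3]
    have h4 : ∀ y, y = e x → (mfderiv 𝓘(ℝ, E) I e.symm y ((1 : ℝ) • w) : E) = v := by
      rintro y rfl
      rw [one_smul]
      exact hw
    exact h4 _ (by simp)

/-- If `α(∂_t l) = h` at time `t`, then the derivative of `α(Dl_t(u))` in `t` is
`dh(u) + dα(∂_t l, Dl_t(u))`. -/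
theorem IsContactForm.hasDerivAt_form_derivative (hα : IsContactForm α)
    {E : Type*} [NormedAddCommGroup E] [NormedSpace ℝ E]
    [FiniteDimensional ℝ E] {H : Type*} [TopologicalSpace H] {I : ModelWithCorners ℝ E H}
    [I.Boundaryless] {N : Type*} [TopologicalSpace N] [ChartedSpace H N] [IsManifold I ∞ N]
    {l : ℝ → N → M}
    (hl : ContMDiff (𝓘(ℝ, ℝ).prod I) (𝓡 (2 * n + 1)) ∞ (fun q : ℝ × N ↦ l q.1 q.2))
    {t : ℝ} {p : N} {h : N → ℝ} {h' : TangentSpace I p →L[ℝ] ℝ}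
    (hh : HasMFDerivAt I 𝓘(ℝ, ℝ) h p h') (hP : ∀ p, α (l t p) (velocity l t p) = h p)
    (u : TangentSpace I p) :
    HasDerivAt (fun t' ↦ α (l t' p) (mfderiv I (𝓡 (2 * n + 1)) (l t') p u))
      (h' u + dForm α (l t p) (velocity l t p) (mfderiv I (𝓡 (2 * n + 1)) (l t) p u)) t := by
  -- Realising u as the velocity of a curve c reduces the claim to the two-parameter map G(t, s) =
  -- l_t(c(s)).
  obtain ⟨c, rfl, hcs, rfl⟩ := exists_curve_through p u
  let G : ℝ × ℝ → M := fun y ↦ l y.1 (c y.2)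
  have hGd : ∀ t s, ContMDiffAt 𝓘(ℝ, ℝ) I ∞ c s →
      HasMFDerivAt 𝓘(ℝ, ℝ × ℝ) (𝓡 (2 * n + 1)) G (t, s)
        ((mfderiv 𝓘(ℝ, ℝ) (𝓡 (2 * n + 1)) (fun s' ↦ l s' (c s)) t).comp
            (ContinuousLinearMap.fst ℝ ℝ ℝ) +
          (mfderiv I (𝓡 (2 * n + 1)) (l t) (c s)).comp ((mfderiv 𝓘(ℝ, ℝ) I c s).comp
            (ContinuousLinearMap.snd ℝ ℝ ℝ))) := by
    intro t s hs
    have h1 : HasMFDerivAt 𝓘(ℝ, ℝ × ℝ) 𝓘(ℝ, ℝ) (Prod.fst : ℝ × ℝ → ℝ) (t, s)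
        (ContinuousLinearMap.fst ℝ ℝ ℝ) := hasFDerivAt_fst.hasMFDerivAt
    have h2 : HasMFDerivAt 𝓘(ℝ, ℝ × ℝ) 𝓘(ℝ, ℝ) (Prod.snd : ℝ × ℝ → ℝ) (t, s)
        (ContinuousLinearMap.snd ℝ ℝ ℝ) := hasFDerivAt_snd.hasMFDerivAt
    have h3 : HasMFDerivAt 𝓘(ℝ, ℝ × ℝ) I (fun y : ℝ × ℝ ↦ c y.2) (t, s) _ :=
      HasMFDerivAt.comp (t, s) (hs.mdifferentiableAt (by simp)).hasMFDerivAt h2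
    exact hasMFDerivAt_family_curve (l := l) (θ := Prod.fst) (γ := fun y : ℝ × ℝ ↦ c y.2)
      (hl.mdifferentiableAt (by simp)) h1 h3
  have hfst : ∀ t s, ContMDiffAt 𝓘(ℝ, ℝ) I ∞ c s →
      (mfderiv 𝓘(ℝ, ℝ × ℝ) (𝓡 (2 * n + 1)) G (t, s) ((1, 0) : ℝ × ℝ) :
        EuclideanSpace ℝ (Fin (2 * n + 1))) = velocity l t (c s) := by
    intro t s hs
    rw [(hGd t s hs).mfderiv]
    let L : ℝ →L[ℝ] EuclideanSpace ℝ (Fin (2 * n + 1)) :=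
      mfderiv 𝓘(ℝ, ℝ) (𝓡 (2 * n + 1)) (fun s' ↦ l s' (c s)) t
    let L' : ℝ →L[ℝ] EuclideanSpace ℝ (Fin (2 * n + 1)) :=
      (mfderiv I (𝓡 (2 * n + 1)) (l t) (c s)).comp (mfderiv 𝓘(ℝ, ℝ) I c s)
    change L 1 + L' 0 = L 1
    rw [map_zero, add_zero]
  have hsnd : ∀ t s, ContMDiffAt 𝓘(ℝ, ℝ) I ∞ c s →
      (mfderiv 𝓘(ℝ, ℝ × ℝ) (𝓡 (2 * n + 1)) G (t, s) ((0, 1) : ℝ × ℝ) :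
        EuclideanSpace ℝ (Fin (2 * n + 1))) = mfderiv I (𝓡 (2 * n + 1)) (l t) (c s)
          (mfderiv 𝓘(ℝ, ℝ) I c s (1 : ℝ)) := by
    intro t s hs
    rw [(hGd t s hs).mfderiv]
    let L : ℝ →L[ℝ] EuclideanSpace ℝ (Fin (2 * n + 1)) :=
      mfderiv 𝓘(ℝ, ℝ) (𝓡 (2 * n + 1)) (fun s' ↦ l s' (c s)) t
    let L' : ℝ →L[ℝ] EuclideanSpace ℝ (Fin (2 * n + 1)) :=
      (mfderiv I (𝓡 (2 * n + 1)) (l t) (c s)).comp (mfderiv 𝓘(ℝ, ℝ) I c s)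
    change L 0 + L' 1 = L' 1
    rw [map_zero, zero_add]
  have hGs : ∀ᶠ y in 𝓝 (t, (0 : ℝ)), ContMDiffAt 𝓘(ℝ, ℝ × ℝ) (𝓡 (2 * n + 1)) ∞ G y := by
    have h1 : Filter.Tendsto (Prod.snd : ℝ × ℝ → ℝ) (𝓝 (t, 0)) (𝓝 0) := continuousAt_snd
    filter_upwards [h1.eventually hcs] with y hy
    refine ContMDiffAt.comp (g := fun q : ℝ × N ↦ l q.1 q.2) (f := fun y : ℝ × ℝ ↦ (y.1, c y.2))
      y hl.contMDiffAt (contDiff_fst.contMDiff.contMDiffAt.prodMk ?_)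
    exact ContMDiffAt.comp (f := (Prod.snd : ℝ × ℝ → ℝ)) y hy contDiff_snd.contMDiff.contMDiffAt
  have hc0 := hcs.self_of_nhds
  have hh' : HasDerivAt (fun s ↦ h (c s)) (h' (mfderiv 𝓘(ℝ, ℝ) I c 0 (1 : ℝ))) 0 := by
    have h1 := HasMFDerivAt.comp (0 : ℝ) hh (hc0.mdifferentiableAt (by simp)).hasMFDerivAt
    let L : ℝ →L[ℝ] ℝ := h'.comp (mfderiv 𝓘(ℝ, ℝ) I c 0)
    have h2 : HasFDerivAt (fun s ↦ h (c s)) L 0 := hasMFDerivAt_iff_hasFDerivAt.1 h1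
    exact h2.hasDerivAt
  have hmain := hα.hasDerivAt_form_family hGs hh' (by
    filter_upwards [hcs] with s hs
    rw [← hP (c s)]
    exact congrArg (fun w : EuclideanSpace ℝ (Fin (2 * n + 1)) ↦
      α (l t (c s)) (show TangentSpace (𝓡 (2 * n + 1)) (l t (c s)) from w)) (hfst t s hs))
  have e1 := hfst t 0 hc0
  have e2 := hsnd t 0 hc0
  refine (hmain.congr_deriv ?_).congr_of_eventuallyEq ?_
  · exact congrArg₂ (fun w w' : EuclideanSpace ℝ (Fin (2 * n + 1)) ↦
      h' (mfderiv 𝓘(ℝ, ℝ) I c 0 (1 : ℝ)) + dForm α (l t (c 0))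
      (show TangentSpace (𝓡 (2 * n + 1)) (l t (c 0)) from w)
      (show TangentSpace (𝓡 (2 * n + 1)) (l t (c 0)) from w')) e1 e2
  · filter_upwards with t'
    exact congrArg (fun w : EuclideanSpace ℝ (Fin (2 * n + 1)) ↦
      α (l t' (c 0)) (show TangentSpace (𝓡 (2 * n + 1)) (l t' (c 0)) from w))
      (hsnd t' 0 hc0).symm

end ConformalFactor

/-! ### Uniqueness for time-dependent fields. -/

section Uniqueness

variable {E : Type*} [NormedAddCommGroup E] [NormedSpace ℝ E] [FiniteDimensional ℝ E]
  {H : Type*} [TopologicalSpace H] {I : ModelWithCorners ℝ E H} [I.Boundaryless]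
  {N : Type*} [TopologicalSpace N] [ChartedSpace H N] [IsManifold I ∞ N] [T2Space N]

theorem eq_of_hasMFDerivAt_timeDependent {X : ℝ → ∀ x : N, TangentSpace I x}
    (hX : ContMDiff (𝓘(ℝ, ℝ).prod I) I.tangent ∞
      (fun q : ℝ × N ↦ (⟨q.2, X q.1 q.2⟩ : TangentBundle I N))) {c c' : ℝ → N} {t₀ : ℝ}
    (hc : ∀ t, HasMFDerivAt 𝓘(ℝ, ℝ) I c t ((1 : ℝ →L[ℝ] ℝ).smulRight (X t (c t))))
    (hc' : ∀ t, HasMFDerivAt 𝓘(ℝ, ℝ) I c' t ((1 : ℝ →L[ℝ] ℝ).smulRight (X t (c' t))))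
    (h : c t₀ = c' t₀) : c = c' := by
  let v : ∀ q : ℝ × N, TangentSpace (𝓘(ℝ, ℝ).prod I) q := fun q ↦ ((1 : ℝ), X q.1 q.2)
  have hv : ContMDiff (𝓘(ℝ, ℝ).prod I) (𝓘(ℝ, ℝ).prod I).tangent ∞
      (fun q ↦ (⟨q, v q⟩ : TangentBundle (𝓘(ℝ, ℝ).prod I) (ℝ × N))) := fun q ↦
    contMDiffAt_tangent_prodMk contMDiffAt_fst (contMDiffAt_const (c := (1 : ℝ))) (hX q)
  have hcurve : ∀ c : ℝ → N, (∀ t, HasMFDerivAt 𝓘(ℝ, ℝ) I c t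
      ((1 : ℝ →L[ℝ] ℝ).smulRight (X t (c t)))) → IsMIntegralCurve (fun t ↦ (t, c t)) v := by
    intro c hc t
    refine ((hasMFDerivAt_id (I := 𝓘(ℝ, ℝ)) t).prodMk (hc t)).congr_mfderiv ?_
    refine ContinuousLinearMap.ext fun (w : ℝ) ↦ Prod.ext ?_ rfl
    exact (mul_one w).symm
  have h2 := isMIntegralCurve_Ioo_eq_of_contMDiff_boundaryless (t₀ := t₀)
    (contMDiff_one_vectorField hv) (hcurve c hc) (hcurve c' hc') (by rw [h])
  funext t
  exact congrArg Prod.snd (congrFun h2 t)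

end Uniqueness

/-! ### Paths of co-orientation preserving contactomorphisms. -/

section PosPath

variable {n : ℕ} {M : Type*} [TopologicalSpace M]
  [ChartedSpace (EuclideanSpace ℝ (Fin (2 * n + 1))) M] [IsManifold (𝓡 (2 * n + 1)) ∞ M]
  {α : ∀ x : M, TangentSpace (𝓡 (2 * n + 1)) x →L[ℝ] ℝ}

theorem hasMFDerivAt_of_velocity {N : Type*} {l : ℝ → N → M} {t : ℝ} {p : N}
    {v : TangentSpace (𝓡 (2 * n + 1)) (l t p)}
    (hl : MDifferentiableAt 𝓘(ℝ, ℝ) (𝓡 (2 * n + 1)) (fun s ↦ l s p) t)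
    (h : velocity l t p = v) :
    HasMFDerivAt 𝓘(ℝ, ℝ) (𝓡 (2 * n + 1)) (fun s ↦ l s p) t
      ((1 : ℝ →L[ℝ] ℝ).smulRight v) := by
  refine hl.hasMFDerivAt.congr_mfderiv (ContinuousLinearMap.ext fun (w : ℝ) ↦ ?_)
  rw [← h]
  let L : ℝ →L[ℝ] EuclideanSpace ℝ (Fin (2 * n + 1)) :=
    mfderiv 𝓘(ℝ, ℝ) (𝓡 (2 * n + 1)) (fun s ↦ l s p) t
  change L w = w • L 1
  rw [← map_smul, smul_eq_mul, mul_one]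

theorem continuous_differential_reebField (hα : IsContactForm α) {F : ℝ → M → ℝ}
    (hF : ContMDiff (𝓘(ℝ, ℝ).prod (𝓡 (2 * n + 1))) 𝓘(ℝ, ℝ) ∞ (fun q : ℝ × M ↦ F q.1 q.2)) :
    Continuous (fun q : ℝ × M ↦ differential (F q.1) q.2 (reebField α q.2)) := by
  rw [continuous_iff_continuousAt]
  intro q₀
  have h1 := contMDiffAt_family_derivative (l := F) isOpen_univ hF.contMDiffOn
    (s := fun q : ℝ × M ↦ q.1) (b := fun q : ℝ × M ↦ q.2)
    (w := fun q : ℝ × M ↦ reebField α q.2) (q₀ := q₀) contMDiffAt_fst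
    (hα.contMDiff_reebField.contMDiffAt.comp q₀ contMDiffAt_snd) (mem_univ _)
  have h2 := (Bundle.contMDiffAt_totalSpace.1 h1).2.continuousAt
  refine h2.congr ?_
  filter_upwards with q
  simp
  rfl

/-- A diffeotopy generated by contact Hamiltonians preserves `ker α` and its co-orientation. -/
theorem IsContactForm.exists_conformal_of_velocity (hα : IsContactForm α) {φ : ℝ → M → M}
    {F : ℝ → M → ℝ}
    (hφ : ContMDiff (𝓘(ℝ, ℝ).prod (𝓡 (2 * n + 1))) (𝓡 (2 * n + 1)) ∞
      (fun q : ℝ × M ↦ φ q.1 q.2))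
    (hF : ContMDiff (𝓘(ℝ, ℝ).prod (𝓡 (2 * n + 1))) 𝓘(ℝ, ℝ) ∞ (fun q : ℝ × M ↦ F q.1 q.2))
    (h0 : ∀ x, φ 0 x = x) (hv : ∀ t x, velocity φ t x = hamField α (F t) (φ t x))
    (t : ℝ) (x : M) : ∃ c > 0, ∀ v : TangentSpace (𝓡 (2 * n + 1)) x,
      α (φ t x) (mfderiv (𝓡 (2 * n + 1)) (𝓡 (2 * n + 1)) (φ t) x v) = c * α x v := by
  -- With a(t) = α(Dφ_t v), the variation formula and the Hamiltonian equation cancel the dF-terms,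
  -- leaving a' = k a with k = dF(R). So a is multiplied by exp ∫ k > 0.
  let k : ℝ → ℝ := fun t ↦ differential (F t) (φ t x) (reebField α (φ t x))
  have hk : Continuous k := (continuous_differential_reebField hα hF).comp
    (continuous_id.prodMk (hφ.continuous.comp (continuous_id.prodMk continuous_const)))
  have hφt : ∀ t, ContMDiff (𝓡 (2 * n + 1)) (𝓡 (2 * n + 1)) ∞ (φ t) := fun t ↦
    hφ.comp (contMDiff_const.prodMk contMDiff_id)
  have hFt : ∀ t, ContMDiff (𝓡 (2 * n + 1)) 𝓘(ℝ, ℝ) ∞ (F t) := fun t ↦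
    hF.comp (contMDiff_const.prodMk contMDiff_id)
  refine ⟨Real.exp (∫ s in (0 : ℝ)..t, k s), Real.exp_pos _, fun v ↦ ?_⟩
  let a : ℝ → ℝ := fun t ↦ α (φ t x) (mfderiv (𝓡 (2 * n + 1)) (𝓡 (2 * n + 1)) (φ t) x v)
  have ha : ∀ t, HasDerivAt a (k t * a t) t := by
    intro t
    have h1 := hα.hasDerivAt_form_derivative hφ (t := t) (p := x) (h := fun x ↦ F t (φ t x))
      (HasMFDerivAt.comp x ((hFt t).mdifferentiable (by simp) (φ t x)).hasMFDerivAt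
        ((hφt t).mdifferentiable (by simp) x).hasMFDerivAt)
      (fun y ↦ by rw [hv, hα.form_hamField]) v
    refine h1.congr_deriv ?_
    rw [hv, hα.dForm_hamField]
    exact add_neg_cancel_left (differential (F t) (φ t x)
      (mfderiv (𝓡 (2 * n + 1)) (𝓡 (2 * n + 1)) (φ t) x v)) _
  have hg : ∀ t, HasDerivAt (fun t ↦ a t * Real.exp (-∫ s in (0 : ℝ)..t, k s)) 0 t := by
    intro t
    have h1 : HasDerivAt (fun t ↦ ∫ s in (0 : ℝ)..t, k s) (k t) t :=
      intervalIntegral.integral_hasDerivAt_right (hk.intervalIntegrable _ _)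
        (hk.stronglyMeasurableAtFilter _ _) hk.continuousAt
    refine ((ha t).mul h1.neg.exp).congr_deriv ?_
    ring
  have h2 := is_const_of_deriv_eq_zero (fun t ↦ (hg t).differentiableAt)
    (fun t ↦ (hg t).deriv) t 0
  have ha0 : a 0 = α x v := by
    have h3 : φ 0 = id := funext h0
    change α (φ 0 x) (mfderiv (𝓡 (2 * n + 1)) (𝓡 (2 * n + 1)) (φ 0) x v) = α x v
    rw [h3, mfderiv_id]
    rfl
  simp only [intervalIntegral.integral_same, neg_zero, Real.exp_zero, mul_one, ha0] at h2
  rw [← h2]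
  change a t = _
  rw [mul_comm, mul_assoc, ← Real.exp_add]
  simp

/-- The factor by which a contactomorphism scales `α`. -/
def conformalFactor (α : ∀ x : M, TangentSpace (𝓡 (2 * n + 1)) x →L[ℝ] ℝ) (g : M → M) (x : M) :
    ℝ :=
  α (g x) (mfderiv (𝓡 (2 * n + 1)) (𝓡 (2 * n + 1)) g x (reebField α x))

/-- A compactly supported smooth path of co-orientation preserving contactomorphisms,
parametrised by the whole real line. -/
structure IsPosPath (α : ∀ x : M, TangentSpace (𝓡 (2 * n + 1)) x →L[ℝ] ℝ) (φ : ℝ → M → M) :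
    Prop where
  contMDiff : ContMDiff (𝓘(ℝ, ℝ).prod (𝓡 (2 * n + 1))) (𝓡 (2 * n + 1)) ∞
    (fun q : ℝ × M ↦ φ q.1 q.2)
  diffeo : ∀ t, ∃ Φ : Diffeomorph (𝓡 (2 * n + 1)) (𝓡 (2 * n + 1)) M M ∞, ⇑Φ = φ t
  conformal : ∀ t x, ∃ c > 0, ∀ v : TangentSpace (𝓡 (2 * n + 1)) x,
    α (φ t x) (mfderiv (𝓡 (2 * n + 1)) (𝓡 (2 * n + 1)) (φ t) x v) = c * α x v
  compactSupport : ∃ K : Set M, IsCompact K ∧ ∀ t, ∀ x ∉ K, φ t x = x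

variable {φ ψ : ℝ → M → M}

theorem IsPosPath.contMDiff_time (hφ : IsPosPath α φ) (t : ℝ) :
    ContMDiff (𝓡 (2 * n + 1)) (𝓡 (2 * n + 1)) ∞ (φ t) :=
  hφ.contMDiff.comp (contMDiff_const.prodMk contMDiff_id)

theorem IsPosPath.isContactPath (hφ : IsPosPath α φ) : IsContactPath α φ where
  contMDiff := hφ.contMDiff
  diffeo t _ := hφ.diffeo t
  contact t _ x v := by
    obtain ⟨c, hc, h⟩ := hφ.conformal t x
    rw [h v]
    simp [hc.ne']
  compactSupport := by
    obtain ⟨K, hK, h⟩ := hφ.compactSupport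
    exact ⟨K, hK, fun t _ ↦ h t⟩

theorem IsPosPath.form_mfderiv (hφ : IsPosPath α φ) (hα : IsContactForm α) (t : ℝ) (x : M)
    (v : TangentSpace (𝓡 (2 * n + 1)) x) :
    α (φ t x) (mfderiv (𝓡 (2 * n + 1)) (𝓡 (2 * n + 1)) (φ t) x v) =
      conformalFactor α (φ t) x * α x v := by
  obtain ⟨c, hc, h⟩ := hφ.conformal t x
  rw [conformalFactor, h, h, (hα.isReebVector_reebField x).1, mul_one]

theorem IsPosPath.conformalFactor_pos (hφ : IsPosPath α φ) (hα : IsContactForm α) (t : ℝ)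
    (x : M) : 0 < conformalFactor α (φ t) x := by
  obtain ⟨c, hc, h⟩ := hφ.conformal t x
  rwa [conformalFactor, h, (hα.isReebVector_reebField x).1, mul_one]

theorem IsPosPath.continuous_conformalFactor (hφ : IsPosPath α φ) (hα : IsContactForm α) :
    Continuous (fun q : ℝ × M ↦ conformalFactor α (φ q.1) q.2) := by
  refine ContMDiff.continuous (I := 𝓘(ℝ, ℝ).prod (𝓡 (2 * n + 1))) (I' := 𝓘(ℝ, ℝ)) (n := ∞)
    fun q₀ ↦ hα.contMDiffAt_apply ?_
  exact contMDiffAt_family_derivative (l := φ) isOpen_univ hφ.contMDiff.contMDiffOn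
    (s := fun q : ℝ × M ↦ q.1) (b := fun q : ℝ × M ↦ q.2)
    (w := fun q : ℝ × M ↦ reebField α q.2) (q₀ := q₀) contMDiffAt_fst
    (hα.contMDiff_reebField.contMDiffAt.comp q₀ contMDiffAt_snd) (mem_univ _)

/-- The composition of a co-orientation preserving path with a smooth family of maps. -/
theorem IsPosPath.form_velocity_comp (hψ : IsPosPath α ψ) (hα : IsContactForm α)
    {E : Type*} [NormedAddCommGroup E] [NormedSpace ℝ E]
    {H : Type*} [TopologicalSpace H] {I : ModelWithCorners ℝ E H}
    {N : Type*} [TopologicalSpace N] [ChartedSpace H N] [IsManifold I ∞ N] {l : ℝ → N → M}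
    (hl : ContMDiff (𝓘(ℝ, ℝ).prod I) (𝓡 (2 * n + 1)) ∞ (fun q : ℝ × N ↦ l q.1 q.2))
    {θ : ℝ → ℝ} {θ' : ℝ} {t : ℝ} (hθ : HasDerivAt θ θ' t) (p : N) :
    α (ψ (θ t) (l t p)) (velocity (n := n) (fun s p ↦ ψ (θ s) (l s p)) t p) =
      θ' * α (ψ (θ t) (l t p)) (velocity ψ (θ t) (l t p)) +
        conformalFactor α (ψ (θ t)) (l t p) * α (l t p) (velocity l t p) := by
  have hl' : MDifferentiableAt 𝓘(ℝ, ℝ) (𝓡 (2 * n + 1)) (fun s ↦ l s p) t :=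
    (hasMFDerivAt_family_fst (hl.mdifferentiableAt (by simp) (x := (t, p)))).mdifferentiableAt
  rw [velocity_comp hψ.contMDiff hθ hl', map_add, map_smul, smul_eq_mul, hψ.form_mfderiv hα]
  rfl

/-- Only the outer path must preserve the co-orientation. Competitors in `lorentzianDistance` are
merely contact paths, and they enter as the inner factor. -/
theorem IsPosPath.comp_contactPath (hψ : IsPosPath α ψ) (hφ : IsContactPath α φ) {θ : ℝ → ℝ}
    (hθ : ContDiff ℝ ∞ θ) : IsContactPath α (fun t x ↦ ψ (θ t) (φ t x)) where
  contMDiff := hψ.contMDiff.comp ((hθ.contMDiff.comp contMDiff_fst).prodMk hφ.contMDiff)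
  diffeo t ht := by
    obtain ⟨Φ, hΦ⟩ := hφ.diffeo t ht
    obtain ⟨Ψ, hΨ⟩ := hψ.diffeo (θ t)
    exact ⟨Φ.trans Ψ, by rw [Diffeomorph.coe_trans, hΦ, hΨ]; rfl⟩
  contact t ht x v := by
    have hφt : ContMDiff (𝓡 (2 * n + 1)) (𝓡 (2 * n + 1)) ∞ (φ t) :=
      hφ.contMDiff.comp (contMDiff_const.prodMk contMDiff_id)
    have h1 := mfderiv_comp x ((hψ.contMDiff_time (θ t)).mdifferentiableAt (by simp))
      (hφt.mdifferentiableAt (by simp))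
    change α _ (mfderiv _ _ (ψ (θ t) ∘ φ t) x v) = 0 ↔ _
    rw [h1, ← hφ.contact t ht x v]
    obtain ⟨c, hc, h⟩ := hψ.conformal (θ t) (φ t x)
    have h2 := h (mfderiv (𝓡 (2 * n + 1)) (𝓡 (2 * n + 1)) (φ t) x v)
    change α (ψ (θ t) (φ t x)) (mfderiv (𝓡 (2 * n + 1)) (𝓡 (2 * n + 1)) (ψ (θ t)) (φ t x)
      (mfderiv (𝓡 (2 * n + 1)) (𝓡 (2 * n + 1)) (φ t) x v)) = 0 ↔ _
    rw [h2]
    simp [hc.ne']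
  compactSupport := by
    obtain ⟨K, hK, h⟩ := hφ.compactSupport
    obtain ⟨K', hK', h'⟩ := hψ.compactSupport
    refine ⟨K ∪ K', hK.union hK', fun t ht x hx ↦ ?_⟩
    rw [mem_union, not_or] at hx
    rw [h t ht x hx.1, h' _ x hx.2]

theorem IsPosPath.comp (hψ : IsPosPath α ψ) (hφ : IsPosPath α φ) :
    IsPosPath α (fun t x ↦ ψ t (φ t x)) where
  contMDiff := hψ.contMDiff.comp (contMDiff_fst.prodMk hφ.contMDiff)
  diffeo t := by
    obtain ⟨Φ, hΦ⟩ := hφ.diffeo t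
    obtain ⟨Ψ, hΨ⟩ := hψ.diffeo t
    exact ⟨Φ.trans Ψ, by rw [Diffeomorph.coe_trans, hΦ, hΨ]; rfl⟩
  conformal t x := by
    have h1 := mfderiv_comp x ((hψ.contMDiff_time t).mdifferentiableAt (by simp))
      ((hφ.contMDiff_time t).mdifferentiableAt (by simp))
    obtain ⟨c, hc, h⟩ := hψ.conformal t (φ t x)
    obtain ⟨c', hc', h'⟩ := hφ.conformal t x
    refine ⟨c * c', mul_pos hc hc', fun v ↦ ?_⟩
    change α _ (mfderiv _ _ (ψ t ∘ φ t) x v) = _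
    rw [h1, mul_assoc, ← h' v]
    exact h (mfderiv (𝓡 (2 * n + 1)) (𝓡 (2 * n + 1)) (φ t) x v)
  compactSupport := by
    obtain ⟨K, hK, h⟩ := hφ.compactSupport
    obtain ⟨K', hK', h'⟩ := hψ.compactSupport
    refine ⟨K ∪ K', hK.union hK', fun t x hx ↦ ?_⟩
    rw [mem_union, not_or] at hx
    rw [h t x hx.1, h' _ x hx.2]

theorem IsPosPath.reparam (hφ : IsPosPath α φ) {θ : ℝ → ℝ} (hθ : ContDiff ℝ ∞ θ) :
    IsPosPath α (fun t ↦ φ (θ t)) where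
  contMDiff := hφ.contMDiff.comp ((hθ.contMDiff.comp contMDiff_fst).prodMk contMDiff_snd)
  diffeo t := hφ.diffeo (θ t)
  conformal t := hφ.conformal (θ t)
  compactSupport := by
    obtain ⟨K, hK, h⟩ := hφ.compactSupport
    exact ⟨K, hK, fun t ↦ h (θ t)⟩

theorem isPosPath_id : IsPosPath α (fun _ x ↦ x) where
  contMDiff := contMDiff_snd
  diffeo _ := ⟨Diffeomorph.refl _ _ _, rfl⟩
  conformal _ x := ⟨1, one_pos, fun v ↦ by
    rw [one_mul]
    exact congrArg (fun L : EuclideanSpace ℝ (Fin (2 * n + 1)) →L[ℝ]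
      EuclideanSpace ℝ (Fin (2 * n + 1)) ↦ α x (L v)) (mfderiv_id (I := 𝓡 (2 * n + 1)) (x := x))⟩
  compactSupport := ⟨∅, isCompact_empty, fun _ _ _ ↦ rfl⟩

theorem IsPosPath.exists_inverse (hφ : IsPosPath α φ) (t : ℝ) : ∃ g : M → M,
    IsPosPath α (fun _ ↦ g) ∧ (∀ x, g (φ t x) = x) ∧ ∀ x, φ t (g x) = x := by
  obtain ⟨Φ, hΦ⟩ := hφ.diffeo t
  have h1 : ∀ x, Φ.symm (φ t x) = x := fun x ↦ by rw [← hΦ, Φ.symm_apply_apply]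
  have h2 : ∀ x, φ t (Φ.symm x) = x := fun x ↦ by rw [← hΦ, Φ.apply_symm_apply]
  refine ⟨Φ.symm, ⟨Φ.symm.contMDiff.comp contMDiff_snd, fun _ ↦ ⟨Φ.symm, rfl⟩,
    fun _ x ↦ ?_, ?_⟩, h1, h2⟩
  · obtain ⟨c, hc, h⟩ := hφ.conformal t (Φ.symm x)
    refine ⟨c⁻¹, inv_pos.2 hc, fun v ↦ ?_⟩
    have h3 := mfderiv_comp x ((hφ.contMDiff_time t).mdifferentiableAt (by simp))
      (Φ.symm.contMDiff.mdifferentiableAt (by simp) (x := x))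
    have h4 : φ t ∘ Φ.symm = id := funext h2
    rw [h4, mfderiv_id] at h3
    have h5 := h (mfderiv (𝓡 (2 * n + 1)) (𝓡 (2 * n + 1)) Φ.symm x v)
    rw [eq_inv_mul_iff_mul_eq₀ hc.ne', ← h5]
    have h6 := congrArg (fun L : EuclideanSpace ℝ (Fin (2 * n + 1)) →L[ℝ]
      EuclideanSpace ℝ (Fin (2 * n + 1)) ↦ L v) h3
    refine (form_congr (h2 x) _).trans ?_
    exact congrArg (fun w : EuclideanSpace ℝ (Fin (2 * n + 1)) ↦
      α x (show TangentSpace (𝓡 (2 * n + 1)) x from w)) h6.symm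
  · obtain ⟨K, hK, h⟩ := hφ.compactSupport
    exact ⟨K, hK, fun _ x hx ↦ by
      have := h1 x
      rwa [h t x hx] at this⟩

/-- On the compact set [a, b] × K the speed and the inverse of the positive factor are bounded. Off
K the maps are locally the identity, with speed 0 and factor 1, which explains the maxima with 1. -/
theorem IsPosPath.exists_bounds [T2Space M] (hφ : IsPosPath α φ) (hα : IsContactForm α)
    (a b : ℝ) : ∃ κ > 0, ∃ c > 0, ∀ t ∈ Icc a b, ∀ x,
      |α (φ t x) (velocity φ t x)| ≤ κ ∧ c ≤ conformalFactor α (φ t) x := by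
  obtain ⟨K, hK, h⟩ := hφ.compactSupport
  have h1 : Continuous (fun q : ℝ × M ↦ α (φ q.1 q.2) (velocity φ q.1 q.2)) :=
    (hα.contMDiff_form_velocity hφ.contMDiff).continuous
  have h2 := hφ.continuous_conformalFactor hα
  have hc := (isCompact_Icc (a := a) (b := b)).prod hK
  obtain ⟨κ, hκ⟩ := (hc.image h1.abs).bddAbove
  have h3 : Continuous (fun q : ℝ × M ↦ (conformalFactor α (φ q.1) q.2)⁻¹) :=
    h2.inv₀ fun q ↦ (hφ.conformalFactor_pos hα _ _).ne'
  obtain ⟨d, hd⟩ := (hc.image h3).bddAbove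
  refine ⟨max κ 1, by positivity, (max d 1)⁻¹, by positivity, fun t ht x ↦ ?_⟩
  by_cases hx : x ∈ K
  · refine ⟨(hκ (mem_image_of_mem _ (mk_mem_prod ht hx))).trans (le_max_left _ _), ?_⟩
    have h4 := (hd (mem_image_of_mem _ (mk_mem_prod ht hx))).trans (le_max_left d 1)
    exact inv_le_of_inv_le₀ (hφ.conformalFactor_pos hα _ _) h4
  · constructor
    · have h4 : velocity φ t x = (0 : EuclideanSpace ℝ (Fin (2 * n + 1))) := by
        have h5 : (fun s ↦ φ s x) = fun _ ↦ x := funext fun s ↦ h s x hx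
        rw [velocity, h5, mfderiv_const]
        rfl
      rw [h4]
      have h6 : α (φ t x) (0 : TangentSpace (𝓡 (2 * n + 1)) (φ t x)) = 0 := map_zero _
      refine (le_of_eq (congrArg abs h6)).trans ?_
      simp
    · have h4 : φ t =ᶠ[𝓝 x] id := by
        filter_upwards [hK.isClosed.isOpen_compl.mem_nhds hx] with y hy using h t y hy
      have h5 : conformalFactor α (φ t) x = 1 := by
        have h6 : mfderiv (𝓡 (2 * n + 1)) (𝓡 (2 * n + 1)) (φ t) x =
            mfderiv (𝓡 (2 * n + 1)) (𝓡 (2 * n + 1)) (id : M → M) x := h4.mfderiv_eq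
        rw [mfderiv_id] at h6
        rw [conformalFactor, h6, ← (hα.isReebVector_reebField x).1]
        exact form_congr (h4.self_of_nhds) _
      rw [h5]
      exact inv_le_one_of_one_le₀ (le_max_right _ _)

end PosPath

/-! ### Contact isotopies generated by Hamiltonians. -/

section ContactFlow

variable {n : ℕ} {M : Type*} [TopologicalSpace M] [T2Space M]
  [ChartedSpace (EuclideanSpace ℝ (Fin (2 * n + 1))) M] [IsManifold (𝓡 (2 * n + 1)) ∞ M]
  {α : ∀ x : M, TangentSpace (𝓡 (2 * n + 1)) x →L[ℝ] ℝ}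

/-- The contact isotopy generated by a compactly supported time-dependent Hamiltonian. -/
theorem IsContactForm.exists_contactFlow (hα : IsContactForm α) {F : ℝ → M → ℝ}
    (hF : ContMDiff (𝓘(ℝ, ℝ).prod (𝓡 (2 * n + 1))) 𝓘(ℝ, ℝ) ∞ (fun q : ℝ × M ↦ F q.1 q.2))
    {K : Set M} (hK : IsCompact K) {a : ℝ} (hFK : ∀ t, ∀ x ∉ K, F t x = 0)
    (hFa : ∀ t, a < |t| → ∀ x, F t x = 0) :
    ∃ φ : ℝ → M → M, IsPosPath α φ ∧ (∀ x, φ 0 x = x) ∧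
      ∀ t x, velocity φ t x = hamField α (F t) (φ t x) := by
  obtain ⟨φ, h1, h2, h3, h4, h5⟩ := exists_flow_timeDependent (hα.contMDiff_hamField hF) hK
    (a := a) (fun t x hx ↦ hα.hamField_eq_zero (by
      filter_upwards [hK.isClosed.isOpen_compl.mem_nhds hx] with y hy using hFK t y hy))
    (fun t ht x ↦ hα.hamField_eq_zero (Filter.Eventually.of_forall (hFa t ht)))
  have h6 : ∀ t x, velocity φ t x = hamField α (F t) (φ t x) := fun t x ↦ velocity_eq (h4 t x)
  exact ⟨φ, ⟨h1, h3, hα.exists_conformal_of_velocity h1 hF h2 h6, K, hK, h5⟩, h2, h6⟩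

/-- The flow of the contact vector field of a compactly supported autonomous Hamiltonian. -/
theorem IsContactForm.exists_autonomous_contactFlow (hα : IsContactForm α) {F : M → ℝ}
    (hF : ContMDiff (𝓡 (2 * n + 1)) 𝓘(ℝ, ℝ) ∞ F) {K : Set M} (hK : IsCompact K)
    (hFK : ∀ x ∉ K, F x = 0) :
    ∃ φ : ℝ → M → M, IsPosPath α φ ∧ (∀ x, φ 0 x = x) ∧
      (∀ s t x, φ (s + t) x = φ s (φ t x)) ∧
      ∀ t x, velocity φ t x = hamField α F (φ t x) := by
  have hF' : ContMDiff (𝓘(ℝ, ℝ).prod (𝓡 (2 * n + 1))) 𝓘(ℝ, ℝ) ∞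
    (fun q : ℝ × M ↦ F q.2) := hF.comp contMDiff_snd
  have hX : ContMDiff (𝓡 (2 * n + 1)) (𝓡 (2 * n + 1)).tangent ∞
      (fun x : M ↦ (⟨x, hamField α F x⟩ : TangentBundle (𝓡 (2 * n + 1)) M)) :=
    (hα.contMDiff_hamField (F := fun _ ↦ F) hF').comp
      ((contMDiff_const (c := (0 : ℝ))).prodMk contMDiff_id)
  have hX0 : ∀ x ∉ K, hamField α F x = 0 := fun x hx ↦ hα.hamField_eq_zero (by
      filter_upwards [hK.isClosed.isOpen_compl.mem_nhds hx] with y hy using hFK y hy)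
  have hconst : ∀ x ∉ K, IsMIntegralCurve (fun _ ↦ x) (hamField α F) := by
    intro x hx t
    refine (hasMFDerivAt_const x t).congr_mfderiv (ContinuousLinearMap.ext fun (w : ℝ) ↦ ?_)
    rw [hX0 x hx]
    exact (smul_zero w).symm
  obtain ⟨φ, h1, h2, h3, h4⟩ := exists_flow hX hK fun x hx ↦
    ⟨fun _ ↦ x, rfl, (hconst x hx).isMIntegralCurveOn _⟩
  have h6 : ∀ t x, velocity φ t x = hamField α F (φ t x) := fun t x ↦ velocity_eq (h4 x t)
  have hφt : ∀ t, ContMDiff (𝓡 (2 * n + 1)) (𝓡 (2 * n + 1)) ∞ (φ t) := fun t ↦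
    h1.comp (contMDiff_const.prodMk contMDiff_id)
  refine ⟨φ, ⟨h1, fun t ↦ ?_, hα.exists_conformal_of_velocity (F := fun _ ↦ F) h1 hF' h2 h6,
    K, hK, fun t x hx ↦ ?_⟩, h2, h3, h6⟩
  · refine ⟨⟨⟨φ t, φ (-t), fun x ↦ ?_, fun x ↦ ?_⟩, hφt t, hφt (-t)⟩, rfl⟩
    · rw [← h3, neg_add_cancel, h2]
    · rw [← h3, add_neg_cancel, h2]
  · exact congrFun (isMIntegralCurve_Ioo_eq_of_contMDiff_boundaryless (t₀ := 0)
      (contMDiff_one_vectorField hX) (h4 x) (hconst x hx) (h2 x)) t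

end ContactFlow

/-! ### Smooth local left inverses of immersions. -/

section LeftInverse

variable {E : Type*} [NormedAddCommGroup E] [NormedSpace ℝ E] [FiniteDimensional ℝ E]
  {H : Type*} [TopologicalSpace H] {I : ModelWithCorners ℝ E H} [I.Boundaryless]
  {N : Type*} [TopologicalSpace N] [ChartedSpace H N] [IsManifold I ∞ N]
  {E' : Type*} [NormedAddCommGroup E'] [NormedSpace ℝ E'] [FiniteDimensional ℝ E']
  {H' : Type*} [TopologicalSpace H'] {I' : ModelWithCorners ℝ E' H'} [I'.Boundaryless]
  {N' : Type*} [TopologicalSpace N'] [ChartedSpace H' N'] [IsManifold I' ∞ N']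

theorem surjective_mfderiv_extChartAt_symm {x₀ : N} {y : E} (hy : y ∈ (extChartAt I x₀).target) :
    Function.Surjective (mfderiv 𝓘(ℝ, E) I (extChartAt I x₀).symm y) := by
  intro u
  have h1 := mfderiv_extChartAt_symm_comp (I := I) ((extChartAt I x₀).map_target hy) u
  rw [(extChartAt I x₀).right_inv hy] at h1
  exact ⟨_, h1⟩

theorem injective_mfderiv_extChartAt_symm {x₀ : N} {y : E} (hy : y ∈ (extChartAt I x₀).target) :
    Function.Injective (mfderiv 𝓘(ℝ, E) I (extChartAt I x₀).symm y) := by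
  let L : E →L[ℝ] E := mfderiv 𝓘(ℝ, E) I (extChartAt I x₀).symm y
  have h : Function.Injective L := LinearMap.injective_iff_surjective (f := L.toLinearMap).2
    (surjective_mfderiv_extChartAt_symm hy)
  exact h

/-- A family of maps between vector spaces which is immersive at a point has a smooth family of
local left inverses. -/
theorem exists_local_leftInverse_vectorSpace {ψ : ℝ × E → E'} {t₀ : ℝ} {y₀ : E}
    (hψ' : ∀ᶠ q in 𝓝 (t₀, y₀), ContDiffAt ℝ ∞ ψ q)
    (hinj : Function.Injective fun v : E ↦ fderiv ℝ ψ (t₀, y₀) (0, v)) :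
    ∃ ρ : ℝ × E' → E, (∀ᶠ z in 𝓝 (t₀, ψ (t₀, y₀)), ContDiffAt ℝ ∞ ρ z) ∧
      ∀ᶠ q in 𝓝 (t₀, y₀), ρ (q.1, ψ q) = q.2 := by
  have hψ := hψ'.self_of_nhds
  let A : E →ₗ[ℝ] E' := (fderiv ℝ ψ (t₀, y₀)).toLinearMap ∘ₗ LinearMap.inr ℝ ℝ E
  obtain ⟨P₀, hP₀⟩ := LinearMap.exists_leftInverse_of_injective A (LinearMap.ker_eq_bot.2 hinj)
  let P : E' →L[ℝ] E := LinearMap.toContinuousLinearMap P₀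
  have hP : ∀ v, P (fderiv ℝ ψ (t₀, y₀) (0, v)) = v := fun v ↦ LinearMap.congr_fun hP₀ v
  -- Composing ψ with a linear left inverse P of its derivative gives a map between spaces of equal
  -- dimension, to which the inverse function theorem applies. The parameter is carried along.
  let Ψ : ℝ × E → ℝ × E := fun q ↦ (q.1, P (ψ q))
  have hΨ' : ∀ᶠ q in 𝓝 (t₀, y₀), ContDiffAt ℝ ∞ Ψ q := hψ'.mono fun q hq ↦
    contDiffAt_fst.prodMk (P.contDiff.contDiffAt.comp _ hq)
  have hΨ := hΨ'.self_of_nhds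
  let L : ℝ × E →L[ℝ] ℝ × E :=
    (ContinuousLinearMap.fst ℝ ℝ E).prod (P.comp (fderiv ℝ ψ (t₀, y₀)))
  have hL : HasFDerivAt Ψ L (t₀, y₀) := hasFDerivAt_fst.prodMk
    (P.hasFDerivAt.comp _ (hψ.differentiableAt (by simp)).hasFDerivAt)
  have hLinj : Function.Injective L := by
    rw [injective_iff_map_eq_zero]
    rintro ⟨τ, v⟩ h
    have h1 : τ = 0 := congrArg Prod.fst h
    have h2 : P (fderiv ℝ ψ (t₀, y₀) (τ, v)) = 0 := congrArg Prod.snd h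
    rw [h1, hP] at h2
    rw [h1, h2]
    rfl
  let e : (ℝ × E) ≃L[ℝ] (ℝ × E) :=
    (LinearEquiv.ofInjectiveEndo L.toLinearMap hLinj).toContinuousLinearEquiv
  have he : HasFDerivAt Ψ (e : ℝ × E →L[ℝ] ℝ × E) (t₀, y₀) := hL
  let f := hΨ.toOpenPartialHomeomorph Ψ he (by simp)
  have hf0 : (t₀, y₀) ∈ f.source := hΨ.mem_toOpenPartialHomeomorph_source he (by simp)
  -- Invertibility of the derivative is an open condition. It is needed at nearby points to have the
  -- inverse smooth on a neighbourhood and not only at one point.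
  have hinv : ∀ᶠ q in 𝓝 (t₀, y₀), ∃ e : (ℝ × E) ≃L[ℝ] (ℝ × E), HasFDerivAt Ψ (e : _ →L[ℝ] _) q := by
    have h1 : ContinuousAt (fderiv ℝ Ψ) (t₀, y₀) :=
      (hΨ.fderiv_right (m := ∞) (by simp)).continuousAt
    have h2 := h1.eventually (he.fderiv ▸ e.nhds)
    filter_upwards [h2, hΨ'] with q hq hq'
    obtain ⟨e', he'⟩ := hq
    exact ⟨e', he' ▸ (hq'.differentiableAt (by simp)).hasFDerivAt⟩
  have hs : ∀ᶠ z in 𝓝 (Ψ (t₀, y₀)), ContDiffAt ℝ ∞ f.symm z := by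
    have h0 : f.symm (Ψ (t₀, y₀)) = (t₀, y₀) := f.left_inv hf0
    have h1 : ContinuousAt f.symm (Ψ (t₀, y₀)) := f.continuousAt_symm (f.map_source hf0)
    have h2 := h1.tendsto
    rw [h0] at h2
    filter_upwards [h2.eventually hinv, h2.eventually hΨ',
      f.open_target.mem_nhds (f.map_source hf0)] with z ⟨e', hz1⟩ hz2 hz3
    exact f.contDiffAt_symm hz3 hz1 hz2
  refine ⟨fun q ↦ (f.symm (q.1, P q.2)).2, ?_, ?_⟩
  · have h1 : ContinuousAt (fun q : ℝ × E' ↦ (q.1, P q.2)) (t₀, ψ (t₀, y₀)) := by fun_prop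
    filter_upwards [h1.eventually hs] with z hz
    exact contDiff_snd.contDiffAt.comp _ (ContDiffAt.comp (f := fun q : ℝ × E' ↦ (q.1, P q.2)) _
      hz (by fun_prop))
  · filter_upwards [f.open_source.mem_nhds hf0] with q hq
    exact congrArg Prod.snd (f.left_inv hq)

/-- A smooth family of maps which is immersive at a point has a smooth family of local left
inverses. -/
theorem exists_local_leftInverse {l : ℝ → N → N'}
    (hl : ContMDiff (𝓘(ℝ, ℝ).prod I) I' ∞ (fun q : ℝ × N ↦ l q.1 q.2)) {t₀ : ℝ} {p₀ : N}
    (hinj : Function.Injective (mfderiv I I' (l t₀) p₀)) :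
    ∃ r : ℝ → N' → N, (∀ᶠ q in 𝓝 (t₀, l t₀ p₀),
      ContMDiffAt (𝓘(ℝ, ℝ).prod I') I ∞ (fun q : ℝ × N' ↦ r q.1 q.2) q) ∧ ∀ᶠ q in 𝓝 (t₀, p₀), r q.1 (l q.1 q.2) = q.2 := by
  set k := extChartAt I p₀ with hk
  set e := extChartAt I' (l t₀ p₀) with he
  have hT : IsOpen k.target := isOpen_extChartAt_target (I := I) p₀
  have hy₀ : k p₀ ∈ k.target := mem_extChartAt_target (I := I) p₀
  have hk0 : k.symm (k p₀) = p₀ := k.left_inv (mem_extChartAt_source (I := I) p₀)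
  let ψ : ℝ × E → E' := fun q ↦ e (l q.1 (k.symm q.2))
  have hksymm : ∀ y ∈ k.target, ContMDiffAt 𝓘(ℝ, E) I ∞ k.symm y := fun y hy ↦
    (contMDiffOn_extChartAt_symm (I := I) (n := ∞) p₀).contMDiffAt (hT.mem_nhds hy)
  have hlt : ContMDiff I I' ∞ (l t₀) := hl.comp (contMDiff_const.prodMk contMDiff_id)
  have hψ' : ∀ᶠ q in 𝓝 (t₀, k p₀), ContDiffAt ℝ ∞ ψ q := by
    have h0 : ∀ᶠ q in 𝓝 (t₀, k p₀), q.2 ∈ k.target :=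
      continuousAt_snd.tendsto.eventually (hT.mem_nhds hy₀)
    have h1 : ∀ q : ℝ × E, q.2 ∈ k.target → ContMDiffAt 𝓘(ℝ, ℝ × E) I' ∞
        (fun q : ℝ × E ↦ l q.1 (k.symm q.2)) q := fun q hq ↦
      ContMDiffAt.comp (g := fun q : ℝ × N ↦ l q.1 q.2) (f := fun q : ℝ × E ↦ (q.1, k.symm q.2))
        q hl.contMDiffAt (contDiff_fst.contMDiff.contMDiffAt.prodMk
          (ContMDiffAt.comp (g := k.symm) (f := Prod.snd) q (hksymm _ hq)
          contDiff_snd.contMDiff.contMDiffAt))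
    have h2 : ∀ᶠ q : ℝ × E in 𝓝 (t₀, k p₀),
        l q.1 (k.symm q.2) ∈ (chartAt H' (l t₀ p₀)).source := by
      refine (h1 (t₀, k p₀) hy₀).continuousAt.eventually ?_
      simp only [hk0]
      exact (chartAt H' (l t₀ p₀)).open_source.mem_nhds (mem_chart_source _ _)
    filter_upwards [h0, h2] with q hq0 hq2
    rw [← contMDiffAt_iff_contDiffAt]
    exact ContMDiffAt.comp (g := e) (f := fun q : ℝ × E ↦ l q.1 (k.symm q.2)) q
      (contMDiffAt_extChartAt' hq2) (h1 q hq0)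
  have hψ := hψ'.self_of_nhds
  have hfd : ∀ v, fderiv ℝ ψ (t₀, k p₀) (0, v) = mfderiv I' 𝓘(ℝ, E') e (l t₀ p₀)
      (mfderiv I I' (l t₀) p₀ (mfderiv 𝓘(ℝ, E) I k.symm (k p₀) v)) := by
    intro v
    have h1 : HasFDerivAt (fun y ↦ ψ (t₀, y)) ((fderiv ℝ ψ (t₀, k p₀)).comp
        (ContinuousLinearMap.inr ℝ ℝ E)) (k p₀) :=
      (hψ.differentiableAt (by simp)).hasFDerivAt.comp _ (hasFDerivAt_prodMk_right t₀ (k p₀))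
    have h2 := ((hksymm _ hy₀).mdifferentiableAt (by simp)).hasMFDerivAt
    have h3 : HasMFDerivAt I I' (l t₀) (k.symm (k p₀)) (mfderiv I I' (l t₀) p₀) := by
      rw [hk0]; exact (hlt.mdifferentiableAt (by simp)).hasMFDerivAt
    have h4 : HasMFDerivAt I' 𝓘(ℝ, E') e (l t₀ (k.symm (k p₀)))
        (mfderiv I' 𝓘(ℝ, E') e (l t₀ p₀)) := by
      rw [hk0]; exact (mdifferentiableAt_extChartAt (mem_chart_source _ _)).hasMFDerivAt
    have h5 := hasMFDerivAt_iff_hasFDerivAt.1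
      (HasMFDerivAt.comp (f := k.symm) (k p₀) (HasMFDerivAt.comp (f := l t₀) _ h4 h3) h2)
    exact congrArg (fun L : E →L[ℝ] E' ↦ L v) (h1.unique h5)
  obtain ⟨ρ, hρ, hρψ⟩ := exists_local_leftInverse_vectorSpace hψ' (by
    intro v w hvw
    simp only [hfd] at hvw
    have h1 : Function.Injective (mfderiv I' 𝓘(ℝ, E') e (l t₀ p₀)) := by
      intro a b hab
      have h2 := mfderiv_extChartAt_symm_comp (I := I') (mem_extChartAt_source (I := I') (l t₀ p₀))
      exact (h2 a).symm.trans ((congrArg _ hab).trans (h2 b))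
    have h2 := hinj (h1 hvw)
    exact injective_mfderiv_extChartAt_symm hy₀ h2)
  have hψ0 : ψ (t₀, k p₀) = e (l t₀ p₀) := by simp only [ψ, hk0]
  have hρ0 : ρ (t₀, e (l t₀ p₀)) = k p₀ := by
    rw [← hψ0]; exact hρψ.self_of_nhds
  refine ⟨fun t z ↦ k.symm (ρ (t, e z)), ?_, ?_⟩
  · rw [hψ0] at hρ
    have h1 : ∀ q : ℝ × N', q.2 ∈ (chartAt H' (l t₀ p₀)).source →
        ContMDiffAt (𝓘(ℝ, ℝ).prod I') 𝓘(ℝ, ℝ × E') ∞ (fun q : ℝ × N' ↦ (q.1, e q.2)) q :=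
      fun q hq ↦ contMDiffAt_fst.prodMk_space
        (ContMDiffAt.comp (g := e) (f := Prod.snd) q (contMDiffAt_extChartAt' hq) contMDiffAt_snd)
    have hsrc : ∀ᶠ q : ℝ × N' in 𝓝 (t₀, l t₀ p₀), q.2 ∈ (chartAt H' (l t₀ p₀)).source :=
      continuousAt_snd.tendsto.eventually
        ((chartAt H' (l t₀ p₀)).open_source.mem_nhds (mem_chart_source _ _))
    have h2 : ∀ᶠ q : ℝ × N' in 𝓝 (t₀, l t₀ p₀), ContDiffAt ℝ ∞ ρ (q.1, e q.2) :=
      (h1 (t₀, l t₀ p₀) (mem_chart_source _ _)).continuousAt.eventually hρ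
    have h3 : ∀ᶠ q : ℝ × N' in 𝓝 (t₀, l t₀ p₀), ρ (q.1, e q.2) ∈ k.target := by
      have h4 : ContinuousAt (fun q : ℝ × N' ↦ ρ (q.1, e q.2)) (t₀, l t₀ p₀) :=
        ContinuousAt.comp (f := fun q : ℝ × N' ↦ (q.1, e q.2)) hρ.self_of_nhds.continuousAt
          (h1 (t₀, l t₀ p₀) (mem_chart_source _ _)).continuousAt
      refine h4.eventually ?_
      simp only [hρ0]
      exact hT.mem_nhds hy₀
    filter_upwards [hsrc, h2, h3] with q hq1 hq2 hq3
    exact ContMDiffAt.comp (g := k.symm) (f := fun q : ℝ × N' ↦ ρ (q.1, e q.2)) q (hksymm _ hq3)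
      (ContMDiffAt.comp (g := ρ) (I' := 𝓘(ℝ, ℝ × E')) (f := fun q : ℝ × N' ↦ (q.1, e q.2)) q
        hq2.contMDiffAt (h1 q hq1))
  · have h1 : Filter.Tendsto (fun q : ℝ × N ↦ (q.1, k q.2)) (𝓝 (t₀, p₀)) (𝓝 (t₀, k p₀)) :=
      (continuousAt_fst.prodMk ((continuousAt_extChartAt (I := I) p₀).comp
        (x := (t₀, p₀)) continuousAt_snd))
    have h2 : ∀ᶠ q in 𝓝 (t₀, p₀), q.2 ∈ k.source :=
      continuousAt_snd.tendsto.eventually (extChartAt_source_mem_nhds (I := I) p₀)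
    filter_upwards [h1.eventually hρψ, h2] with q hq hq2
    simp only [ψ, k.left_inv hq2] at hq
    simp only [hq, k.left_inv hq2]

end LeftInverse

/-! ### Contact isotopies that follow a Legendrian isotopy. -/

section Trace

theorem contMDiffAt_tangent_sub {E : Type*} [NormedAddCommGroup E] [NormedSpace ℝ E]
    {H : Type*} [TopologicalSpace H] {I : ModelWithCorners ℝ E H}
    {N : Type*} [TopologicalSpace N] [ChartedSpace H N] [IsManifold I ∞ N]
    {A : Type*} [NormedAddCommGroup A] [NormedSpace ℝ A] {HA : Type*} [TopologicalSpace HA]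
    {J : ModelWithCorners ℝ A HA} {Q : Type*} [TopologicalSpace Q] [ChartedSpace HA Q]
    {b : Q → N} {v w : ∀ q, TangentSpace I (b q)} {q₀ : Q}
    (hv : ContMDiffAt J I.tangent ∞ (fun q ↦ (⟨b q, v q⟩ : TangentBundle I N)) q₀)
    (hw : ContMDiffAt J I.tangent ∞ (fun q ↦ (⟨b q, w q⟩ : TangentBundle I N)) q₀) :
    ContMDiffAt J I.tangent ∞ (fun q ↦ (⟨b q, v q - w q⟩ : TangentBundle I N)) q₀ := by
  rw [Bundle.contMDiffAt_totalSpace] at hv hw ⊢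
  refine ⟨hv.1, (hv.2.sub hw.2).congr_of_eventuallyEq ?_⟩
  have h : ∀ᶠ q in 𝓝 q₀, b q ∈ (trivializationAt E (TangentSpace I : N → Type _) (b q₀)).baseSet :=
    hv.1.continuousAt.eventually ((trivializationAt E (TangentSpace I : N → Type _)
      (b q₀)).open_baseSet.mem_nhds (FiberBundle.mem_baseSet_trivializationAt' (b q₀)))
  filter_upwards [h] with q hq
  exact ((trivializationAt E (TangentSpace I : N → Type _) (b q₀)).linear ℝ hq).map_sub _ _

variable {n : ℕ} {M : Type*} [TopologicalSpace M] [T2Space M]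
  [ChartedSpace (EuclideanSpace ℝ (Fin (2 * n + 1))) M] [IsManifold (𝓡 (2 * n + 1)) ∞ M]
  {α : ∀ x : M, TangentSpace (𝓡 (2 * n + 1)) x →L[ℝ] ℝ}
  {Λ : Type*} [TopologicalSpace Λ] [CompactSpace Λ]
  [ChartedSpace (EuclideanSpace ℝ (Fin n)) Λ] [IsManifold (𝓡 n) ∞ Λ]

/-- In a chart of Λ the pull-back of α vanishes identically on an open set, hence so does its
exterior derivative. -/
theorem IsLegendrianEmbedding.dForm_mfderiv (hα : IsContactForm α) {f : Λ → M}
    (hf : IsLegendrianEmbedding α f) (p : Λ) (v w : TangentSpace (𝓡 n) p) :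
    dForm α (f p) (mfderiv (𝓡 n) (𝓡 (2 * n + 1)) f p v)
      (mfderiv (𝓡 n) (𝓡 (2 * n + 1)) f p w) = 0 := by
  obtain ⟨p₀, y, hy, rfl⟩ : ∃ p₀, ∃ y ∈ (extChartAt (𝓡 n) p₀).target,
      (extChartAt (𝓡 n) p₀).symm y = p := ⟨p, _, mem_extChartAt_target (I := 𝓡 n) p,
    (extChartAt (𝓡 n) p).left_inv (mem_extChartAt_source (I := 𝓡 n) p)⟩
  let k := extChartAt (𝓡 n) p₀
  have hT : IsOpen k.target := isOpen_extChartAt_target (I := 𝓡 n) p₀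
  let G : EuclideanSpace ℝ (Fin n) → M := fun y ↦ f (k.symm y)
  have hk : ∀ y ∈ k.target, HasMFDerivAt 𝓘(ℝ, EuclideanSpace ℝ (Fin n)) (𝓡 (2 * n + 1)) G y
      ((mfderiv (𝓡 n) (𝓡 (2 * n + 1)) f (k.symm y)).comp
        (mfderiv 𝓘(ℝ, EuclideanSpace ℝ (Fin n)) (𝓡 n) k.symm y)) := fun y hy ↦
    HasMFDerivAt.comp y (hf.contMDiff.mdifferentiableAt (by simp)).hasMFDerivAt
      (hasMFDerivAt_extChartAt_symm (I := 𝓡 n) hy)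
  have hG : ∀ᶠ y in 𝓝 y, ContMDiffAt 𝓘(ℝ, EuclideanSpace ℝ (Fin n)) (𝓡 (2 * n + 1)) ∞ G y := by
    filter_upwards [hT.mem_nhds hy] with z hz
    exact hf.contMDiff.contMDiffAt.comp z
      ((contMDiffOn_extChartAt_symm (I := 𝓡 n) (n := ∞) p₀).contMDiffAt (hT.mem_nhds hz))
  have h0 : pullForm α G =ᶠ[𝓝 y] fun _ ↦ 0 := by
    filter_upwards [hT.mem_nhds hy] with z hz
    refine ContinuousLinearMap.ext fun u ↦ ?_
    rw [pullForm, (hk z hz).mfderiv]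
    exact hf.isotropic (k.symm z) _
  obtain ⟨-, h1⟩ := hα.fderiv_pullForm_sub hG
  obtain ⟨v', hv'⟩ := surjective_mfderiv_extChartAt_symm hy v
  obtain ⟨w', hw'⟩ := surjective_mfderiv_extChartAt_symm hy w
  have h2 := h1 v' w'
  rw [h0.fderiv_eq, (hk y hy).mfderiv] at h2
  rw [← hv', ← hw']
  refine Eq.trans h2.symm ?_
  rw [hasFDerivAt_zero_of_eventually_const (0 : EuclideanSpace ℝ (Fin n) →L[ℝ] ℝ)
    (Filter.Eventually.of_forall fun _ ↦ rfl) |>.fderiv]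
  exact sub_self (0 : ℝ)

theorem dForm_sub_left (x : M) (u u' v : TangentSpace (𝓡 (2 * n + 1)) x) :
    dForm α x (u - u') v = dForm α x u v - dForm α x u' v := by
  let D := fderiv ℝ (coordForm α x) (extChartAt (𝓡 (2 * n + 1)) x x)
  let a : EuclideanSpace ℝ (Fin (2 * n + 1)) := u
  let a' : EuclideanSpace ℝ (Fin (2 * n + 1)) := u'
  let b : EuclideanSpace ℝ (Fin (2 * n + 1)) := v
  change D (a - a') b - D b (a - a') = D a b - D b a - (D a' b - D b a')
  simp only [map_sub, sub_apply]
  ring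

/-- A vector which is annihilated by `α` and `dα`-orthogonal to a Legendrian tangent space
belongs to it. -/
theorem IsLegendrianEmbedding.exists_mfderiv_eq (hα : IsContactForm α) {f : Λ → M}
    (hf : IsLegendrianEmbedding α f) {p : Λ} {u : TangentSpace (𝓡 (2 * n + 1)) (f p)}
    (hu : α (f p) u = 0)
    (hd : ∀ w, dForm α (f p) u (mfderiv (𝓡 n) (𝓡 (2 * n + 1)) f p w) = 0) :
    ∃ w, mfderiv (𝓡 n) (𝓡 (2 * n + 1)) f p w = u := by
  let W : EuclideanSpace ℝ (Fin n) →L[ℝ] EuclideanSpace ℝ (Fin (2 * n + 1)) :=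
    mfderiv (𝓡 n) (𝓡 (2 * n + 1)) f p
  exact (hα.isContactPair_dForm (f p)).mem_range_of_isotropic (W := W) (by simp)
    (hf.immersion p) (hf.isotropic p) (hf.dForm_mfderiv hα p) hu hd

/-- A contact isotopy whose Hamiltonian restricts to the speed `α(∂_t l)` of a Legendrian isotopy
`l` carries along the images of `l`. -/
theorem IsContactForm.image_flow_eq_range (hα : IsContactForm α) {l : ℝ → Λ → M}
    (hl : ContMDiff (𝓘(ℝ, ℝ).prod (𝓡 n)) (𝓡 (2 * n + 1)) ∞ (fun q : ℝ × Λ ↦ l q.1 q.2))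
    (hleg : ∀ t, IsLegendrianEmbedding α (l t)) {a : ℝ}
    (hla : ∀ t, a < |t| → ∀ p, velocity (n := n) l t p = 0) {F : ℝ → M → ℝ}
    (hF : ContMDiff (𝓘(ℝ, ℝ).prod (𝓡 (2 * n + 1))) 𝓘(ℝ, ℝ) ∞ (fun q : ℝ × M ↦ F q.1 q.2))
    (hFa : ∀ t, a < |t| → ∀ x, F t x = 0)
    (hFl : ∀ t p, F t (l t p) = α (l t p) (velocity l t p)) {φ : ℝ → M → M}
    (hφ : ContMDiff (𝓘(ℝ, ℝ).prod (𝓡 (2 * n + 1))) (𝓡 (2 * n + 1)) ∞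
      (fun q : ℝ × M ↦ φ q.1 q.2))
    (hφ0 : ∀ x, φ 0 x = x) (hφv : ∀ t x, velocity φ t x = hamField α (F t) (φ t x)) (t : ℝ) :
    φ t '' range (l 0) = range (l t) := by
  have : T2Space Λ := (hleg 0).isEmbedding.t2Space
  have hlt : ∀ t, ContMDiff (𝓡 n) (𝓡 (2 * n + 1)) ∞ (l t) := fun t ↦ (hleg t).contMDiff
  have hFt : ∀ t, ContMDiff (𝓡 (2 * n + 1)) 𝓘(ℝ, ℝ) ∞ (F t) := fun t ↦
    hF.comp (contMDiff_const.prodMk contMDiff_id)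
  -- The Hamiltonian field and the velocity have the same α-value. Differentiating the constant 0 =
  -- α(Dl_t w) in t shows that their difference is dα-orthogonal to L_t. A Legendrian tangent space
  -- is its own complement in ker α, so the difference is tangent to L_t.
  have hV : ∀ t p, ∃ w : TangentSpace (𝓡 n) p, mfderiv (𝓡 n) (𝓡 (2 * n + 1)) (l t) p w =
      hamField α (F t) (l t p) - velocity l t p := by
    intro t p
    refine (hleg t).exists_mfderiv_eq hα ?_ fun w ↦ ?_
    · rw [map_sub, hα.form_hamField, hFl, sub_self]
    · have h1 := hα.hasDerivAt_form_derivative hl (t := t) (p := p) (h := fun p ↦ F t (l t p))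
        (HasMFDerivAt.comp p ((hFt t).mdifferentiable (by simp) (l t p)).hasMFDerivAt
          ((hlt t).mdifferentiable (by simp) p).hasMFDerivAt)
        (fun y ↦ (hFl t y).symm) w
      have h2 := h1.unique ((hasDerivAt_const t (0 : ℝ)).congr_of_eventuallyEq
        (Filter.Eventually.of_forall fun s ↦ (hleg s).isotropic p w))
      rw [dForm_sub_left, hα.dForm_hamField, (hleg t).isotropic, mul_zero, add_zero]
      have h4 : differential (F t) (l t p) (mfderiv (𝓡 n) (𝓡 (2 * n + 1)) (l t) p w) +
        dForm α (l t p) (velocity l t p) (mfderiv (𝓡 n) (𝓡 (2 * n + 1)) (l t) p w) = 0 := h2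
      linarith
  choose V hV using hV
  have hu : ContMDiff (𝓘(ℝ, ℝ).prod (𝓡 n)) (𝓡 (2 * n + 1)).tangent ∞
      (fun q : ℝ × Λ ↦ (⟨l q.1 q.2, hamField α (F q.1) (l q.1 q.2) - velocity l q.1 q.2⟩ :
        TangentBundle (𝓡 (2 * n + 1)) M)) := fun q ↦
    contMDiffAt_tangent_sub ((hα.contMDiff_hamField hF).comp (contMDiff_fst.prodMk hl) q)
      (contMDiff_velocity hl q)
  have hVs : ContMDiff (𝓘(ℝ, ℝ).prod (𝓡 n)) (𝓡 n).tangent ∞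
      (fun q : ℝ × Λ ↦ (⟨q.2, V q.1 q.2⟩ : TangentBundle (𝓡 n) Λ)) := by
    rintro ⟨t₀, p₀⟩
    obtain ⟨r, hr, hrl⟩ := exists_local_leftInverse hl ((hleg t₀).immersion p₀)
    obtain ⟨U, hUs, hU, hU0⟩ := eventually_nhds_iff.1 hr
    -- V was obtained pointwise by choice. It is smooth because it is the image of a smooth vector
    -- field under the derivative of a local left inverse of l.
    have h1 := contMDiffAt_family_derivative (l := r) hU
      (fun q hq ↦ (hUs q hq).contMDiffWithinAt) (s := fun q : ℝ × Λ ↦ q.1)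
      (b := fun q : ℝ × Λ ↦ l q.1 q.2)
      (w := fun q ↦ hamField α (F q.1) (l q.1 q.2) - velocity l q.1 q.2) (q₀ := (t₀, p₀))
      contMDiffAt_fst (hu _) hU0
    refine h1.congr_of_eventuallyEq ?_
    have h2 : ∀ᶠ q : ℝ × Λ in 𝓝 (t₀, p₀), (q.1, l q.1 q.2) ∈ U :=
      (continuous_fst.prodMk hl.continuous).continuousAt.eventually (hU.mem_nhds hU0)
    filter_upwards [hrl.eventually_nhds, h2] with q hq hqU
    have h3 : (fun p ↦ r q.1 (l q.1 p)) =ᶠ[𝓝 q.2] id :=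
      (Continuous.prodMk_right q.1).continuousAt.eventually hq
    have h4 : HasMFDerivAt (𝓡 n) (𝓡 n) (fun p ↦ r q.1 (l q.1 p)) q.2
        (ContinuousLinearMap.id ℝ (TangentSpace (𝓡 n) q.2)) :=
      (hasMFDerivAt_id (I := 𝓡 n) q.2).congr_of_eventuallyEq h3
    have h5 := (hasMFDerivAt_family_snd
      ((hUs _ hqU).mdifferentiableAt (by simp))).mdifferentiableAt.hasMFDerivAt
    have h6 := hasMFDerivAt_unique h4 (HasMFDerivAt.comp (f := l q.1) q.2 h5
      ((hlt q.1).mdifferentiable (by simp) q.2).hasMFDerivAt)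
    have h7 := congrArg (fun L : EuclideanSpace ℝ (Fin n) →L[ℝ] EuclideanSpace ℝ (Fin n) ↦
      L (V q.1 q.2)) h6
    have h8 : (V q.1 q.2 : EuclideanSpace ℝ (Fin n)) =
        mfderiv (𝓡 (2 * n + 1)) (𝓡 n) (r q.1) (l q.1 q.2)
          (hamField α (F q.1) (l q.1 q.2) - velocity l q.1 q.2) := by
      rw [← hV]
      exact h7
    have h9 : r q.1 (l q.1 q.2) = q.2 := hq.self_of_nhds
    have h10 : ∀ (y : Λ) (w : EuclideanSpace ℝ (Fin n)), y = q.2 →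
        (w : EuclideanSpace ℝ (Fin n)) = V q.1 q.2 →
        (⟨q.2, V q.1 q.2⟩ : TangentBundle (𝓡 n) Λ) = ⟨y, w⟩ := by
      rintro y w rfl rfl; rfl
    exact h10 _ _ h9 h8.symm
  have hVa : ∀ t, a < |t| → ∀ p, V t p = 0 := by
    intro t ht p
    apply (hleg t).immersion p
    rw [hV, hla t ht, sub_zero, hα.hamField_eq_zero (Filter.Eventually.of_forall (hFa t ht)),
      map_zero]
  obtain ⟨d, hd, hd0, hdd, hdv, -⟩ := exists_flow_timeDependent hVs isCompact_univ (a := a)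
    (fun t x hx ↦ absurd (mem_univ x) hx) hVa
  -- Reparametrising l_t by the flow d of V adds exactly the missing tangential velocity, so both
  -- curves solve the same equation. Since d_t is a bijection of Λ, the images agree.
  have key : ∀ p, (fun t ↦ l t (d t p)) = fun t ↦ φ t (l 0 p) := by
    intro p
    refine eq_of_hasMFDerivAt_timeDependent (I := 𝓡 (2 * n + 1))
      (X := fun t x ↦ hamField α (F t) x) (t₀ := 0) (hα.contMDiff_hamField hF) (fun t ↦ ?_)
      (fun t ↦ ?_) (by simp [hd0, hφ0])
    · have h1 := velocity_comp (n := n) hl (hasDerivAt_id t) (m := d) (p := p)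
        (hdv t p).mdifferentiableAt
      refine hasMFDerivAt_of_velocity (l := fun t p ↦ l t (d t p)) ?_ ?_
      · exact ((hasMFDerivAt_family_curve (l := l) (J := 𝓘(ℝ, ℝ)) (θ := id)
          (hl.mdifferentiableAt (by simp)) (hasMFDerivAt_id (I := 𝓘(ℝ, ℝ)) t)
          (hdv t p))).mdifferentiableAt
      · refine h1.trans ?_
        have h2 : mfderiv 𝓘(ℝ, ℝ) (𝓡 n) (fun s ↦ d s p) t (1 : ℝ) = V t (d t p) := by
          rw [(hdv t p).mfderiv]
          exact one_smul ℝ (V t (d t p) : EuclideanSpace ℝ (Fin n))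
        rw [h2]
        simp only [id]
        rw [hV, one_smul, add_sub_cancel]
    · exact hasMFDerivAt_of_velocity (hasMFDerivAt_family_fst
        (hφ.mdifferentiableAt (by simp))).mdifferentiableAt (hφv t _)
  obtain ⟨D, hD⟩ := hdd t
  ext x
  constructor
  · rintro ⟨_, ⟨p, rfl⟩, rfl⟩
    exact ⟨d t p, congrFun (key p) t⟩
  · rintro ⟨p, rfl⟩
    obtain ⟨p', hp'⟩ := D.surjective p
    rw [← hp']
    refine ⟨l 0 p', mem_range_self _, (congrFun (key p') t).symm.trans ?_⟩
    exact congrArg (l t) (congrFun hD p').symm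

end Trace

/-! ### Extending Legendrian isotopies to contact isotopies. -/

section Extension

variable {n : ℕ} {M : Type*} [TopologicalSpace M] [T2Space M]
  [ChartedSpace (EuclideanSpace ℝ (Fin (2 * n + 1))) M] [IsManifold (𝓡 (2 * n + 1)) ∞ M]
  {α : ∀ x : M, TangentSpace (𝓡 (2 * n + 1)) x →L[ℝ] ℝ}
  {Λ : Type*} [TopologicalSpace Λ] [CompactSpace Λ]
  [ChartedSpace (EuclideanSpace ℝ (Fin n)) Λ] [IsManifold (𝓡 n) ∞ Λ]

theorem deriv_smoothTransition_eq_zero {t : ℝ} (ht : t < 0 ∨ 1 < t) :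
    deriv Real.smoothTransition t = 0 := by
  rcases ht with h | h
  · have h1 : Real.smoothTransition =ᶠ[𝓝 t] fun _ ↦ 0 := by
      filter_upwards [gt_mem_nhds h] with s hs using Real.smoothTransition.zero_of_nonpos hs.le
    rw [h1.deriv_eq, deriv_const]
  · have h1 : Real.smoothTransition =ᶠ[𝓝 t] fun _ ↦ 1 := by
      filter_upwards [lt_mem_nhds h] with s hs using Real.smoothTransition.one_of_one_le hs.le
    rw [h1.deriv_eq, deriv_const]

theorem deriv_smoothTransition_eq_zero_of_abs {t : ℝ} (ht : 1 < |t|) :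
    deriv Real.smoothTransition t = 0 :=
  deriv_smoothTransition_eq_zero ((lt_abs.1 ht).symm.imp (fun h ↦ by linarith) id)

/-- A Legendrian isotopy can be reparametrised so that it is constant near and beyond its ends. -/
theorem IsLegendrianIsotopy.exists_reparam {l : ℝ → Λ → M} (hl : IsLegendrianIsotopy α l) :
    ∃ m : ℝ → Λ → M,
      ContMDiff (𝓘(ℝ, ℝ).prod (𝓡 n)) (𝓡 (2 * n + 1)) ∞ (fun q : ℝ × Λ ↦ m q.1 q.2) ∧
      (∀ t, IsLegendrianEmbedding α (m t)) ∧ m 0 = l 0 ∧ m 1 = l 1 ∧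
      (∀ t, 1 < |t| → ∀ p, velocity (n := n) m t p = 0) ∧
      ∀ t p, ∃ s ∈ Icc (0 : ℝ) 1, ∃ c ≥ 0,
        α (m t p) (velocity m t p) = c * α (l s p) (velocity l s p) := by
  have hθ : ContDiff ℝ ∞ Real.smoothTransition := Real.smoothTransition.contDiff
  have hv : ∀ t p, velocity (n := n) (fun t ↦ l (Real.smoothTransition t)) t p =
      deriv Real.smoothTransition t • velocity l (Real.smoothTransition t) p := fun t p ↦
    velocity_reparam hl.contMDiff ((hθ.differentiable (by simp)) t).hasDerivAt p
  refine ⟨fun t ↦ l (Real.smoothTransition t),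
    hl.contMDiff.comp ((hθ.contMDiff.comp contMDiff_fst).prodMk contMDiff_snd),
    fun t ↦ hl.legendrian _ ⟨Real.smoothTransition.nonneg t, Real.smoothTransition.le_one t⟩,
    by simp [Real.smoothTransition.zero], by simp [Real.smoothTransition.one],
    fun t ht p ↦ ?_, fun t p ↦ ⟨Real.smoothTransition t,
      ⟨Real.smoothTransition.nonneg t, Real.smoothTransition.le_one t⟩,
      deriv Real.smoothTransition t, Real.smoothTransition.monotone.deriv_nonneg, ?_⟩⟩
  · rw [hv, deriv_smoothTransition_eq_zero_of_abs ht]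
    exact zero_smul ℝ _
  · rw [hv, map_smul, smul_eq_mul]

/-- A Legendrian isotopy which is everywhere tangent to its image has constant image. -/
theorem IsContactForm.range_eq_of_form_velocity_eq_zero (hα : IsContactForm α) {l : ℝ → Λ → M}
    (hl : IsLegendrianIsotopy α l)
    (h0 : ∀ t ∈ Icc (0 : ℝ) 1, ∀ p, α (l t p) (velocity l t p) = 0) :
    range (l 0) = range (l 1) := by
  obtain ⟨m, hm, hleg, hm0, hm1, hma, hmv⟩ := hl.exists_reparam
  -- With vanishing speed the zero Hamiltonian, whose flow is the identity, follows the isotopy.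
  have h := hα.image_flow_eq_range hm hleg hma (F := fun _ _ ↦ 0) contMDiff_const
    (fun _ _ _ ↦ rfl) (fun t p ↦ by
      obtain ⟨s, hs, c, -, h⟩ := hmv t p
      rw [h, h0 s hs, mul_zero]) (φ := fun _ x ↦ x) contMDiff_snd (fun _ ↦ rfl) (fun t x ↦ by
      rw [hα.hamField_eq_zero (Filter.Eventually.of_forall fun _ ↦ rfl), velocity, mfderiv_const]
      rfl) 1
  rw [← hm0, ← hm1, ← h, image_id']

/-- Followed by the projection to ℝ the map is proper, because Λ is compact. Hence it is itself
proper, and so closed. -/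
theorem isClosedEmbedding_graph {l : ℝ → Λ → M} (hl : Continuous fun q : ℝ × Λ ↦ l q.1 q.2)
    (hinj : ∀ t, Function.Injective (l t)) :
    Topology.IsClosedEmbedding (fun q : ℝ × Λ ↦ (q.1, l q.1 q.2)) := by
  have hc : Continuous (fun q : ℝ × Λ ↦ (q.1, l q.1 q.2)) := continuous_fst.prodMk hl
  refine Topology.IsClosedEmbedding.of_continuous_injective_isClosedMap hc ?_
    (isProperMap_of_comp_of_t2 hc continuous_fst
      (isProperMap_fst_of_compactSpace : IsProperMap (Prod.fst : ℝ × Λ → ℝ))).isClosedMap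
  rintro ⟨t, p⟩ ⟨t', p'⟩ h
  obtain ⟨rfl, h2⟩ := Prod.ext_iff.1 h
  exact Prod.ext rfl (hinj _ h2)

variable [SecondCountableTopology M]

/-- Smooth functions on the trace of a Legendrian isotopy extend to the ambient manifold. -/
theorem exists_extension_of_family {l : ℝ → Λ → M}
    (hl : ContMDiff (𝓘(ℝ, ℝ).prod (𝓡 n)) (𝓡 (2 * n + 1)) ∞ (fun q : ℝ × Λ ↦ l q.1 q.2))
    (hinj : ∀ t, Function.Injective (l t))
    (himm : ∀ t p, Function.Injective (mfderiv (𝓡 n) (𝓡 (2 * n + 1)) (l t) p))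
    {h : ℝ × Λ → ℝ} (hh : ContMDiff (𝓘(ℝ, ℝ).prod (𝓡 n)) 𝓘(ℝ, ℝ) ∞ h) {S : Set ℝ}
    (hS : Convex ℝ S) (hS0 : S.Nonempty) (hSh : ∀ q, h q ∈ S) :
    ∃ F : ℝ → M → ℝ,
      ContMDiff (𝓘(ℝ, ℝ).prod (𝓡 (2 * n + 1))) 𝓘(ℝ, ℝ) ∞ (fun q : ℝ × M ↦ F q.1 q.2) ∧
      (∀ t p, F t (l t p) = h (t, p)) ∧ ∀ t x, F t x ∈ S := by
  have : LocallyCompactSpace M := Manifold.locallyCompact_of_finiteDimensional (𝓡 (2 * n + 1))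
  have hj := isClosedEmbedding_graph hl.continuous hinj
  obtain ⟨g, hg⟩ : ∃ g : C^((⊤ : ℕ∞))⟮𝓘(ℝ, ℝ).prod (𝓡 (2 * n + 1)), ℝ × M; 𝓘(ℝ, ℝ), ℝ⟯,
      ∀ q, g q ∈ {y | (∀ p, q = (q.1, l q.1 p) → y = h (q.1, p)) ∧ y ∈ S} := by
    -- A partition of unity glues local extensions: having the prescribed value on the trace and
    -- lying in S are convex conditions on the value.
    refine exists_contMDiffMap_forall_mem_convex_of_local _ ?_ ?_
    · refine fun q a ha b hb c d hc hd hcd ↦ ⟨fun p hp ↦ ?_, hS ha.2 hb.2 hc hd hcd⟩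
      rw [ha.1 p hp, hb.1 p hp, ← add_smul, hcd, one_smul]
    · rintro ⟨t₀, x₀⟩
      by_cases hx : (t₀, x₀) ∈ range (fun q : ℝ × Λ ↦ (q.1, l q.1 q.2))
      · obtain ⟨⟨t, p₀⟩, hq⟩ := hx
        obtain ⟨rfl, rfl⟩ := Prod.ext_iff.1 hq
        obtain ⟨r, hr, hrl⟩ := exists_local_leftInverse hl (himm t p₀)
        -- The left inverse r is known only near p₀. As the graph map is a topological embedding,
        -- every point of the trace near (t, l_t(p₀)) comes from such a parameter.
        have h1 : ∀ᶠ z in 𝓝 (t, l t p₀), ∀ q : ℝ × Λ, (q.1, l q.1 q.2) = z →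
            r q.1 (l q.1 q.2) = q.2 := by
          have h2 : 𝓝 (t, p₀) = Filter.comap (fun q : ℝ × Λ ↦ (q.1, l q.1 q.2)) (𝓝 (t, l t p₀)) :=
            hj.isInducing.nhds_eq_comap (t, p₀)
          rw [h2, Filter.eventually_comap] at hrl
          exact hrl
        refine ⟨_, hr.and h1, fun z ↦ h (z.1, r z.1 z.2), fun z hz ↦ ?_, fun z hz ↦ ⟨?_, hSh _⟩⟩
        · exact (hh.contMDiffAt.comp z (contMDiffAt_fst.prodMk hz.1)).contMDiffWithinAt
        · intro p hp
          have h3 := hz.2 (z.1, p) hp.symm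
          simp only at h3
          have h4 : z.2 = l z.1 p := congrArg Prod.snd hp
          simp only [h4, h3]
      · obtain ⟨s₀, hs₀⟩ := hS0
        refine ⟨(range (fun q : ℝ × Λ ↦ (q.1, l q.1 q.2)))ᶜ,
          hj.isClosed_range.isOpen_compl.mem_nhds hx, fun _ ↦ s₀, contMDiffOn_const,
          fun q hq ↦ ⟨fun p hp ↦ absurd ⟨(q.1, p), hp.symm⟩ hq, hs₀⟩⟩
  exact ⟨fun t x ↦ g (t, x), g.contMDiff, fun t p ↦ (hg (t, l t p)).1 p rfl,
    fun t x ↦ (hg (t, x)).2⟩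

theorem exists_cutoff {K U : Set M} (hK : IsCompact K) (hU : IsOpen U) (hKU : K ⊆ U) :
    ∃ χ : M → ℝ, ContMDiff (𝓡 (2 * n + 1)) 𝓘(ℝ, ℝ) ∞ χ ∧ (∀ᶠ x in 𝓝ˢ K, χ x = 1) ∧
      (∀ x, 0 ≤ χ x) ∧ (∀ x, χ x ≤ 1) ∧ ∃ K' ⊆ U, IsCompact K' ∧ ∀ x ∉ K', χ x = 0 := by
  have : LocallyCompactSpace M := Manifold.locallyCompact_of_finiteDimensional (𝓡 (2 * n + 1))
  obtain ⟨K', hK', hKK', hK'U⟩ := exists_compact_between hK hU hKU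
  obtain ⟨f, hf1, hf0, hf⟩ := exists_contMDiffMap_one_nhds_of_subset_interior
    (𝓡 (2 * n + 1)) (n := (⊤ : ℕ∞)) hK.isClosed hKK'
  exact ⟨f, f.contMDiff, hf1, fun x ↦ (hf x).1, fun x ↦ (hf x).2, K', hK'U, hK', hf0⟩

/-- Legendrian isotopies extend to compactly supported contact isotopies, and non-negative ones
to non-negative ones. -/
theorem IsContactForm.exists_posPath_of_isotopy (hα : IsContactForm α) {l : ℝ → Λ → M}
    (hl : IsLegendrianIsotopy α l) :
    ∃ φ : ℝ → M → M, IsPosPath α φ ∧ (∀ x, φ 0 x = x) ∧ φ 1 '' range (l 0) = range (l 1) ∧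
      ((∀ t ∈ Icc (0 : ℝ) 1, ∀ p, 0 ≤ α (l t p) (velocity l t p)) →
        ∀ t x, 0 ≤ α (φ t x) (velocity φ t x)) := by
  obtain ⟨m, hm, hleg, hm0, hm1, hma, hmv⟩ := hl.exists_reparam
  -- S is [0, ∞) for a non-negative isotopy and ℝ otherwise, so a single extension covers both
  -- cases.
  let S : Set ℝ := {y | (∀ t ∈ Icc (0 : ℝ) 1, ∀ p, 0 ≤ α (l t p) (velocity l t p)) → 0 ≤ y}
  obtain ⟨F₀, hF₀, hF₀m, hF₀S⟩ := exists_extension_of_family hm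
    (fun t ↦ (hleg t).isEmbedding.injective) (fun t ↦ (hleg t).immersion)
    (hα.contMDiff_form_velocity hm) (S := S)
    (fun a ha b hb c d hc hd _ hpos ↦ add_nonneg (mul_nonneg hc (ha hpos))
      (mul_nonneg hd (hb hpos))) ⟨0, fun _ ↦ le_rfl⟩ (fun q hpos ↦ by
        obtain ⟨s, hs, c, hc, h⟩ := hmv q.1 q.2
        rw [h]
        exact mul_nonneg hc (hpos s hs _))
  -- ρ cuts off in time and χ in space. Both are 1 on the trace for |t| ≤ 1, and beyond that the
  -- reparametrised isotopy has velocity 0, so the prescribed values along it are unaffected.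
  let ρ : ContDiffBump (0 : ℝ) := ⟨1, 2, one_pos, one_lt_two⟩
  have hK₀ : IsCompact ((fun q : ℝ × Λ ↦ m q.1 q.2) '' (Icc (-2) 2 ×ˢ univ)) :=
    (isCompact_Icc.prod isCompact_univ).image hm.continuous
  obtain ⟨χ, hχ, hχ1, hχ0, -, K, -, hK, hχK⟩ :=
    exists_cutoff (n := n) hK₀ isOpen_univ (subset_univ _)
  have hχm : ∀ t ∈ Icc (-2 : ℝ) 2, ∀ p, χ (m t p) = 1 := fun t ht p ↦
    hχ1.self_of_nhdsSet _ ⟨(t, p), ⟨ht, mem_univ _⟩, rfl⟩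
  have hρ : ContMDiff (𝓘(ℝ, ℝ).prod (𝓡 (2 * n + 1))) 𝓘(ℝ, ℝ) ∞ (fun q : ℝ × M ↦ ρ q.1) :=
    ρ.contDiff.contMDiff.comp contMDiff_fst
  let F : ℝ → M → ℝ := fun t x ↦ ρ t * (χ x * F₀ t x)
  have hF : ContMDiff (𝓘(ℝ, ℝ).prod (𝓡 (2 * n + 1))) 𝓘(ℝ, ℝ) ∞ (fun q : ℝ × M ↦ F q.1 q.2) :=
    hρ.mul ((hχ.comp contMDiff_snd).mul hF₀)
  have hρ0 : ∀ t : ℝ, 2 < |t| → ρ t = 0 := fun t ht ↦ ρ.zero_of_le_dist (by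
    rw [Real.dist_eq, sub_zero]; exact ht.le)
  obtain ⟨φ, hφ, hφ0, hφv⟩ := hα.exists_contactFlow hF hK (a := 2)
    (fun t x hx ↦ by simp only [F, hχK x hx]; ring)
    (fun t ht x ↦ by simp only [F, hρ0 t ht]; ring)
  refine ⟨φ, hφ, hφ0, ?_, fun hpos t x ↦ ?_⟩
  · rw [← hm0, ← hm1]
    refine hα.image_flow_eq_range hm hleg (a := 2) (fun t ht ↦ hma t (by linarith)) hF
      (fun t ht x ↦ by simp only [F, hρ0 t ht]; ring) (fun t p ↦ ?_) hφ.contMDiff hφ0 hφv 1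
    simp only [F, hF₀m]
    by_cases ht : |t| ≤ 1
    · rw [hχm t (by rw [abs_le] at ht; constructor <;> linarith [ht.1, ht.2]),
        ρ.one_of_mem_closedBall (by simpa [Real.dist_eq] using ht)]
      simp
    · rw [hma t (not_le.1 ht), map_zero, mul_zero, mul_zero]
  · rw [hφv, hα.form_hamField]
    exact mul_nonneg ρ.nonneg (mul_nonneg (hχ0 _) (hF₀S _ _ hpos))

end Extension

/-! ### Contactomorphisms preserving a Legendrian act transitively on it. -/

section Homogeneity

variable {n : ℕ} {M : Type*} [TopologicalSpace M] [T2Space M] [SecondCountableTopology M]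
  [ChartedSpace (EuclideanSpace ℝ (Fin (2 * n + 1))) M] [IsManifold (𝓡 (2 * n + 1)) ∞ M]
  {α : ∀ x : M, TangentSpace (𝓡 (2 * n + 1)) x →L[ℝ] ℝ}
  {Λ : Type*} [TopologicalSpace Λ] [CompactSpace Λ]
  [ChartedSpace (EuclideanSpace ℝ (Fin n)) Λ] [IsManifold (𝓡 n) ∞ Λ]

/-- The local expression of a Hamiltonian which vanishes along the submanifold `ψ` and generates
the vector field `∂_v ψ` there. -/
def tangentHam {F E : Type*} [NormedAddCommGroup F] [NormedSpace ℝ F] [NormedAddCommGroup E]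
    [NormedSpace ℝ E] (Ω : E → E →L[ℝ] E →L[ℝ] ℝ) (ψ : F → E) (v : F) (q : F × E) : ℝ :=
  Ω (ψ q.1) (q.2 - ψ q.1) (fderiv ℝ ψ q.1 v) - Ω (ψ q.1) (fderiv ℝ ψ q.1 v) (q.2 - ψ q.1)

theorem contDiffAt_tangentHam {F E : Type*} [NormedAddCommGroup F] [NormedSpace ℝ F]
    [NormedAddCommGroup E] [NormedSpace ℝ E] {Ω : E → E →L[ℝ] E →L[ℝ] ℝ} {ψ : F → E} (v : F)
    {y : F} (hψ : ContDiffAt ℝ ∞ ψ y) (hΩ : ContDiffAt ℝ ∞ Ω (ψ y)) (b : E) :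
    ContDiffAt ℝ ∞ (tangentHam Ω ψ v) (y, b) := by
  have h1 : ContDiffAt ℝ ∞ (fun q : F × E ↦ ψ q.1) (y, b) := hψ.comp (y, b) contDiffAt_fst
  have h2 : ContDiffAt ℝ ∞ (fun q : F × E ↦ Ω (ψ q.1)) (y, b) := hΩ.comp (y, b) h1
  have h3 : ContDiffAt ℝ ∞ (fun q : F × E ↦ fderiv ℝ ψ q.1 v) (y, b) :=
    (ContDiffAt.comp (g := fderiv ℝ ψ) (y, b) (hψ.fderiv_right (m := ∞) (by simp))
      contDiffAt_fst).clm_apply contDiffAt_const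
  have h4 : ContDiffAt ℝ ∞ (fun q : F × E ↦ q.2 - ψ q.1) (y, b) := contDiffAt_snd.sub h1
  exact ((h2.clm_apply h4).clm_apply h3).sub ((h2.clm_apply h3).clm_apply h4)

-- On the submanifold the factor q.2 - ψ(q.1) is zero, so only its own derivative contributes.
set_option synthInstance.maxHeartbeats 200000 in
theorem fderiv_tangentHam {F E : Type*} [NormedAddCommGroup F] [NormedSpace ℝ F]
    [NormedAddCommGroup E] [NormedSpace ℝ E] {Ω : E → E →L[ℝ] E →L[ℝ] ℝ} {ψ : F → E} (v : F)
    {y : F} (hψ : ContDiffAt ℝ ∞ ψ y) (hΩ : ContDiffAt ℝ ∞ Ω (ψ y)) (a : F) (b : E) :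
    fderiv ℝ (tangentHam Ω ψ v) (y, ψ y) (a, b) =
      Ω (ψ y) (b - fderiv ℝ ψ y a) (fderiv ℝ ψ y v) -
        Ω (ψ y) (fderiv ℝ ψ y v) (b - fderiv ℝ ψ y a) := by
  have h1 : HasFDerivAt (fun q : F × E ↦ ψ q.1) ((fderiv ℝ ψ y).comp
      (ContinuousLinearMap.fst ℝ F E)) (y, ψ y) :=
    (hψ.differentiableAt (by simp)).hasFDerivAt.comp (y, ψ y) hasFDerivAt_fst
  have h2 := (hΩ.differentiableAt (by simp)).hasFDerivAt.comp (y, ψ y) h1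
  have h3 := ((ContDiffAt.comp (g := fderiv ℝ ψ) (f := fun q : F × E ↦ q.1) (y, ψ y)
    (hψ.fderiv_right (m := ∞) (by simp)) contDiffAt_fst).clm_apply
      (contDiffAt_const (c := v))).differentiableAt (by simp) |>.hasFDerivAt
  have h4 : HasFDerivAt (fun q : F × E ↦ q.2 - ψ q.1) (ContinuousLinearMap.snd ℝ F E -
    (fderiv ℝ ψ y).comp (ContinuousLinearMap.fst ℝ F E)) (y, ψ y) := hasFDerivAt_snd.sub h1
  have h5 := ((h2.clm_apply h4).clm_apply h3).sub ((h2.clm_apply h3).clm_apply h4)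
  have h6 : fderiv ℝ (tangentHam Ω ψ v) (y, ψ y) = _ := h5.fderiv
  rw [h6]
  simp

theorem dForm_congr {x x' : M} (h : x = x') (u v : EuclideanSpace ℝ (Fin (2 * n + 1))) :
    dForm α x (show TangentSpace (𝓡 (2 * n + 1)) x from u)
      (show TangentSpace (𝓡 (2 * n + 1)) x from v) =
    dForm α x' (show TangentSpace (𝓡 (2 * n + 1)) x' from u)
      (show TangentSpace (𝓡 (2 * n + 1)) x' from v) := by
  subst h; rfl

theorem dForm_smul_left (c : ℝ) (x : M) (u v : TangentSpace (𝓡 (2 * n + 1)) x) :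
    dForm α x (c • u) v = c * dForm α x u v := by
  let D := fderiv ℝ (coordForm α x) (extChartAt (𝓡 (2 * n + 1)) x x)
  let a : EuclideanSpace ℝ (Fin (2 * n + 1)) := u
  let b : EuclideanSpace ℝ (Fin (2 * n + 1)) := v
  change D (c • a) b - D b (c • a) = c * (D a b - D b a)
  simp only [map_smul, smul_apply, smul_eq_mul]
  ring

/-- Contactomorphisms preserving a Legendrian submanifold move its points locally
transitively. -/
theorem IsLegendrianEmbedding.eventually_exists_contactomorphism (hα : IsContactForm α)
    {f : Λ → M} (hf : IsLegendrianEmbedding α f) (p₀ : Λ) : ∀ᶠ p in 𝓝 p₀, ∃ g : M → M,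
      IsPosPath α (fun _ ↦ g) ∧ g '' range f = range f ∧ g (f p₀) = f p := by
  set x₀ := f p₀ with hx₀
  set k := extChartAt (𝓡 n) p₀ with hk
  set e := extChartAt (𝓡 (2 * n + 1)) x₀ with he
  have hkT : IsOpen k.target := isOpen_extChartAt_target (I := 𝓡 n) p₀
  have heT : IsOpen e.target := isOpen_extChartAt_target (I := 𝓡 (2 * n + 1)) x₀
  have hkS : IsOpen k.source := isOpen_extChartAt_source (I := 𝓡 n) p₀
  have heS : IsOpen e.source := isOpen_extChartAt_source (I := 𝓡 (2 * n + 1)) x₀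
  have hfc : Continuous f := hf.contMDiff.continuous
  let Ω := fderiv ℝ (coordForm α x₀)
  let ψ : EuclideanSpace ℝ (Fin n) → EuclideanSpace ℝ (Fin (2 * n + 1)) :=
    fun y ↦ e (f (k.symm y))
  have hΩ : ∀ y ∈ e.target, ContDiffAt ℝ ∞ Ω y := fun y hy ↦
    (hα.contDiffAt_coordForm hy).fderiv_right (m := ∞) (by simp)
  -- the coordinate expression of the embedding
  have hψ : ∀ p ∈ k.source, f p ∈ e.source → ContDiffAt ℝ ∞ ψ (k p) := by
    intro p hp hfp
    rw [← contMDiffAt_iff_contDiffAt]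
    have h1 : ContMDiffAt 𝓘(ℝ, EuclideanSpace ℝ (Fin n)) (𝓡 (2 * n + 1)) ∞
        (fun y ↦ f (k.symm y)) (k p) := hf.contMDiff.contMDiffAt.comp _
      ((contMDiffOn_extChartAt_symm (I := 𝓡 n) (n := ∞) p₀).contMDiffAt
        (hkT.mem_nhds (k.map_source hp)))
    refine ContMDiffAt.comp (g := e) (f := fun y ↦ f (k.symm y)) (k p)
      (contMDiffAt_extChartAt' ?_) h1
    rw [k.left_inv hp]
    rwa [he, extChartAt_source] at hfp
  obtain ⟨r₀, hr₀, hr₀l⟩ := exists_local_leftInverse (l := fun _ : ℝ ↦ f) (t₀ := 0)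
    (hf.contMDiff.comp contMDiff_snd) (hf.immersion p₀)
  let r : M → Λ := r₀ 0
  have hr : ∀ᶠ x in 𝓝 x₀, ContMDiffAt (𝓡 (2 * n + 1)) (𝓡 n) ∞ r x := by
    filter_upwards [(Continuous.prodMk_right (0 : ℝ)).continuousAt.eventually hr₀] with x hx
    exact ContMDiffAt.comp (g := fun q : ℝ × M ↦ r₀ q.1 q.2) (f := fun x ↦ ((0 : ℝ), x)) x hx
      (contMDiffAt_const.prodMk contMDiffAt_id)
  have hrl : ∀ᶠ p in 𝓝 p₀, r (f p) = p :=
    (Continuous.prodMk_right (0 : ℝ)).continuousAt.eventually hr₀l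
  have hr0 : r x₀ = p₀ := hrl.self_of_nhds
  have hrc : ContinuousAt r x₀ := hr.self_of_nhds.continuousAt
  have hW : ∀ᶠ x in 𝓝 x₀, x ∈ e.source ∧ ContMDiffAt (𝓡 (2 * n + 1)) (𝓡 n) ∞ r x ∧
      r x ∈ k.source ∧ f (r x) ∈ e.source ∧ ∀ p, f p = x → r (f p) = p := by
    have h1 : ∀ᶠ x in 𝓝 x₀, ∀ p, f p = x → r (f p) = p := by
      rw [hf.isEmbedding.isInducing.nhds_eq_comap, Filter.eventually_comap] at hrl
      exact hrl
    have h2 : ∀ᶠ x in 𝓝 x₀, r x ∈ k.source := hrc.eventually (by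
      rw [hr0]; exact extChartAt_source_mem_nhds (I := 𝓡 n) p₀)
    have h3 : ∀ᶠ x in 𝓝 x₀, f (r x) ∈ e.source :=
      (hfc.continuousAt.comp hrc).eventually (by
        simp only [Function.comp, hr0]
        exact extChartAt_source_mem_nhds (I := 𝓡 (2 * n + 1)) x₀)
    filter_upwards [extChartAt_source_mem_nhds (I := 𝓡 (2 * n + 1)) x₀, hr, h2, h3, h1] with
      x a b c d e using ⟨a, b, c, d, e⟩
  obtain ⟨W, hWs, hWo, hxW⟩ := eventually_nhds_iff.1 hW
  obtain ⟨χ, hχ, hχ1, -, -, K, hKW, hK, hχK⟩ := exists_cutoff (n := n) (isCompact_singleton (x := x₀))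
    hWo (singleton_subset_iff.2 hxW)
  rw [nhdsSet_singleton] at hχ1
  obtain ⟨W', hW's, hW'o, hxW'⟩ := eventually_nhds_iff.1 (hχ1.and (hWo.mem_nhds hxW))
  -- The aim is a Hamiltonian that vanishes on the Legendrian, so that its flow preserves it, and
  -- whose contact field there is the coordinate field in direction v. Near x₀ the local left
  -- inverse r supplies the base point.
  let G : EuclideanSpace ℝ (Fin n) → M → ℝ := fun v x ↦ tangentHam Ω ψ v (k (r x), e x)
  have hGs : ∀ v, ∀ x ∈ W, ContMDiffAt (𝓡 (2 * n + 1)) 𝓘(ℝ, ℝ) ∞ (G v) x := by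
    intro v x hx
    obtain ⟨h1, h2, h3, h4, -⟩ := hWs x hx
    have h5 : ContMDiffAt (𝓡 (2 * n + 1))
        𝓘(ℝ, EuclideanSpace ℝ (Fin n) × EuclideanSpace ℝ (Fin (2 * n + 1))) ∞
        (fun x ↦ (k (r x), e x)) x := by
      refine ContMDiffAt.prodMk_space ?_ (contMDiffAt_extChartAt' ?_)
      · refine ContMDiffAt.comp (g := k) (f := r) x (contMDiffAt_extChartAt' ?_) h2
        rwa [hk, extChartAt_source] at h3
      · rwa [he, extChartAt_source] at h1
    refine ContMDiffAt.comp (g := tangentHam Ω ψ v) (f := fun x ↦ (k (r x), e x)) x ?_ h5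
    rw [contMDiffAt_iff_contDiffAt]
    refine contDiffAt_tangentHam v (hψ _ h3 h4) (hΩ _ ?_) _
    simp only [ψ]
    rw [k.left_inv h3]
    exact e.map_source h4
  let F : EuclideanSpace ℝ (Fin n) → M → ℝ := fun v x ↦ χ x * G v x
  have hFs : ∀ v, ContMDiff (𝓡 (2 * n + 1)) 𝓘(ℝ, ℝ) ∞ (F v) := by
    intro v x
    by_cases hx : x ∈ K
    · exact hχ.contMDiffAt.mul (hGs v x (hKW hx))
    · refine (contMDiffAt_const (c := (0 : ℝ))).congr_of_eventuallyEq ?_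
      filter_upwards [hK.isClosed.isOpen_compl.mem_nhds hx] with y hy
      simp only [F, hχK y hy, zero_mul]
  have hFK : ∀ v, ∀ x ∉ K, F v x = 0 := fun v x hx ↦ by simp only [F, hχK x hx, zero_mul]
  have hFf : ∀ v p, F v (f p) = 0 := by
    intro v p
    by_cases hx : f p ∈ K
    · obtain ⟨h1, h2, h3, h4, h5⟩ := hWs _ (hKW hx)
      rw [h5 p rfl] at h3
      simp only [F, G, tangentHam, h5 p rfl, ψ]
      rw [k.left_inv h3]
      simp
    · exact hFK v _ hx
  have hFd : ∀ v, ∀ y ∈ k.target, f (k.symm y) ∈ W' → ∀ w,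
      differential (F v) (f (k.symm y)) w = -dForm α (f (k.symm y))
        (mfderiv (𝓡 n) (𝓡 (2 * n + 1)) f (k.symm y)
          (mfderiv 𝓘(ℝ, EuclideanSpace ℝ (Fin n)) (𝓡 n) k.symm y v)) w := by
    intro v y hy hyW w
    obtain ⟨h1, h2, h3, h4, h5⟩ := hWs _ (hW's _ hyW).2
    have hrp := h5 _ rfl
    have hky : k (k.symm y) = y := k.right_inv hy
    have hfx : HasMFDerivAt (𝓡 n) (𝓡 (2 * n + 1)) f (k.symm y)
        (mfderiv (𝓡 n) (𝓡 (2 * n + 1)) f (k.symm y)) :=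
      (hf.contMDiff.mdifferentiableAt (by simp)).hasMFDerivAt
    let B : EuclideanSpace ℝ (Fin (2 * n + 1)) →L[ℝ] EuclideanSpace ℝ (Fin (2 * n + 1)) :=
      mfderiv (𝓡 (2 * n + 1)) 𝓘(ℝ, EuclideanSpace ℝ (Fin (2 * n + 1))) e (f (k.symm y))
    have hB : HasMFDerivAt (𝓡 (2 * n + 1)) 𝓘(ℝ, EuclideanSpace ℝ (Fin (2 * n + 1))) e
        (f (k.symm y)) B := (mdifferentiableAt_extChartAt (by
          rwa [he, extChartAt_source] at h1)).hasMFDerivAt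
    let U : EuclideanSpace ℝ (Fin n) →L[ℝ] EuclideanSpace ℝ (Fin (2 * n + 1)) :=
      (mfderiv (𝓡 n) (𝓡 (2 * n + 1)) f (k.symm y)).comp
        (mfderiv 𝓘(ℝ, EuclideanSpace ℝ (Fin n)) (𝓡 n) k.symm y)
    have hψd : fderiv ℝ ψ y = B.comp U := by
      have h6 : HasFDerivAt ψ (B.comp U) y := hasMFDerivAt_iff_hasFDerivAt.1
        (HasMFDerivAt.comp (g := e) (f := fun y ↦ f (k.symm y)) y hB
          (hfx.comp y (hasMFDerivAt_extChartAt_symm (I := 𝓡 n) hy)))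
      exact h6.fderiv
    have hD : ∀ u u' : EuclideanSpace ℝ (Fin (2 * n + 1)),
        Ω (ψ y) (B u) (B u') - Ω (ψ y) (B u') (B u) = dForm α (f (k.symm y)) u u' := by
      intro u u'
      have h6 := hα.dForm_extChartAt_symm (e.map_source h1) (B u) (B u')
      refine h6.symm.trans ?_
      have h7 : symmDeriv (n := n) x₀ (e (f (k.symm y))) (B u) = u :=
        mfderiv_extChartAt_symm_comp h1 u
      have h8 : symmDeriv (n := n) x₀ (e (f (k.symm y))) (B u') = u' :=
        mfderiv_extChartAt_symm_comp h1 u'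
      refine (congrArg₂ (fun a b : EuclideanSpace ℝ (Fin (2 * n + 1)) ↦
        dForm α (e.symm (e (f (k.symm y))))
          (show TangentSpace (𝓡 (2 * n + 1)) (e.symm (e (f (k.symm y)))) from a)
          (show TangentSpace (𝓡 (2 * n + 1)) (e.symm (e (f (k.symm y)))) from b)) h7 h8).trans ?_
      exact dForm_congr (e.left_inv h1) u u'
    have hr' : MDifferentiableAt (𝓡 (2 * n + 1)) (𝓡 n) r (f (k.symm y)) :=
      h2.mdifferentiableAt (by simp)
    have hkr : MDifferentiableAt (𝓡 (2 * n + 1)) 𝓘(ℝ, EuclideanSpace ℝ (Fin n))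
        (fun x ↦ k (r x)) (f (k.symm y)) := by
      refine MDifferentiableAt.comp (g := k) (f := r) _ (mdifferentiableAt_extChartAt ?_) hr'
      rwa [hk, extChartAt_source] at h3
    let A : EuclideanSpace ℝ (Fin (2 * n + 1)) →L[ℝ] EuclideanSpace ℝ (Fin n) :=
      mfderiv (𝓡 (2 * n + 1)) 𝓘(ℝ, EuclideanSpace ℝ (Fin n)) (fun x ↦ k (r x)) (f (k.symm y))
    have hψy := hψ (k.symm y) (k.map_target hy) h1
    have hΩy : ContDiffAt ℝ ∞ Ω (ψ y) := hΩ _ (e.map_source h1)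
    rw [hky] at hψy
    have hfd := fderiv_tangentHam v hψy hΩy (A w) (B w)
    have hT : HasFDerivAt (tangentHam Ω ψ v) (fderiv ℝ (tangentHam Ω ψ v) (y, ψ y))
        (k (r (f (k.symm y))), e (f (k.symm y))) := by
      rw [hrp, hky]
      exact ((contDiffAt_tangentHam v hψy hΩy _).differentiableAt (by simp)).hasFDerivAt
    have hpair : HasMFDerivAt (𝓡 (2 * n + 1))
        𝓘(ℝ, EuclideanSpace ℝ (Fin n) × EuclideanSpace ℝ (Fin (2 * n + 1)))
        (fun x ↦ (k (r x), e x)) (f (k.symm y)) (A.prod B) :=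
      ⟨hkr.hasMFDerivAt.1.prodMk hB.1, hkr.hasMFDerivAt.2.prodMk hB.2⟩
    have hGd : HasMFDerivAt (𝓡 (2 * n + 1)) 𝓘(ℝ, ℝ) (F v) (f (k.symm y))
        ((fderiv ℝ (tangentHam Ω ψ v) (y, ψ y)).comp (A.prod B)) := by
      refine (HasMFDerivAt.comp (g := tangentHam Ω ψ v) (f := fun x ↦ (k (r x), e x))
        (f (k.symm y)) hT.hasMFDerivAt
        hpair).congr_of_eventuallyEq ?_
      filter_upwards [hW'o.mem_nhds hyW] with x hx
      simp only [F, (hW's x hx).1, one_mul]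
      rfl
    rw [differential, hGd.mfderiv]
    change fderiv ℝ (tangentHam Ω ψ v) (y, ψ y) (A w, B w) = -dForm α (f (k.symm y)) (U v) w
    -- The differential pairs B w minus its component U(A w) along f with U v. That component
    -- contributes nothing because f is isotropic.
    rw [hfd, hψd]
    refine Eq.trans ?_ (congrArg Neg.neg (hD (U v) w))
    have h9 := hD (U v) (U (A w))
    have h10 : dForm α (f (k.symm y)) (U v) (U (A w)) = 0 := hf.dForm_mfderiv hα _ _ _
    rw [h10] at h9
    simp only [ContinuousLinearMap.comp_apply, map_sub, sub_apply]
    linarith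
  have hnear : ∀ᶠ y in 𝓝 (k p₀), y ∈ k.target ∧ f (k.symm y) ∈ W' := by
    have h1 := continuousAt_extChartAt_symm (I := 𝓡 n) p₀
    refine Filter.Eventually.and (hkT.mem_nhds (mem_extChartAt_target (I := 𝓡 n) p₀)) ?_
    refine (hfc.continuousAt.comp h1).eventually ?_
    simp only [Function.comp, ← hk]
    rw [k.left_inv (mem_extChartAt_source (I := 𝓡 n) p₀)]
    exact hW'o.mem_nhds hxW'
  obtain ⟨δ, hδ, hball⟩ := Metric.eventually_nhds_iff_ball.1 hnear
  filter_upwards [(continuousAt_extChartAt (I := 𝓡 n) p₀).eventually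
    (Metric.ball_mem_nhds _ hδ), extChartAt_source_mem_nhds (I := 𝓡 n) p₀] with p hp hps
  rw [← hk] at hp hps
  let σ := Real.smoothTransition
  have hσ : ContDiff ℝ ∞ σ := Real.smoothTransition.contDiff
  have hσ' : ContDiff ℝ ∞ (deriv σ) := (contDiff_infty_iff_deriv.1 hσ).2
  let v := k p - k p₀
  have hseg : ∀ t, k p₀ + σ t • v ∈ Metric.ball (k p₀) δ := fun t ↦
    (convex_ball (k p₀) δ).add_smul_sub_mem (Metric.mem_ball_self hδ) hp
      ⟨Real.smoothTransition.nonneg t, Real.smoothTransition.le_one t⟩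
  -- The time factor σ' makes the orbit of f p₀ run along the coordinate segment k p₀ + σ(t) v,
  -- which ends at k p. It also gives compact support in time.
  let H : ℝ → M → ℝ := fun t x ↦ deriv σ t * F v x
  have hH : ContMDiff (𝓘(ℝ, ℝ).prod (𝓡 (2 * n + 1))) 𝓘(ℝ, ℝ) ∞ (fun q : ℝ × M ↦ H q.1 q.2) :=
    (hσ'.contMDiff.comp contMDiff_fst).mul ((hFs v).comp contMDiff_snd)
  have hHa : ∀ t, 1 < |t| → ∀ x, H t x = 0 := fun t ht x ↦ by
    simp only [H, σ, deriv_smoothTransition_eq_zero_of_abs ht, zero_mul]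
  obtain ⟨φ, hφ, hφ0, hφv⟩ := hα.exists_contactFlow hH hK (a := 1)
    (fun t x hx ↦ by simp only [H, hFK v x hx, mul_zero]) hHa
  have hvel : ∀ t p, velocity (n := n) (fun _ : ℝ ↦ f) t p = 0 := fun t p ↦ by
    rw [velocity, mfderiv_const]; rfl
  refine ⟨φ 1, hφ.reparam contDiff_const, ?_, ?_⟩
  -- The flow follows the constant isotopy, because H vanishes along f.
  · exact hα.image_flow_eq_range (l := fun _ ↦ f) (hf.contMDiff.comp contMDiff_snd) (fun _ ↦ hf)
      (a := 1) (fun t _ p ↦ hvel t p) hH hHa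
      (fun t p ↦ by rw [hvel, map_zero]; simp only [H, hFf, mul_zero]) hφ.contMDiff hφ0 hφv 1
  · have key : (fun t ↦ φ t (f p₀)) = fun t ↦ f (k.symm (k p₀ + σ t • v)) := by
      refine eq_of_hasMFDerivAt_timeDependent (I := 𝓡 (2 * n + 1))
        (X := fun t x ↦ hamField α (H t) x) (t₀ := 0) (hα.contMDiff_hamField hH) (fun t ↦ ?_)
        (fun t ↦ ?_) ?_
      · exact hasMFDerivAt_of_velocity (hasMFDerivAt_family_fst
          (hφ.contMDiff.mdifferentiableAt (by simp))).mdifferentiableAt (hφv t _)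
      · obtain ⟨h1, h2⟩ := hball _ (hseg t)
        have h3 : HasDerivAt (fun t ↦ k p₀ + σ t • v) (deriv σ t • v) t :=
          ((hσ.differentiable (by simp) t).hasDerivAt.smul_const v).const_add _
        have h4 := HasMFDerivAt.comp (f := fun t ↦ k p₀ + σ t • v) t
          (HasMFDerivAt.comp (k p₀ + σ t • v)
            (hf.contMDiff.mdifferentiableAt (by simp)).hasMFDerivAt
            (hasMFDerivAt_extChartAt_symm (I := 𝓡 n) h1)) h3.hasFDerivAt.hasMFDerivAt
        let U : EuclideanSpace ℝ (Fin n) →L[ℝ] EuclideanSpace ℝ (Fin (2 * n + 1)) :=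
          (mfderiv (𝓡 n) (𝓡 (2 * n + 1)) f (k.symm (k p₀ + σ t • v))).comp
            (mfderiv 𝓘(ℝ, EuclideanSpace ℝ (Fin n)) (𝓡 n) k.symm (k p₀ + σ t • v))
        have h5 : deriv σ t • U v = hamField α (H t) (f (k.symm (k p₀ + σ t • v))) := by
          refine hα.hamField_eq_of_forall ?_ fun w _ ↦ ?_
          · have h6 : α (f (k.symm (k p₀ + σ t • v))) (U v) = 0 := hf.isotropic _ _
            refine (map_smul (α (f (k.symm (k p₀ + σ t • v)))) _ _).trans ?_
            rw [h6]
            simp only [H, hFf, mul_zero, smul_zero]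
          · have h6 : HasMFDerivAt (𝓡 (2 * n + 1)) 𝓘(ℝ, ℝ) (H t)
                (f (k.symm (k p₀ + σ t • v)))
                (deriv σ t • differential (F v) (f (k.symm (k p₀ + σ t • v)))) :=
              ((hFs v).mdifferentiable (by simp) _).hasMFDerivAt.const_smul (deriv σ t)
            have h7 := hFd v _ h1 h2 w
            rw [differential, h6.mfderiv]
            refine (dForm_smul_left _ _ (U v) w).trans ?_
            have h8 : dForm α (f (k.symm (k p₀ + σ t • v))) (U v) w =
              -differential (F v) (f (k.symm (k p₀ + σ t • v))) w := by
              rw [h7, neg_neg]; rfl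
            rw [h8, mul_neg]
            rfl
        refine h4.congr_mfderiv (ContinuousLinearMap.ext fun (s : ℝ) ↦ ?_)
        rw [← h5]
        change U (s • deriv σ t • v) = s • deriv σ t • U v
        rw [map_smul, map_smul]
      · simp only [hφ0, σ, Real.smoothTransition.zero, zero_smul, add_zero]
        rw [k.left_inv (mem_extChartAt_source (I := 𝓡 n) p₀)]
    have h1 := congrFun key 1
    simp only [σ, Real.smoothTransition.one, one_smul, v, add_sub_cancel] at h1
    rw [k.left_inv hps] at h1
    exact h1

/-- By local transitivity and the existence of inverses, orbits are open with open complement, so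
connectedness of Λ leaves one orbit. -/
theorem IsLegendrianEmbedding.exists_contactomorphism [ConnectedSpace Λ] (hα : IsContactForm α)
    {f : Λ → M} (hf : IsLegendrianEmbedding α f) (p q : Λ) : ∃ g : M → M,
      IsPosPath α (fun _ ↦ g) ∧ g '' range f = range f ∧ g (f p) = f q := by
  let S : Set Λ := {q | ∃ g : M → M,
      IsPosPath α (fun _ ↦ g) ∧ g '' range f = range f ∧ g (f p) = f q}
  have hopen : IsOpen S := by
    rw [isOpen_iff_mem_nhds]
    rintro q ⟨g, hg, hgf, hgq⟩
    filter_upwards [hf.eventually_exists_contactomorphism hα q] with q' ⟨g', hg', hgf', hgq'⟩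
    refine ⟨fun x ↦ g' (g x), hg'.comp hg, ?_, (congrArg g' hgq).trans hgq'⟩
    rw [← image_image, hgf, hgf']
  have hclosed : IsClosed S := by
    rw [← isOpen_compl_iff, isOpen_iff_mem_nhds]
    intro q hq
    filter_upwards [hf.eventually_exists_contactomorphism hα q] with q' ⟨g', hg', hgf', hgq'⟩
    rintro ⟨g, hg, hgf, hgq⟩
    obtain ⟨i, hi, hi1, hi2⟩ := hg'.exists_inverse 0
    refine hq ⟨fun x ↦ i (g x), hi.comp hg, ?_,
      (congrArg i (hgq.trans hgq'.symm)).trans (hi1 _)⟩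
    rw [← image_image, hgf]
    nth_rewrite 1 [← hgf']
    rw [image_image]
    simp [hi1]
  have : S = univ := IsClopen.eq_univ ⟨hclosed, hopen⟩
    ⟨p, fun x ↦ x, isPosPath_id, by simp, rfl⟩
  exact (this ▸ mem_univ q : q ∈ S)

end Homogeneity

/-! ### Legendrian isotopies and finiteness of the distance. -/

section Isotopies

variable {n : ℕ} {M : Type*} [TopologicalSpace M] [T2Space M] [SecondCountableTopology M]
  [ChartedSpace (EuclideanSpace ℝ (Fin (2 * n + 1))) M] [IsManifold (𝓡 (2 * n + 1)) ∞ M]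
  {α : ∀ x : M, TangentSpace (𝓡 (2 * n + 1)) x →L[ℝ] ℝ}
  {Λ : Type*} [TopologicalSpace Λ] [CompactSpace Λ]
  [ChartedSpace (EuclideanSpace ℝ (Fin n)) Λ] [IsManifold (𝓡 n) ∞ Λ]

theorem IsLegendrianEmbedding.comp_contact {f : Λ → M} (hf : IsLegendrianEmbedding α f)
    {g : M → M} (hg : ∃ Φ : Diffeomorph (𝓡 (2 * n + 1)) (𝓡 (2 * n + 1)) M M ∞, ⇑Φ = g)
    (hc : ∀ (x : M) (v : TangentSpace (𝓡 (2 * n + 1)) x),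
      α (g x) (mfderiv (𝓡 (2 * n + 1)) (𝓡 (2 * n + 1)) g x v) = 0 ↔ α x v = 0) :
    IsLegendrianEmbedding α (fun p ↦ g (f p)) := by
  obtain ⟨Φ, rfl⟩ := hg
  have h : ∀ p, mfderiv (𝓡 n) (𝓡 (2 * n + 1)) (fun p ↦ Φ (f p)) p =
      (mfderiv (𝓡 (2 * n + 1)) (𝓡 (2 * n + 1)) Φ (f p)).comp
        (mfderiv (𝓡 n) (𝓡 (2 * n + 1)) f p) := fun p ↦
    mfderiv_comp p (Φ.contMDiff.mdifferentiableAt (by simp))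
      (hf.contMDiff.mdifferentiableAt (by simp))
  refine ⟨Φ.contMDiff.comp hf.contMDiff, Φ.toHomeomorph.isEmbedding.comp hf.isEmbedding,
    fun p ↦ ?_, fun p v ↦ ?_⟩
  · rw [h]
    exact (Φ.mfderivToContinuousLinearEquiv (by simp) (f p)).injective.comp (hf.immersion p)
  · rw [h]
    exact (hc _ _).2 (hf.isotropic p v)

theorem IsLegendrianIsotopy.reparam {l : ℝ → Λ → M} (hl : IsLegendrianIsotopy α l) {θ : ℝ → ℝ}
    (hθ : ContDiff ℝ ∞ θ) (hθ' : ∀ t ∈ Icc (0 : ℝ) 1, θ t ∈ Icc (0 : ℝ) 1) :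
    IsLegendrianIsotopy α (fun t ↦ l (θ t)) :=
  ⟨hl.contMDiff.comp ((hθ.contMDiff.comp contMDiff_fst).prodMk contMDiff_snd),
    fun t ht ↦ hl.legendrian _ (hθ' t ht)⟩

theorem IsContactPath.comp_embedding {φ : ℝ → M → M} (hφ : IsContactPath α φ) {f : Λ → M}
    (hf : IsLegendrianEmbedding α f) : IsLegendrianIsotopy α (fun t p ↦ φ t (f p)) :=
  ⟨hφ.contMDiff.comp (contMDiff_fst.prodMk (hf.contMDiff.comp contMDiff_snd)),
    fun t ht ↦ hf.comp_contact (hφ.diffeo t ht) (hφ.contact t ht)⟩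

theorem IsPosPath.comp_isotopy {φ : ℝ → M → M} (hφ : IsPosPath α φ) {l : ℝ → Λ → M}
    (hl : IsLegendrianIsotopy α l) : IsLegendrianIsotopy α (fun t p ↦ φ t (l t p)) :=
  ⟨hφ.contMDiff.comp (contMDiff_fst.prodMk hl.contMDiff), fun t ht ↦
    (hl.legendrian t ht).comp_contact (hφ.diffeo t) (hφ.isContactPath.contact t ht)⟩

/-- Concatenation of Legendrian isotopies. -/
theorem IsContactForm.exists_isotopy_trans (hα : IsContactForm α) {l m : ℝ → Λ → M}
    (hl : IsLegendrianIsotopy α l) (hm : IsLegendrianIsotopy α m)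
    (h : range (l 1) = range (m 0)) : ∃ k : ℝ → Λ → M, IsLegendrianIsotopy α k ∧
      range (k 0) = range (l 0) ∧ range (k 1) = range (m 1) ∧
      ((∀ t ∈ Icc (0 : ℝ) 1, ∀ p, 0 ≤ α (l t p) (velocity l t p)) →
        (∀ t ∈ Icc (0 : ℝ) 1, ∀ p, 0 ≤ α (m t p) (velocity m t p)) →
        ∀ t ∈ Icc (0 : ℝ) 1, ∀ p, 0 ≤ α (k t p) (velocity k t p)) := by
  obtain ⟨φ, hφ, hφ0, hφ1, hφpos⟩ := hα.exists_posPath_of_isotopy hm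
  -- The two isotopies run simultaneously, φ_t ∘ l_t with φ carrying m. This has the right end and
  -- avoids smoothing at a junction.
  refine ⟨_, hφ.comp_isotopy hl, by simp [hφ0], ?_, fun hlp hmp t ht p ↦ ?_⟩
  · rw [← hφ1, ← h, ← range_comp]
    rfl
  · have := hφ.form_velocity_comp hα hl.contMDiff (hasDerivAt_id t) p
    simp only [id, one_mul] at this
    rw [this]
    exact add_nonneg (hφpos hmp _ _)
      (mul_nonneg (hφ.conformalFactor_pos hα _ _).le (hlp t ht p))

theorem exists_embedding_of_mem_isotopyClass {L L₀ : Set M} (h : L₀ ∈ isotopyClass Λ α L) :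
    ∃ f : Λ → M, IsLegendrianEmbedding α f ∧ range f = L₀ := by
  obtain ⟨l, hl, -, h1⟩ := h
  exact ⟨l 1, hl.legendrian 1 (by simp), h1⟩

theorem IsContactForm.exists_isotopy_of_mem_isotopyClass (hα : IsContactForm α) {L L₀ L₁ : Set M}
    (h₀ : L₀ ∈ isotopyClass Λ α L) (h₁ : L₁ ∈ isotopyClass Λ α L) :
    ∃ l : ℝ → Λ → M, IsLegendrianIsotopy α l ∧ range (l 0) = L₀ ∧ range (l 1) = L₁ := by
  obtain ⟨l, hl, hl0, hl1⟩ := h₀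
  obtain ⟨m, hm, hm0, hm1⟩ := h₁
  have hr : ContDiff ℝ ∞ (fun t : ℝ ↦ 1 - t) := by fun_prop
  obtain ⟨k, hk, hk0, hk1, -⟩ := hα.exists_isotopy_trans
    (hl.reparam hr fun t ht ↦ ⟨by linarith [ht.2], by linarith [ht.1]⟩) hm
    (by rw [hm0, ← hl0]; norm_num)
  exact ⟨k, hk, by rw [hk0, ← hl1]; norm_num, hk1.trans hm1⟩

theorem IsContactForm.mem_isotopyClass_of_isotopy (hα : IsContactForm α) {L L₀ L₁ : Set M}
    (h₀ : L₀ ∈ isotopyClass Λ α L) {l : ℝ → Λ → M} (hl : IsLegendrianIsotopy α l)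
    (hl0 : range (l 0) = L₀) (hl1 : range (l 1) = L₁) : L₁ ∈ isotopyClass Λ α L := by
  obtain ⟨m, hm, hm0, hm1⟩ := h₀
  obtain ⟨k, hk, hk0, hk1, -⟩ := hα.exists_isotopy_trans hm hl (by rw [hm1, hl0])
  exact ⟨k, hk, hk0.trans hm0, hk1.trans hl1⟩

/-- Curves in a Legendrian submanifold are annihilated by the contact form. -/
theorem IsLegendrianEmbedding.form_curve_eq_zero {f : Λ → M} (hf : IsLegendrianEmbedding α f)
    {c : ℝ → M} {t₀ : ℝ} (hc : MDifferentiableAt 𝓘(ℝ, ℝ) (𝓡 (2 * n + 1)) c t₀)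
    (h : ∀ᶠ t in 𝓝 t₀, c t ∈ range f) :
    α (c t₀) (mfderiv 𝓘(ℝ, ℝ) (𝓡 (2 * n + 1)) c t₀ (1 : ℝ)) = 0 := by
  obtain ⟨p₀, hp₀⟩ := h.self_of_nhds
  obtain ⟨r₀, hr₀, hr₀l⟩ := exists_local_leftInverse (l := fun _ : ℝ ↦ f) (t₀ := 0)
    (hf.contMDiff.comp contMDiff_snd) (hf.immersion p₀)
  have hr : MDifferentiableAt (𝓡 (2 * n + 1)) (𝓡 n) (r₀ 0) (c t₀) := by
    rw [← hp₀]
    exact (hasMFDerivAt_family_snd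
      (hr₀.self_of_nhds.mdifferentiableAt (by simp))).mdifferentiableAt
  have hrl : ∀ᶠ x in 𝓝 (c t₀), ∀ p, f p = x → r₀ 0 (f p) = p := by
    have h1 : ∀ᶠ p in 𝓝 p₀, r₀ 0 (f p) = p :=
      (Continuous.prodMk_right (0 : ℝ)).continuousAt.eventually hr₀l
    rw [hf.isEmbedding.isInducing.nhds_eq_comap, Filter.eventually_comap, hp₀] at h1
    exact h1
  -- Via the local left inverse, c is locally f composed with a curve in Λ, so its velocity is a
  -- tangent vector of the Legendrian.
  have h1 : c =ᶠ[𝓝 t₀] fun t ↦ f (r₀ 0 (c t)) := by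
    filter_upwards [h, hc.continuousAt.eventually hrl] with t ⟨p, hp⟩ ht
    rw [← hp, ht p hp]
  have h2 := HasMFDerivAt.comp (g := f) (f := fun t ↦ r₀ 0 (c t)) t₀
    (hf.contMDiff.mdifferentiableAt (by simp)).hasMFDerivAt
    (HasMFDerivAt.comp (f := c) t₀ hr.hasMFDerivAt hc.hasMFDerivAt)
  have h3 : mfderiv 𝓘(ℝ, ℝ) (𝓡 (2 * n + 1)) c t₀ =
    mfderiv 𝓘(ℝ, ℝ) (𝓡 (2 * n + 1)) (fun t ↦ f (r₀ 0 (c t))) t₀ := h1.mfderiv_eq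
  have h4 : mfderiv 𝓘(ℝ, ℝ) (𝓡 (2 * n + 1)) (fun t ↦ f (r₀ 0 (c t))) t₀ = _ := h2.mfderiv
  rw [h3, h4]
  refine (form_congr h1.self_of_nhds _).trans ?_
  exact hf.isotropic (r₀ 0 (c t₀)) _

/-- In an orderable class, non-negative loops are tangent to the submanifolds. -/
theorem IsOrderable.form_velocity_eq_zero {L : Set M}
    (ho : IsOrderable Λ α (isotopyClass Λ α L)) (hα : IsContactForm α) {L₀ : Set M}
    (hL₀ : L₀ ∈ isotopyClass Λ α L) {ζ : ℝ → M → M} (hζ : IsContactPath α ζ)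
    (hζ0 : ζ 0 '' L₀ = L₀) (hζ1 : ζ 1 '' L₀ = L₀)
    (hpos : ∀ t ∈ Icc (0 : ℝ) 1, ∀ x ∈ L₀, 0 ≤ α (ζ t x) (velocity ζ t x)) :
    ∀ t ∈ Ioo (0 : ℝ) 1, ∀ x ∈ L₀, α (ζ t x) (velocity ζ t x) = 0 := by
  obtain ⟨f, hf, rfl⟩ := exists_embedding_of_mem_isotopyClass hL₀
  let l : ℝ → Λ → M := fun t p ↦ ζ t (f p)
  have hl : IsLegendrianIsotopy α l := hζ.comp_embedding hf
  have hlpos : ∀ t ∈ Icc (0 : ℝ) 1, ∀ p, 0 ≤ α (l t p) (velocity l t p) :=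
    fun t ht p ↦ hpos t ht _ (mem_range_self p)
  have hrange : ∀ t, range (l t) = ζ t '' range f := fun t ↦ by rw [← range_comp]; rfl
  have hsub : ∀ a b : ℝ, a ∈ Icc (0 : ℝ) 1 → b ∈ Icc (0 : ℝ) 1 → a ≤ b →
      NonnegRel Λ α (range (l a)) (range (l b)) ∧
        IsLegendrianIsotopy α (fun t ↦ l (a + t * (b - a))) := by
    intro a b ha hb hab
    have hs : ContDiff ℝ ∞ (fun t : ℝ ↦ a + t * (b - a)) := by fun_prop
    have hm : ∀ t ∈ Icc (0 : ℝ) 1, a + t * (b - a) ∈ Icc (0 : ℝ) 1 := fun t ht ↦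
      ⟨by nlinarith [ha.1, ht.1], by nlinarith [ht.2, hb.2]⟩
    have hi := hl.reparam hs hm
    refine ⟨⟨_, hi, by simp, by simp, fun t ht p ↦ ?_⟩, hi⟩
    have hd : HasDerivAt (fun t : ℝ ↦ a + t * (b - a)) (b - a) t := by
      simpa using ((hasDerivAt_id t).mul_const (b - a)).const_add a
    rw [velocity_reparam hl.contMDiff hd p, map_smul, smul_eq_mul]
    exact mul_nonneg (sub_nonneg.2 hab) (hlpos _ (hm t ht) p)
  -- The two halves of the loop give L₀ ≼ L_s ≼ L₀, and antisymmetry makes the image constant.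
  have hconst : ∀ s ∈ Icc (0 : ℝ) 1, range (l s) = range f := by
    intro s hs
    have h1 := hsub 0 s (by simp) hs hs.1
    have h2 := hsub s 1 hs (by simp) hs.2
    have h0 : range (l 0) = range f := by rw [hrange, hζ0]
    have h1' : range (l 1) = range f := by rw [hrange, hζ1]
    have hmem : range (l s) ∈ isotopyClass Λ α L :=
      hα.mem_isotopyClass_of_isotopy hL₀ h1.2 (by simp [h0]) (by simp)
    have := ho.toAntisymm.antisymm (⟨range f, hL₀⟩ : isotopyClass Λ α L) ⟨range (l s), hmem⟩
      (by have := h1.1; rwa [h0] at this) (by have := h2.1; rwa [h1'] at this)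
    exact (congrArg Subtype.val this).symm
  rintro t ht _ ⟨p, rfl⟩
  refine hf.form_curve_eq_zero (c := fun s ↦ ζ s (f p)) ?_ ?_
  · exact (hasMFDerivAt_family_fst (hζ.contMDiff.mdifferentiableAt (by simp))).mdifferentiableAt
  · filter_upwards [isOpen_Ioo.mem_nhds ht] with s hs
    rw [← hconst s ⟨hs.1.le, hs.2.le⟩]
    exact ⟨p, rfl⟩

/-- A smooth function with small slope and prescribed increment. -/
theorem exists_smooth_slope_le {m : ℝ → ℝ} (hm : Continuous m)
    (hpos : ∀ t ∈ Icc (0 : ℝ) 1, 0 ≤ m t) {T : ℝ} (hT : 0 ≤ T) (hTm : T < ∫ t in (0 : ℝ)..1, m t) :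
    ∃ s : ℝ → ℝ, ContDiff ℝ ∞ s ∧ s 0 = 0 ∧ s 1 = T ∧
      ∀ t ∈ Icc (0 : ℝ) 1, 0 ≤ deriv s t ∧ deriv s t ≤ m t ∧ s t ∈ Icc 0 T := by
  let ε := ((∫ t in (0 : ℝ)..1, m t) - T) / 2
  have hε : 0 < ε := by simp only [ε]; linarith
  -- With ε half the excess of ∫ m over T, a smooth g between m - 2ε and max(m, 0) has integral at
  -- least T. Rescaling by c ≤ 1 makes it exactly T.
  obtain ⟨g, hg⟩ := exists_contMDiffMap_forall_mem_convex_of_local_const 𝓘(ℝ, ℝ) (M := ℝ)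
    (n := (⊤ : ℕ∞)) (t := fun t ↦ {y : ℝ | 0 ≤ y ∧ y ≤ max (m t) 0 ∧ m t - 2 * ε ≤ y})
    (fun t a ha b hb c d hc hd hcd ↦ ⟨by have := ha.1; have := hb.1; positivity, by
      have h1 := mul_le_mul_of_nonneg_left ha.2.1 hc
      have h2 := mul_le_mul_of_nonneg_left hb.2.1 hd
      have h3 : c * max (m t) 0 + d * max (m t) 0 = max (m t) 0 := by rw [← add_mul, hcd, one_mul]
      simp only [smul_eq_mul]
      linarith, by
      have h1 := mul_le_mul_of_nonneg_left ha.2.2 hc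
      have h2 := mul_le_mul_of_nonneg_left hb.2.2 hd
      have h3 : c * (m t - 2 * ε) + d * (m t - 2 * ε) = m t - 2 * ε := by
        rw [← add_mul, hcd, one_mul]
      simp only [smul_eq_mul]
      linarith⟩) (fun t ↦ by
    by_cases h : ε < m t
    · refine ⟨m t - ε, ?_⟩
      have h1 : ∀ᶠ y in 𝓝 t, m y ∈ Ioo (m t - ε) (m t + ε) :=
        hm.continuousAt.eventually (Ioo_mem_nhds (by linarith) (by linarith))
      filter_upwards [h1] with y hy
      exact ⟨by linarith, le_max_of_le_left hy.1.le, by linarith [hy.2]⟩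
    · refine ⟨0, ?_⟩
      have h1 : ∀ᶠ y in 𝓝 t, m y < 2 * ε := hm.continuousAt.eventually (gt_mem_nhds (by linarith))
      filter_upwards [h1] with y hy
      exact ⟨le_rfl, le_max_right _ _, by linarith⟩)
  have hgs : ContDiff ℝ ∞ g := contMDiff_iff_contDiff.1 g.contMDiff
  have hint : T ≤ ∫ t in (0 : ℝ)..1, g t := by
    have h1 : ∫ t in (0 : ℝ)..1, (m t - 2 * ε) ≤ ∫ t in (0 : ℝ)..1, g t :=
      intervalIntegral.integral_mono_on zero_le_one
        ((hm.sub continuous_const).intervalIntegrable _ _)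
        (hgs.continuous.intervalIntegrable _ _) fun t _ ↦ (hg t).2.2
    rw [intervalIntegral.integral_sub (hm.intervalIntegrable _ _)
      (continuous_const.intervalIntegrable _ _)] at h1
    simp only [intervalIntegral.integral_const, ε] at h1
    simp at h1
    linarith
  let A := ∫ t in (0 : ℝ)..1, g t
  have hc : ∃ c : ℝ, 0 ≤ c ∧ c ≤ 1 ∧ c * A = T := by
    rcases hT.eq_or_lt with h | h
    · exact ⟨0, le_rfl, zero_le_one, by rw [zero_mul, h]⟩
    · have hA : 0 < A := h.trans_le hint
      exact ⟨T / A, by positivity, (div_le_one hA).2 hint, div_mul_cancel₀ _ hA.ne'⟩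
  obtain ⟨c, hc0, hc1, hcA⟩ := hc
  let s : ℝ → ℝ := fun t ↦ c * ∫ u in (0 : ℝ)..t, g u
  have hs : ∀ t, HasDerivAt s (c * g t) t := fun t ↦
    (intervalIntegral.integral_hasDerivAt_right (hgs.continuous.intervalIntegrable _ _)
        (hgs.continuous.stronglyMeasurableAtFilter _ _) hgs.continuous.continuousAt).const_mul c
  have hds : deriv s = fun t ↦ c * g t := funext fun t ↦ (hs t).deriv
  have hmono : Monotone s := monotone_of_deriv_nonneg (fun t ↦ (hs t).differentiableAt)
    fun t ↦ by rw [hds]; exact mul_nonneg hc0 (hg t).1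
  have hs0 : s 0 = 0 := by simp [s]
  have hs1 : s 1 = T := hcA
  refine ⟨s, contDiff_infty_iff_deriv.2 ⟨fun t ↦ (hs t).differentiableAt, ?_⟩, hs0, hs1,
    fun t ht ↦ ⟨?_, ?_, hs0 ▸ hmono ht.1, hs1 ▸ hmono ht.2⟩⟩
  · rw [hds]
    exact contDiff_const.mul hgs
  · rw [hds]; exact mul_nonneg hc0 (hg t).1
  · rw [hds]
    have h1 := (hg t).2.1
    rw [max_eq_left (hpos t ht)] at h1
    nlinarith [(hg t).1]

theorem continuous_iInf_form_velocity (hα : IsContactForm α) {φ : ℝ → M → M}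
    (hφ : ContMDiff (𝓘(ℝ, ℝ).prod (𝓡 (2 * n + 1))) (𝓡 (2 * n + 1)) ∞
      (fun q : ℝ × M ↦ φ q.1 q.2)) {K : Set M} (hK : IsCompact K) :
    Continuous (fun t ↦ ⨅ p : K, α (φ t p) (velocity φ t (p : M))) := by
  have h := hK.continuous_sInf (f := fun t x ↦ α (φ t x) (velocity φ t x))
    (hα.contMDiff_form_velocity hφ).continuous
  simpa only [sInf_image'] using h

theorem iInf_form_velocity_le (hα : IsContactForm α) {φ : ℝ → M → M}
    (hφ : ContMDiff (𝓘(ℝ, ℝ).prod (𝓡 (2 * n + 1))) (𝓡 (2 * n + 1)) ∞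
      (fun q : ℝ × M ↦ φ q.1 q.2)) {K : Set M} (hK : IsCompact K) (t : ℝ) {x : M} (hx : x ∈ K) :
    ⨅ p : K, α (φ t p) (velocity φ t (p : M)) ≤ α (φ t x) (velocity φ t x) := by
  have h1 : Continuous fun x ↦ α (φ t x) (velocity φ t x) :=
    (hα.contMDiff_form_velocity hφ).continuous.comp (Continuous.prodMk_right t)
  have h2 := (hK.image h1).bddBelow
  refine ciInf_le (f := fun p : K ↦ α (φ t p) (velocity φ t (p : M))) ?_ ⟨x, hx⟩
  rwa [image_eq_range] at h2

variable [Nonempty Λ]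

theorem IsOrderable.lorentzianDistance_lt_top {L : Set M}
    (ho : IsOrderable Λ α (isotopyClass Λ α L)) (hα : IsContactForm α) {L₀ L₁ : Set M}
    (hL₀ : L₀ ∈ isotopyClass Λ α L) (hL₁ : L₁ ∈ isotopyClass Λ α L) :
    lorentzianDistance Λ α L₀ L₁ < ⊤ := by
  rw [lorentzianDistance]
  split_ifs
  swap
  · exact ENNReal.zero_lt_top
  obtain ⟨f, hf, hfL⟩ := exists_embedding_of_mem_isotopyClass hL₀
  have hK : IsCompact L₀ := hfL ▸ isCompact_range hf.contMDiff.continuous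
  obtain ⟨l, hl, hl0, hl1⟩ := hα.exists_isotopy_of_mem_isotopyClass hL₁ hL₀
  obtain ⟨ψ, hψ, hψ0, hψ1, -⟩ := hα.exists_posPath_of_isotopy hl
  rw [hl0, hl1] at hψ1
  obtain ⟨κ, hκ, c, hc, hb⟩ := hψ.exists_bounds hα 0 1
  -- The bound depends only on the fixed return isotopy ψ, not on the competitor φ.
  refine (?_ : _ ≤ ENNReal.ofReal (κ / c)).trans_lt ENNReal.ofReal_lt_top
  refine iSup_le fun φ ↦ iSup_le fun hφ ↦ iSup_le fun hpos ↦ iSup_le fun hφ0 ↦ iSup_le fun hφ1 ↦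
    ENNReal.ofReal_le_ofReal ?_
  by_contra! hlt
  have hmc := continuous_iInf_form_velocity hα hφ.contMDiff hK
  have hmle := fun t x hx ↦ iInf_form_velocity_le hα hφ.contMDiff hK t (x := x) hx
  set m : ℝ → ℝ := fun t ↦ ⨅ p : L₀, α (φ t p) (velocity φ t (p : M)) with hm
  have hne : Nonempty L₀ := by rw [← hfL]; infer_instance
  have hm0 : ∀ t ∈ Icc (0 : ℝ) 1, 0 ≤ m t := fun t ht ↦ le_ciInf fun p ↦ hpos t ht p
  have hT : 0 < κ / c := div_pos hκ hc
  obtain ⟨s, hs, hs0, hs1, hsd⟩ := exists_smooth_slope_le hmc hm0 hT.le hlt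
  -- With this scaling the return motion costs at most κ θ' = c s', while φ gains at least c m.
  let θ : ℝ → ℝ := fun t ↦ s t / (κ / c)
  have hθ : ContDiff ℝ ∞ θ := hs.div_const _
  have hθd : ∀ t, HasDerivAt θ (deriv s t / (κ / c)) t := fun t ↦
    (hs.differentiable (by simp) t).hasDerivAt.div_const _
  have hζ := hψ.comp_contactPath hφ hθ
  have hkey : ∀ t ∈ Icc (0 : ℝ) 1, ∀ x ∈ L₀, c * (m t - deriv s t) ≤
      α (ψ (θ t) (φ t x)) (velocity (n := n) (fun t x ↦ ψ (θ t) (φ t x)) t x) := by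
    intro t ht x hx
    obtain ⟨h1, h2, h3⟩ := hsd t ht
    have hθt : θ t ∈ Icc (0 : ℝ) 1 := ⟨div_nonneg h3.1 hT.le, (div_le_one hT).2 h3.2⟩
    rw [hψ.form_velocity_comp hα hφ.contMDiff (hθd t) x]
    obtain ⟨h4, h5⟩ := hb _ hθt (φ t x)
    have h6 : deriv s t / (κ / c) * -κ ≤
        deriv s t / (κ / c) * α (ψ (θ t) (φ t x)) (velocity ψ (θ t) (φ t x)) :=
      mul_le_mul_of_nonneg_left (neg_le_of_abs_le h4) (div_nonneg h1 hT.le)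
    have h7 : c * m t ≤ conformalFactor α (ψ (θ t)) (φ t x) * α (φ t x) (velocity φ t x) :=
      mul_le_mul h5 (hmle t x hx) (hm0 t ht) (hc.le.trans h5)
    have h8 : deriv s t / (κ / c) * -κ = -(c * deriv s t) := by field_simp
    linarith
  have hzero := ho.form_velocity_eq_zero hα hL₀ hζ (by
      simp only [θ, hs0, zero_div, hψ0, hφ0]) (by
      have h1 : θ 1 = 1 := by simp only [θ, hs1]; exact div_self hT.ne'
      rw [h1, ← image_image (ψ 1) (φ 1), hφ1, hψ1]) (fun t ht x hx ↦
      (mul_nonneg hc.le (sub_nonneg.2 (hsd t ht).2.1)).trans (hkey t ht x hx))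
  -- Vanishing of the loop's speed turns the lower bound c(m - s') into m ≤ s'. It is known only on
  -- the open interval, which suffices for the integral.
  have hle : ∫ t in (0 : ℝ)..1, m t ≤ ∫ t in (0 : ℝ)..1, deriv s t := by
    refine intervalIntegral.integral_mono_on_of_le_Ioo zero_le_one (hmc.intervalIntegrable _ _)
      ((hs.continuous_deriv (by simp)).intervalIntegrable _ _) fun t ht ↦ ?_
    obtain ⟨x, hx⟩ := hne
    have h1 := hkey t ⟨ht.1.le, ht.2.le⟩ x hx
    rw [hzero t ht x hx] at h1
    nlinarith
  rw [intervalIntegral.integral_deriv_eq_sub (fun t _ ↦ hs.differentiable (by simp) t)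
    ((hs.continuous_deriv (by simp)).intervalIntegrable _ _), hs0, hs1, sub_zero] at hle
  exact absurd hlt (not_lt.2 hle)

end Isotopies

/-! ### Non-negative loops and infinite distance. -/

section Loops

variable {n : ℕ} {M : Type*} [TopologicalSpace M] [T2Space M] [SecondCountableTopology M]
  [ChartedSpace (EuclideanSpace ℝ (Fin (2 * n + 1))) M] [IsManifold (𝓡 (2 * n + 1)) ∞ M]
  {α : ∀ x : M, TangentSpace (𝓡 (2 * n + 1)) x →L[ℝ] ℝ}
  {Λ : Type*} [TopologicalSpace Λ] [CompactSpace Λ]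
  [ChartedSpace (EuclideanSpace ℝ (Fin n)) Λ] [IsManifold (𝓡 n) ∞ Λ]

theorem conformalFactor_id (hα : IsContactForm α) {g : M → M} (hg : ∀ x, g x = x) (x : M) :
    conformalFactor α g x = 1 := by
  obtain rfl : g = id := funext hg
  rw [conformalFactor, mfderiv_id]
  exact (hα.isReebVector_reebField x).1

theorem form_velocity_const (g : M → M) (t : ℝ) (x : M) :
    α (g x) (velocity (n := n) (fun _ ↦ g) t x) = 0 := by
  rw [velocity, mfderiv_const]
  exact map_zero (α (g x))

theorem form_velocity_reparam {φ : ℝ → M → M}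
    (hφ : ContMDiff (𝓘(ℝ, ℝ).prod (𝓡 (2 * n + 1))) (𝓡 (2 * n + 1)) ∞
      (fun q : ℝ × M ↦ φ q.1 q.2)) {θ : ℝ → ℝ} {θ' t : ℝ} (hθ : HasDerivAt θ θ' t) (x : M) :
    α (φ (θ t) x) (velocity (n := n) (fun t ↦ φ (θ t)) t x) =
      θ' * α (φ (θ t) x) (velocity φ (θ t) x) := by
  rw [velocity_reparam hφ hθ x, map_smul, smul_eq_mul]

theorem IsPosPath.form_velocity_comp_self {φ ψ : ℝ → M → M} (hψ : IsPosPath α ψ)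
    (hφ : IsPosPath α φ) (hα : IsContactForm α) (t : ℝ) (x : M) :
    α (ψ t (φ t x)) (velocity (n := n) (fun t x ↦ ψ t (φ t x)) t x) =
      α (ψ t (φ t x)) (velocity ψ t (φ t x)) +
        conformalFactor α (ψ t) (φ t x) * α (φ t x) (velocity φ t x) := by
  have h := hψ.form_velocity_comp hα hφ.contMDiff (hasDerivAt_id t) x
  rwa [one_mul] at h

/-- A non-negative contact isotopy whose time-one map preserves `S`. -/
structure IsNonnegLoop (α : ∀ x : M, TangentSpace (𝓡 (2 * n + 1)) x →L[ℝ] ℝ) (S : Set M)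
    (φ : ℝ → M → M) : Prop where
  isPosPath : IsPosPath α φ
  zero : ∀ x, φ 0 x = x
  one : φ 1 '' S = S
  nonneg : ∀ t x, 0 ≤ α (φ t x) (velocity φ t x)

variable {S : Set M} {φ ψ : ℝ → M → M}

theorem isNonnegLoop_id : IsNonnegLoop α S (fun _ x ↦ x) :=
  ⟨isPosPath_id, fun _ ↦ rfl, image_id' S, fun t x ↦ (form_velocity_const (fun x : M ↦ x) t x).ge⟩

theorem IsNonnegLoop.comp (hψ : IsNonnegLoop α S ψ) (hφ : IsNonnegLoop α S φ)
    (hα : IsContactForm α) : IsNonnegLoop α S (fun t x ↦ ψ t (φ t x)) where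
  isPosPath := hψ.isPosPath.comp hφ.isPosPath
  zero x := by rw [hφ.zero, hψ.zero]
  one := by rw [← image_image (ψ 1) (φ 1), hφ.one, hψ.one]
  nonneg t x := by
    rw [hψ.isPosPath.form_velocity_comp_self hφ.isPosPath hα]
    exact add_nonneg (hψ.nonneg _ _)
      (mul_nonneg (hψ.isPosPath.conformalFactor_pos hα _ _).le (hφ.nonneg _ _))

theorem IsNonnegLoop.comp_pos (hψ : IsNonnegLoop α S ψ) (hφ : IsNonnegLoop α S φ)
    (hα : IsContactForm α) {x : M}
    (h : 0 < α (ψ 0 x) (velocity ψ 0 x) ∨ 0 < α (φ 0 x) (velocity φ 0 x)) :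
    0 < α (ψ 0 (φ 0 x)) (velocity (n := n) (fun t x ↦ ψ t (φ t x)) 0 x) := by
  rw [hψ.isPosPath.form_velocity_comp_self hφ.isPosPath hα]
  have hf := hψ.isPosPath.conformalFactor_pos hα 0 (φ 0 x)
  rcases h with h | h
  · refine add_pos_of_pos_of_nonneg ?_ (mul_nonneg hf.le (hφ.nonneg _ _))
    rwa [hφ.zero]
  · exact add_pos_of_nonneg_of_pos (hψ.nonneg _ _) (mul_pos hf h)

/-- Conjugating a non-negative loop by a contactomorphism which preserves the submanifold. -/
theorem IsNonnegLoop.exists_conj (hφ : IsNonnegLoop α S φ) (hα : IsContactForm α) {g : M → M}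
    (hg : IsPosPath α (fun _ ↦ g)) (hgS : g '' S = S) {x : M}
    (hx : 0 < α (φ 0 (g x)) (velocity φ 0 (g x))) :
    ∃ ψ, IsNonnegLoop α S ψ ∧ 0 < α (ψ 0 x) (velocity ψ 0 x) := by
  obtain ⟨i, hi, hig, hgi⟩ := hg.exists_inverse 0
  have hiS : i '' S = S := by
    nth_rewrite 1 [← hgS]
    rw [image_image]
    simp [hig]
  have h1 := hφ.isPosPath.comp hg
  have hv : ∀ t x, α (i (φ t (g x))) (velocity (n := n) (fun t x ↦ i (φ t (g x))) t x) =
      conformalFactor α i (φ t (g x)) * α (φ t (g x)) (velocity φ t (g x)) := by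
    intro t x
    rw [hi.form_velocity_comp_self h1 hα, form_velocity_const, zero_add,
      hφ.isPosPath.form_velocity_comp_self hg hα, form_velocity_const, mul_zero, add_zero]
  refine ⟨fun t x ↦ i (φ t (g x)), ⟨hi.comp h1, fun x ↦ by rw [hφ.zero, hig], ?_, fun t x ↦ ?_⟩, ?_⟩
  · rw [← image_image (fun y ↦ i (φ 1 y)) g, hgS, ← image_image i (φ 1), hφ.one, hiS]
  · rw [hv]
    exact mul_nonneg (hi.conformalFactor_pos hα t _).le (hφ.nonneg _ _)
  · rw [hv]
    exact mul_pos (hi.conformalFactor_pos hα 0 _) hx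

/-- The concatenation of two non-negative loops. -/
theorem IsNonnegLoop.exists_concat (hψ : IsNonnegLoop α S ψ) (hφ : IsNonnegLoop α S φ)
    (hα : IsContactForm α) (hS : IsCompact S) (hS' : S.Nonempty) :
    ∃ χ, IsNonnegLoop α S χ ∧
      (∫ t in (0 : ℝ)..1, ⨅ p : S, α (φ t p) (velocity φ t (p : M))) +
        (∫ t in (0 : ℝ)..1, ⨅ p : S, α (ψ t p) (velocity ψ t (p : M))) ≤
      ∫ t in (0 : ℝ)..1, ⨅ p : S, α (χ t p) (velocity χ t (p : M)) := by
  have hne : Nonempty S := hS'.to_subtype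
  let σ := Real.smoothTransition
  have hσ : ContDiff ℝ ∞ σ := Real.smoothTransition.contDiff
  -- φ is completed by time 1/3 and ψ starts only at 2/3, so at every instant at most one of them
  -- moves.
  let θ : ℝ → ℝ := fun t ↦ σ (3 * t)
  let η : ℝ → ℝ := fun t ↦ σ (3 * t - 2)
  have hθ : ContDiff ℝ ∞ θ := hσ.comp (by fun_prop)
  have hη : ContDiff ℝ ∞ η := hσ.comp (by fun_prop)
  let θ' : ℝ → ℝ := fun t ↦ deriv σ (3 * t) * 3
  let η' : ℝ → ℝ := fun t ↦ deriv σ (3 * t - 2) * 3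
  have hσd : ∀ t, HasDerivAt σ (deriv σ t) t := fun t ↦
    (hσ.differentiable (by simp) t).hasDerivAt
  have hθd : ∀ t, HasDerivAt θ (θ' t) t := fun t ↦
    (hσd (3 * t)).comp t (by simpa using (hasDerivAt_id t).const_mul 3)
  have hηd : ∀ t, HasDerivAt η (η' t) t := fun t ↦
    HasDerivAt.comp (h := fun t ↦ 3 * t - 2) t (hσd (3 * t - 2))
      (by simpa using ((hasDerivAt_id t).const_mul (3 : ℝ)).sub_const 2)
  have hσ'c : Continuous (deriv σ) := hσ.continuous_deriv (by simp)
  have hθ'c : Continuous θ' := by fun_prop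
  have hη'c : Continuous η' := by fun_prop
  have hθ'0 : ∀ t, 0 ≤ θ' t := fun t ↦
    mul_nonneg Real.smoothTransition.monotone.deriv_nonneg (by norm_num)
  have hη'0 : ∀ t, 0 ≤ η' t := fun t ↦
    mul_nonneg Real.smoothTransition.monotone.deriv_nonneg (by norm_num)
  have hP := (hψ.isPosPath.reparam hη)
  have hQ := (hφ.isPosPath.reparam hθ)
  have hv : ∀ t x, α (ψ (η t) (φ (θ t) x))
      (velocity (n := n) (fun t x ↦ ψ (η t) (φ (θ t) x)) t x) =
      η' t * α (ψ (η t) (φ (θ t) x)) (velocity ψ (η t) (φ (θ t) x)) +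
      conformalFactor α (ψ (η t)) (φ (θ t) x) *
        (θ' t * α (φ (θ t) x) (velocity φ (θ t) x)) := by
    intro t x
    rw [hP.form_velocity_comp_self hQ hα, form_velocity_reparam hψ.isPosPath.contMDiff (hηd t),
      form_velocity_reparam hφ.isPosPath.contMDiff (hθd t)]
  have hχ : IsNonnegLoop α S (fun t x ↦ ψ (η t) (φ (θ t) x)) := by
    refine ⟨hP.comp hQ, fun x ↦ ?_, ?_, fun t x ↦ ?_⟩
    · have h1 : η 0 = 0 := Real.smoothTransition.zero_of_nonpos (by norm_num)
      have h2 : θ 0 = 0 := Real.smoothTransition.zero_of_nonpos (by norm_num)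
      rw [h1, h2, hφ.zero, hψ.zero]
    · have h1 : η 1 = 1 := Real.smoothTransition.one_of_one_le (by norm_num)
      have h2 : θ 1 = 1 := Real.smoothTransition.one_of_one_le (by norm_num)
      rw [h1, h2, ← image_image (ψ 1) (φ 1), hφ.one, hψ.one]
    · rw [hv]
      exact add_nonneg (mul_nonneg (hη'0 t) (hψ.nonneg _ _))
        (mul_nonneg (hψ.isPosPath.conformalFactor_pos hα _ _).le
          (mul_nonneg (hθ'0 t) (hφ.nonneg _ _)))
  refine ⟨_, hχ, ?_⟩
  have hmφ := continuous_iInf_form_velocity hα hφ.isPosPath.contMDiff hS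
  have hmψ := continuous_iInf_form_velocity hα hψ.isPosPath.contMDiff hS
  have hmχ := continuous_iInf_form_velocity (φ := fun t x ↦ ψ (η t) (φ (θ t) x)) hα hχ.isPosPath.contMDiff hS
  have hleφ := fun t x hx ↦ iInf_form_velocity_le hα hφ.isPosPath.contMDiff hS t (x := x) hx
  have hleψ := fun t x hx ↦ iInf_form_velocity_le hα hψ.isPosPath.contMDiff hS t (x := x) hx
  set a : ℝ → ℝ := fun t ↦ ⨅ p : S, α (φ t p) (velocity φ t (p : M))
  set b : ℝ → ℝ := fun t ↦ ⨅ p : S, α (ψ t p) (velocity ψ t (p : M))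
  have hsub : ∀ (ρ ρ' u : ℝ → ℝ), (∀ t, HasDerivAt ρ (ρ' t) t) → Continuous ρ' → Continuous u →
      ρ 0 = 0 → ρ 1 = 1 → ∫ t in (0 : ℝ)..1, u t = ∫ t in (0 : ℝ)..1, u (ρ t) * ρ' t := by
    intro ρ ρ' u h1 h2 h3 h4 h5
    have := intervalIntegral.integral_comp_mul_deriv (a := 0) (b := 1) (g := u)
      (fun t _ ↦ h1 t) h2.continuousOn h3
    rw [h4, h5] at this
    exact this.symm
  rw [hsub θ θ' a hθd hθ'c hmφ (Real.smoothTransition.zero_of_nonpos (by norm_num))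
    (Real.smoothTransition.one_of_one_le (by norm_num)),
    hsub η η' b hηd hη'c hmψ (Real.smoothTransition.zero_of_nonpos (by norm_num))
    (Real.smoothTransition.one_of_one_le (by norm_num))]
  have hc1 : Continuous fun t ↦ a (θ t) * θ' t := (hmφ.comp hθ.continuous).mul hθ'c
  have hc2 : Continuous fun t ↦ b (η t) * η' t := (hmψ.comp hη.continuous).mul hη'c
  rw [← intervalIntegral.integral_add (hc1.intervalIntegrable _ _) (hc2.intervalIntegrable _ _)]
  refine intervalIntegral.integral_mono_on zero_le_one ((hc1.add hc2).intervalIntegrable _ _)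
    (hmχ.intervalIntegrable _ _) fun t _ ↦ le_ciInf fun ⟨x, hx⟩ ↦ ?_
  rw [hv]
  -- In the first half ψ is the identity with factor 1. In the second half φ rests at time 1 and
  -- maps S to itself, so the minimum of ψ over S applies.
  rcases le_total t (1 / 2) with ht | ht
  · have h1 : η t = 0 := Real.smoothTransition.zero_of_nonpos (by linarith)
    have h2 : η' t = 0 := by
      simp only [η', σ, deriv_smoothTransition_eq_zero (Or.inl (show 3 * t - 2 < 0 by linarith)),
        zero_mul]
    rw [h1, h2, conformalFactor_id hα hψ.zero, zero_mul, mul_zero, zero_add, one_mul, add_zero,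
      mul_comm]
    exact mul_le_mul_of_nonneg_left (hleφ _ x hx) (hθ'0 t)
  · have h1 : θ t = 1 := Real.smoothTransition.one_of_one_le (by linarith)
    have h2 : θ' t = 0 := by
      simp only [θ', σ, deriv_smoothTransition_eq_zero (Or.inr (show 1 < 3 * t by linarith)),
        zero_mul]
    have h3 : φ 1 x ∈ S := by rw [← hφ.one]; exact mem_image_of_mem _ hx
    rw [h1, h2, zero_mul, mul_zero, mul_zero, zero_add, add_zero, mul_comm]
    exact mul_le_mul_of_nonneg_left (hleψ _ _ h3) (hη'0 t)

theorem IsContactPath.nonnegRel {φ : ℝ → M → M} (hφ : IsContactPath α φ) {L₀ L₁ : Set M}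
    {f : Λ → M} (hf : IsLegendrianEmbedding α f) (hfL : range f = L₀)
    (h0 : φ 0 '' L₀ = L₀) (h1 : φ 1 '' L₀ = L₁)
    (hpos : ∀ t ∈ Icc (0 : ℝ) 1, ∀ x ∈ L₀, 0 ≤ α (φ t x) (velocity φ t x)) :
    NonnegRel Λ α L₀ L₁ := by
  refine ⟨_, hφ.comp_embedding hf, ?_, ?_, fun t ht p ↦ hpos t ht _ (hfL ▸ mem_range_self p)⟩
  · rw [← h0, ← hfL, ← range_comp]; rfl
  · rw [← h1, ← hfL, ← range_comp]; rfl

theorem IsPosPath.ofReal_integral_le {φ : ℝ → M → M} (hφ : IsPosPath α φ) {L₀ L₁ : Set M}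
    {f : Λ → M} (hf : IsLegendrianEmbedding α f) (hfL : range f = L₀)
    (h0 : ∀ x, φ 0 x = x) (h1 : φ 1 '' L₀ = L₁)
    (hpos : ∀ t ∈ Icc (0 : ℝ) 1, ∀ x, 0 ≤ α (φ t x) (velocity φ t x)) :
    ENNReal.ofReal (∫ t in (0 : ℝ)..1, ⨅ p : L₀, α (φ t p) (velocity φ t (p : M))) ≤
      lorentzianDistance Λ α L₀ L₁ := by
  have h0' : φ 0 '' L₀ = L₀ := by simp [h0]
  rw [lorentzianDistance, if_pos (hφ.isContactPath.nonnegRel hf hfL h0' h1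
    fun t ht x _ ↦ hpos t ht x)]
  exact le_iSup_of_le φ (le_iSup_of_le hφ.isContactPath (le_iSup_of_le hpos
    (le_iSup_of_le h0' (le_iSup_of_le h1 le_rfl))))

/-- A non-negative loop which is positive at time zero forces the Lorentzian distance to be
infinite. -/
theorem IsNonnegLoop.lorentzianDistance_eq_top (hφ : IsNonnegLoop α S φ) (hα : IsContactForm α)
    [Nonempty Λ] {f : Λ → M} (hf : IsLegendrianEmbedding α f) (hfS : range f = S)
    (hpos : ∀ x ∈ S, 0 < α (φ 0 x) (velocity φ 0 x)) : lorentzianDistance Λ α S S = ⊤ := by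
  have hS : IsCompact S := hfS ▸ isCompact_range hf.contMDiff.continuous
  have hS' : S.Nonempty := hfS ▸ range_nonempty f
  have hne : Nonempty S := hS'.to_subtype
  have hm := continuous_iInf_form_velocity hα hφ.isPosPath.contMDiff hS
  set I := ∫ t in (0 : ℝ)..1, ⨅ p : S, α (φ t p) (velocity φ t (p : M))
  have hI : 0 < I := by
    refine intervalIntegral.integral_pos one_pos hm.continuousOn
      -- Compactness of S makes the minimum at time 0 positive, and continuity then makes the whole
      -- integral positive.
      (fun t _ ↦ le_ciInf fun p ↦ hφ.nonneg t p) ⟨0, by simp, ?_⟩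
    have hc : Continuous fun x ↦ α (φ 0 x) (velocity φ 0 x) :=
      (hα.contMDiff_form_velocity hφ.isPosPath.contMDiff).continuous.comp
        (Continuous.prodMk_right (0 : ℝ))
    obtain ⟨x, hx, hmin⟩ := hS.exists_isMinOn hS' hc.continuousOn
    exact (hpos x hx).trans_le (le_ciInf fun p ↦ hmin p.2)
  have hk : ∀ k : ℕ, ∃ ψ, IsNonnegLoop α S ψ ∧
      k * I ≤ ∫ t in (0 : ℝ)..1, ⨅ p : S, α (ψ t p) (velocity ψ t (p : M)) := by
    intro k
    induction k with
    | zero =>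
      refine ⟨φ, hφ, ?_⟩
      rw [Nat.cast_zero, zero_mul]
      exact hI.le
    | succ k ih =>
      obtain ⟨ψ, hψ, hkψ⟩ := ih
      obtain ⟨χ, hχ, hle⟩ := hψ.exists_concat hφ hα hS hS'
      refine ⟨χ, hχ, le_trans ?_ hle⟩
      push_cast
      linarith
  by_contra hne
  obtain ⟨k, hk'⟩ := exists_nat_gt ((lorentzianDistance Λ α S S).toReal / I)
  obtain ⟨ψ, hψ, hle⟩ := hk k
  have h1 := (ENNReal.ofReal_le_ofReal hle).trans (hψ.isPosPath.ofReal_integral_le hf hfS hψ.zero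
    hψ.one fun t _ ↦ hψ.nonneg t)
  rw [ENNReal.ofReal_le_iff_le_toReal hne] at h1
  rw [div_lt_iff₀ hI] at hk'
  linarith

variable [ConnectedSpace Λ]

/-- Positivity of a loop at one point can be spread over the whole submanifold. -/
theorem IsNonnegLoop.exists_pos (hφ : IsNonnegLoop α S φ) (hα : IsContactForm α)
    {f : Λ → M} (hf : IsLegendrianEmbedding α f) (hfS : range f = S) {x₀ : M} (hx₀ : x₀ ∈ S)
    (hpos : 0 < α (φ 0 x₀) (velocity φ 0 x₀)) :
    ∃ ψ, IsNonnegLoop α S ψ ∧ ∀ x ∈ S, 0 < α (ψ 0 x) (velocity ψ 0 x) := by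
  have hS : IsCompact S := hfS ▸ isCompact_range hf.contMDiff.continuous
  -- Composing loops keeps the positive points of both, so positivity near each point, obtained by
  -- conjugation, spreads over S by compactness.
  refine hS.induction_on (p := fun T ↦ ∃ ψ, IsNonnegLoop α S ψ ∧
    ∀ x ∈ T, 0 < α (ψ 0 x) (velocity ψ 0 x)) ⟨_, isNonnegLoop_id, by simp⟩ ?_ ?_ ?_
  · rintro T T' hTT' ⟨ψ, hψ, h⟩
    exact ⟨ψ, hψ, fun x hx ↦ h x (hTT' hx)⟩
  · rintro T T' ⟨ψ, hψ, h⟩ ⟨ψ', hψ', h'⟩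
    exact ⟨_, hψ.comp hψ' hα, fun x hx ↦ hψ.comp_pos hψ' hα (hx.imp (h x) (h' x))⟩
  · intro x hx
    rw [← hfS] at hx hx₀
    obtain ⟨p, rfl⟩ := hx
    obtain ⟨p₀, rfl⟩ := hx₀
    obtain ⟨g, hg, hgf, hgp⟩ := hf.exists_contactomorphism hα p p₀
    rw [hfS] at hgf
    obtain ⟨ψ, hψ, hψp⟩ := hφ.exists_conj hα hg hgf (x := f p) (by rwa [hgp])
    have hc : Continuous fun x ↦ α (ψ 0 x) (velocity ψ 0 x) :=
      (hα.contMDiff_form_velocity hψ.isPosPath.contMDiff).continuous.comp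
        (Continuous.prodMk_right (0 : ℝ))
    exact ⟨{x | 0 < α (ψ 0 x) (velocity ψ 0 x)}, mem_nhdsWithin_of_mem_nhds
      ((isOpen_lt continuous_const hc).mem_nhds hψp), ψ, hψ, fun x hx ↦ hx⟩

/-- Two distinct Legendrian submanifolds with `L₀ ≼ L₁ ≼ L₀` give a non-trivial loop. -/
theorem IsContactForm.exists_loop (hα : IsContactForm α) {L L₀ L₁ : Set M}
    (hL₀ : L₀ ∈ isotopyClass Λ α L) (h01 : NonnegRel Λ α L₀ L₁) (h10 : NonnegRel Λ α L₁ L₀)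
    (hne : L₀ ≠ L₁) : ∃ S ∈ isotopyClass Λ α L, ∃ φ, IsNonnegLoop α S φ ∧
      ∃ x ∈ S, 0 < α (φ 0 x) (velocity φ 0 x) := by
  obtain ⟨l, hl, rfl, rfl, hlpos⟩ := h01
  obtain ⟨m, hm, hm0, hm1, hmpos⟩ := h10
  obtain ⟨φ, hφ, hφ0, hφ1, hφpos⟩ := hα.exists_posPath_of_isotopy hl
  obtain ⟨ψ, hψ, hψ0, hψ1, hψpos⟩ := hα.exists_posPath_of_isotopy hm
  rw [hm0, hm1] at hψ1
  replace hφpos := hφpos hlpos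
  replace hψpos := hψpos hmpos
  have hf := hl.legendrian 0 (by simp)
  set f := l 0
  have hk : IsLegendrianIsotopy α (fun t p ↦ φ t (f p)) := hφ.isContactPath.comp_embedding hf
  -- If the speed vanished identically, the image would not move. The time is taken below 1, by
  -- density, since the loop built below starts with speed scaled by 1 - t₁.
  obtain ⟨t₁, ht₁, p₁, hpos⟩ : ∃ t ∈ Ico (0 : ℝ) 1, ∃ p,
      0 < α (φ t (f p)) (velocity φ t (f p)) := by
    obtain ⟨t, ht, p, h⟩ : ∃ t ∈ Icc (0 : ℝ) 1, ∃ p,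
        α (φ t (f p)) (velocity φ t (f p)) ≠ 0 := by
      by_contra! h
      refine hne ?_
      have h1 := hα.range_eq_of_form_velocity_eq_zero hk h
      have h2 : range (fun p ↦ φ 1 (f p)) = φ 1 '' range f := by rw [← range_comp]; rfl
      rw [h2, hφ1] at h1
      simpa only [hφ0] using h1
    have hc : Continuous fun t ↦ α (φ t (f p)) (velocity φ t (f p)) :=
      (hα.contMDiff_form_velocity hφ.contMDiff).continuous.comp (Continuous.prodMk_left (f p))
    rw [← closure_Ico zero_ne_one] at ht
    obtain ⟨t', h1, h2⟩ := mem_closure_iff.1 ht _ (isOpen_lt continuous_const hc)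
      ((hφpos t (f p)).lt_of_ne' h)
    exact ⟨t', h2, p, h1⟩
  obtain ⟨i, hi, hiφ, hφi⟩ := hφ.exists_inverse t₁
  let S := φ t₁ '' range f
  have hiS : i '' S = range f := by simp only [S, image_image, hiφ, image_id']
  have hθ : ContDiff ℝ ∞ (fun t : ℝ ↦ t₁ * t) := by fun_prop
  have hη : ContDiff ℝ ∞ (fun t : ℝ ↦ t₁ + (1 - t₁) * t) := by fun_prop
  have hθd : ∀ t, HasDerivAt (fun t : ℝ ↦ t₁ * t) t₁ t := fun t ↦ by
    simpa using (hasDerivAt_id t).const_mul t₁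
  have hηd : ∀ t, HasDerivAt (fun t : ℝ ↦ t₁ + (1 - t₁) * t) (1 - t₁) t := fun t ↦ by
    simpa using ((hasDerivAt_id t).const_mul (1 - t₁)).const_add t₁
  -- The loop is based at S = φ_{t₁}(L₀) and composes three motions run in parallel: from S on to L₁
  -- (C), from L₁ back to L₀ (ψ), and from L₀ up to S (A). At time 0 it is the identity and C moves
  -- φ_{t₁}(f p₁) positively.
  have hA := hφ.reparam hθ
  have hC := (hφ.reparam hη).comp hi
  have hB := hψ.comp hC
  have hv : ∀ t x, 0 ≤ α (φ (t₁ * t) (ψ t (φ (t₁ + (1 - t₁) * t) (i x))))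
        (velocity (n := n) (fun t x ↦ φ (t₁ * t) (ψ t (φ (t₁ + (1 - t₁) * t) (i x)))) t x) ∧
      (0 < α (φ (t₁ + (1 - t₁) * t) (i x)) (velocity φ (t₁ + (1 - t₁) * t) (i x)) →
      0 < α (φ (t₁ * t) (ψ t (φ (t₁ + (1 - t₁) * t) (i x))))
        (velocity (n := n) (fun t x ↦ φ (t₁ * t) (ψ t (φ (t₁ + (1 - t₁) * t) (i x)))) t x)) := by
    intro t x
    rw [hA.form_velocity_comp_self hB hα, form_velocity_reparam hφ.contMDiff (hθd t),
      hψ.form_velocity_comp_self hC hα, (hφ.reparam hη).form_velocity_comp_self hi hα,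
      form_velocity_reparam hφ.contMDiff (hηd t), form_velocity_const, mul_zero, add_zero]
    have h1 := hφ.conformalFactor_pos hα (t₁ * t) (ψ t (φ (t₁ + (1 - t₁) * t) (i x)))
    have h2 := hψ.conformalFactor_pos hα t (φ (t₁ + (1 - t₁) * t) (i x))
    have h3 := mul_nonneg ht₁.1
      (hφpos (t₁ * t) (ψ t (φ (t₁ + (1 - t₁) * t) (i x))))
    have h4 := hψpos t (φ (t₁ + (1 - t₁) * t) (i x))
    have h5 := hφpos (t₁ + (1 - t₁) * t) (i x)
    have h6 : 0 < 1 - t₁ := sub_pos.2 ht₁.2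
    refine ⟨by positivity, fun h7 ↦ ?_⟩
    have h8 := mul_pos h1 (add_pos_of_nonneg_of_pos h4 (mul_pos h2 (mul_pos h6 h7)))
    linarith
  refine ⟨S, ?_, _, ⟨hA.comp hB, fun x ↦ ?_, ?_, fun t x ↦ (hv t x).1⟩, φ t₁ (f p₁),
    ⟨f p₁, mem_range_self _, rfl⟩, ?_⟩
  · refine hα.mem_isotopyClass_of_isotopy hL₀
      (hA.isContactPath.comp_embedding hf) ?_ ?_
    · simp [hφ0]
    · simp only [mul_one, S, ← range_comp]
      rfl
  · simp only [mul_zero, add_zero, hφi, hψ0, hφ0]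
  · have h1 : (fun x ↦ φ (t₁ * 1) (ψ 1 (φ (t₁ + (1 - t₁) * 1) (i x)))) '' S =
        φ t₁ '' (ψ 1 '' (φ 1 '' (i '' S))) := by
      simp only [image_image, mul_one, add_sub_cancel]
    rw [h1, hiS, hφ1, hψ1]
  · refine (hv 0 _).2 ?_
    rw [hiφ, mul_zero, add_zero]
    exact hpos

/-- If the Lorentzian distance is finite, then the isotopy class is orderable. -/
theorem IsContactForm.isOrderable_of_lt_top (hα : IsContactForm α) {L : Set M}
    (h : ∀ L₀ ∈ isotopyClass Λ α L, lorentzianDistance Λ α L₀ L₀ < ⊤) :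
    IsOrderable Λ α (isotopyClass Λ α L) := by
  refine { refl := fun L₀ ↦ ?_, trans := fun L₀ L₁ L₂ h01 h12 ↦ ?_, antisymm := ?_ }
  · obtain ⟨f, hf, hfL⟩ := exists_embedding_of_mem_isotopyClass L₀.2
    exact isPosPath_id.isContactPath.nonnegRel hf hfL (image_id' _) (image_id' _)
      fun t _ x _ ↦ (form_velocity_const (fun x : M ↦ x) t x).ge
  · obtain ⟨l, hl, hl0, hl1, hlpos⟩ := h01
    obtain ⟨m, hm, hm0, hm1, hmpos⟩ := h12
    obtain ⟨k, hk, hk0, hk1, hkpos⟩ := hα.exists_isotopy_trans hl hm (hl1.trans hm0.symm)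
    exact ⟨k, hk, hk0.trans hl0, hk1.trans hm1, hkpos hlpos hmpos⟩
  · rintro ⟨L₀, hL₀⟩ ⟨L₁, hL₁⟩ h01 h10
    by_contra hne
    obtain ⟨S, hS, φ, hφ, x, hx, hpos⟩ := hα.exists_loop hL₀ h01 h10
      fun h ↦ hne (Subtype.ext h)
    obtain ⟨f, hf, hfS⟩ := exists_embedding_of_mem_isotopyClass hS
    obtain ⟨ψ, hψ, hψpos⟩ := hφ.exists_pos hα hf hfS hx hpos
    exact (h S hS).ne (hψ.lorentzianDistance_eq_top hα hf hfS hψpos)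

end Loops

/-! ### The Reeb flow and its Lorentzian distance. -/

section Reeb

variable {n : ℕ} {M : Type*} [TopologicalSpace M] [T2Space M] [SecondCountableTopology M]
  [ChartedSpace (EuclideanSpace ℝ (Fin (2 * n + 1))) M] [IsManifold (𝓡 (2 * n + 1)) ∞ M]
  {α : ∀ x : M, TangentSpace (𝓡 (2 * n + 1)) x →L[ℝ] ℝ}
  {Λ : Type*} [TopologicalSpace Λ] [CompactSpace Λ]
  [ChartedSpace (EuclideanSpace ℝ (Fin n)) Λ] [IsManifold (𝓡 n) ∞ Λ]

/-- `η` is the flow of the contact vector field of the smooth function `χ` with values in `[0, 1]`. -/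
structure IsContactFlow (α : ∀ x : M, TangentSpace (𝓡 (2 * n + 1)) x →L[ℝ] ℝ) (χ : M → ℝ)
    (η : ℝ → M → M) : Prop where
  contMDiff : ContMDiff (𝓡 (2 * n + 1)) 𝓘(ℝ, ℝ) ∞ χ
  nonneg : ∀ x, 0 ≤ χ x
  le_one : ∀ x, χ x ≤ 1
  isPosPath : IsPosPath α η
  zero : ∀ x, η 0 x = x
  add : ∀ s t x, η (s + t) x = η s (η t x)
  velocity : ∀ t x, velocity η t x = hamField α χ (η t x)

/-- The Reeb field need not be complete. The field of a cutoff Hamiltonian is complete and agrees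
with it near K. -/
theorem IsContactForm.exists_cutoff_reebFlow (hα : IsContactForm α) {K : Set M}
    (hK : IsCompact K) :
    ∃ (χ : M → ℝ) (η : ℝ → M → M), IsContactFlow α χ η ∧ (∀ x ∈ K, ∀ᶠ y in 𝓝 x, χ y = 1) ∧
      ∃ K', IsCompact K' ∧ ∀ x ∉ K', χ x = 0 := by
  obtain ⟨χ, hχ, hχ1, hχ0, hχle, K', -, hK', hχK'⟩ := exists_cutoff (n := n) hK isOpen_univ
    (subset_univ K)
  obtain ⟨η, h1, h2, h3, h4⟩ := hα.exists_autonomous_contactFlow hχ hK' hχK'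
  exact ⟨χ, η, ⟨hχ, hχ0, hχle, h1, h2, h3, h4⟩, eventually_nhdsSet_iff_forall.1 hχ1, K', hK', hχK'⟩

variable {χ : M → ℝ} {η : ℝ → M → M}

theorem IsContactFlow.isMIntegralCurve (h : IsContactFlow α χ η) (x : M) :
    IsMIntegralCurve (fun s ↦ η s x) (hamField α χ) := fun t ↦
  hasMFDerivAt_of_velocity (hasMFDerivAt_family_fst
    (h.isPosPath.contMDiff.mdifferentiableAt (by simp) (x := (t, x)))).mdifferentiableAt
    (h.velocity t x)

theorem IsContactFlow.continuous_curve (h : IsContactFlow α χ η) (x : M) :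
    Continuous (fun s ↦ η s x) :=
  h.isPosPath.contMDiff.continuous.comp (Continuous.prodMk_left x)

theorem IsContactFlow.form_velocity (h : IsContactFlow α χ η) (hα : IsContactForm α) (t : ℝ)
    (x : M) : α (η t x) (LegendrianOrder.velocity η t x) = χ (η t x) := by
  rw [h.velocity, hα.form_hamField]

/-- The orbits of the flow along which `χ = 1` are Reeb orbits. -/
theorem IsContactFlow.isMIntegralCurveOn_reebField (h : IsContactFlow α χ η)
    (hα : IsContactForm α) {x : M} {S : Set ℝ} (hS : ∀ s ∈ S, ∀ᶠ y in 𝓝 (η s x), χ y = 1) :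
    IsMIntegralCurveOn (fun s ↦ η s x) (reebField α) S := fun s hs ↦ by
  have h1 := (h.isMIntegralCurve x s).hasMFDerivWithinAt (s := S)
  rwa [hα.hamField_eq_reebField (hS s hs)] at h1

/-- Reeb orbits along which `χ = 1` are orbits of the flow. -/
theorem IsContactFlow.eqOn_of_reeb (h : IsContactFlow α χ η) (hα : IsContactForm α) {t : ℝ}
    {γ : ℝ → M} (hγ : IsMIntegralCurveOn γ (reebField α) (Icc 0 t))
    (hχ : ∀ s ∈ Icc 0 t, ∀ᶠ y in 𝓝 (γ s), χ y = 1) :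
    EqOn γ (fun s ↦ η s (γ 0)) (Icc 0 t) := by
  rcases lt_or_ge 0 t with ht | ht
  swap
  · intro s hs
    have : s = 0 := le_antisymm (hs.2.trans ht) hs.1
    rw [this]
    exact (h.zero _).symm
  have hγc : ContinuousOn γ (Icc 0 t) := fun s hs ↦ (hγ s hs).continuousWithinAt
  -- Uniqueness of integral curves is used on an open interval, so the comparison is anchored at the
  -- midpoint t/2. The end points follow by continuity.
  let c : ℝ → M := fun s ↦ η s (η (-(t / 2)) (γ (t / 2)))
  have hc : IsMIntegralCurve c (hamField α χ) := h.isMIntegralCurve _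
  have hcc : Continuous c := h.continuous_curve _
  have hX : ContMDiff (𝓡 (2 * n + 1)) (𝓡 (2 * n + 1)).tangent ∞
      (fun x : M ↦ (⟨x, hamField α χ x⟩ : TangentBundle (𝓡 (2 * n + 1)) M)) :=
    (hα.contMDiff_hamField (F := fun _ ↦ χ) (h.contMDiff.comp contMDiff_snd)).comp
      ((contMDiff_const (c := (0 : ℝ))).prodMk contMDiff_id)
  have hγ' : IsMIntegralCurveOn γ (hamField α χ) (Ioo 0 t) := fun s hs ↦ by
    have h1 := (hγ s (Ioo_subset_Icc_self hs)).mono Ioo_subset_Icc_self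
    rwa [← hα.hamField_eq_reebField (hχ s (Ioo_subset_Icc_self hs))] at h1
  have h1 : EqOn γ c (Ioo 0 t) := isMIntegralCurveOn_Ioo_eqOn_of_contMDiff_boundaryless
    (t₀ := t / 2) ⟨by positivity, by linarith⟩ (hX.of_le (by simp)) hγ'
    (hc.isMIntegralCurveOn _) (by simp only [c]; rw [← h.add, add_neg_cancel, h.zero])
  have h2 : EqOn γ c (Icc 0 t) := h1.of_subset_closure hγc hcc.continuousOn
    Ioo_subset_Icc_self (by rw [closure_Ioo ht.ne])
  intro s hs
  rw [h2 hs, h2 ⟨le_rfl, ht.le⟩]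
  simp only [c, ← h.add, zero_add]

/-- Finite-time Reeb orbits starting from a compact set can be chosen inside a compact set. -/
theorem IsContactForm.exists_compact_reeb (hα : IsContactForm α) {S : Set M} (hS : IsCompact S)
    {t : ℝ} (h : ReebFlowDefinedOn α t S) :
    ∃ K : Set M, IsCompact K ∧ ∀ p ∈ S, ∃ γ : ℝ → M, γ 0 = p ∧
      IsMIntegralCurveOn γ (reebField α) (Icc 0 t) ∧ ∀ s ∈ Icc 0 t, γ s ∈ K := by
  refine hS.induction_on (p := fun S' ↦ ∃ K : Set M, IsCompact K ∧ ∀ p ∈ S', ∃ γ : ℝ → M,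
    γ 0 = p ∧ IsMIntegralCurveOn γ (reebField α) (Icc 0 t) ∧ ∀ s ∈ Icc 0 t, γ s ∈ K)
    ⟨∅, isCompact_empty, by simp⟩ ?_ ?_ ?_
  · rintro S₁ S₂ h12 ⟨K, hK, hS₂⟩
    exact ⟨K, hK, fun p hp ↦ hS₂ p (h12 hp)⟩
  · rintro S₁ S₂ ⟨K₁, hK₁, h1⟩ ⟨K₂, hK₂, h2⟩
    refine ⟨K₁ ∪ K₂, hK₁.union hK₂, fun p hp ↦ ?_⟩
    rcases hp with hp | hp
    · obtain ⟨γ, hγ0, hγ, hγK⟩ := h1 p hp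
      exact ⟨γ, hγ0, hγ, fun s hs ↦ Or.inl (hγK s hs)⟩
    · obtain ⟨γ, hγ0, hγ, hγK⟩ := h2 p hp
      exact ⟨γ, hγ0, hγ, fun s hs ↦ Or.inr (hγK s hs)⟩
  · intro p hp
    obtain ⟨γ, rfl, hγ⟩ := h p hp
    have hγc : ContinuousOn γ (Icc 0 t) := fun s hs ↦ (hγ s hs).continuousWithinAt
    obtain ⟨χ, η, hη, hχ1, K', hK', hχK'⟩ :=
      hα.exists_cutoff_reebFlow (isCompact_Icc.image_of_continuousOn hγc)
    have hγη := hη.eqOn_of_reeb hα hγ fun s hs ↦ hχ1 _ (mem_image_of_mem γ hs)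
    have hopen : IsOpen {y : M | ∀ᶠ z in 𝓝 y, χ z = 1} := isOpen_setOfPred_eventually_nhds
    -- That the orbit over the compact interval [0, t] stays where χ is locally 1 is an open
    -- condition on the starting point. Such orbits are Reeb orbits inside the support of χ.
    have hev : ∀ᶠ q in 𝓝 (γ 0), ∀ s ∈ Icc 0 t, ∀ᶠ z in 𝓝 (η s q), χ z = 1 := by
      refine isCompact_Icc.eventually_forall_of_forall_eventually fun s hs ↦ ?_
      have h1 : ContinuousAt (fun q : M × ℝ ↦ η q.2 q.1) (γ 0, s) :=
        (hη.isPosPath.contMDiff.continuous.comp (continuous_snd.prodMk continuous_fst)).continuousAt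
      refine h1.eventually (hopen.mem_nhds ?_)
      have h2 := hχ1 _ (mem_image_of_mem γ hs)
      rw [hγη hs] at h2
      exact h2
    refine ⟨_, mem_nhdsWithin_of_mem_nhds hev, K', hK', fun q hq ↦ ⟨fun s ↦ η s q, hη.zero q,
      hη.isMIntegralCurveOn_reebField hα hq, fun s hs ↦ ?_⟩⟩
    by_contra hnot
    have h1 := (hq s hs).self_of_nhds
    rw [hχK' _ hnot] at h1
    exact zero_ne_one h1

/-- On a compact set on which it is defined, the time-`t` Reeb flow is the time-`t` map of the
contact flow of a cutoff function which is `1` along the Reeb orbits. -/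
theorem IsContactForm.exists_flow_of_reeb (hα : IsContactForm α) {S : Set M} (hS : IsCompact S)
    {t : ℝ} (ht : 0 ≤ t) (h : ReebFlowDefinedOn α t S) :
    ∃ (χ : M → ℝ) (η : ℝ → M → M), IsContactFlow α χ η ∧
      (∀ p ∈ S, ∀ s ∈ Icc 0 t, χ (η s p) = 1) ∧ reebImage α t S = η t '' S := by
  obtain ⟨K, hK, hKS⟩ := hα.exists_compact_reeb hS h
  obtain ⟨χ, η, hη, hχ1, -⟩ := hα.exists_cutoff_reebFlow hK
  have hmem : ∀ p ∈ S, ∀ s ∈ Icc 0 t, η s p ∈ K := by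
    intro p hp s hs
    obtain ⟨γ, rfl, hγ, hγK⟩ := hKS p hp
    have h1 := hη.eqOn_of_reeb hα hγ (fun s hs ↦ hχ1 _ (hγK s hs)) hs
    rw [← show γ s = η s (γ 0) from h1]
    exact hγK s hs
  have hcurve : ∀ p ∈ S, IsMIntegralCurveOn (fun s ↦ η s p) (reebField α) (Icc 0 t) :=
    fun p hp ↦ hη.isMIntegralCurveOn_reebField hα fun s hs ↦ hχ1 _ (hmem p hp s hs)
  refine ⟨χ, η, hη, fun p hp s hs ↦ (hχ1 _ (hmem p hp s hs)).self_of_nhds, Subset.antisymm ?_ ?_⟩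
  · rintro q ⟨γ, hγ0, hγ, rfl⟩
    have hγc : ContinuousOn γ (Icc 0 t) := fun s hs ↦ (hγ s hs).continuousWithinAt
    -- The curve γ need not be the one chosen for K. A cutoff equal to 1 along both curves
    -- identifies their end points.
    obtain ⟨χ', η', hη', hχ'1, -⟩ :=
      hα.exists_cutoff_reebFlow (hK.union (isCompact_Icc.image_of_continuousOn hγc))
    have h1 : γ t = η' t (γ 0) := hη'.eqOn_of_reeb hα hγ
      (fun s hs ↦ hχ'1 _ (Or.inr (mem_image_of_mem γ hs))) ⟨ht, le_rfl⟩
    have h2 : η t (γ 0) = η' t (η 0 (γ 0)) := hη'.eqOn_of_reeb hα (hcurve _ hγ0)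
      (fun s hs ↦ hχ'1 _ (Or.inl (hmem _ hγ0 s hs))) ⟨ht, le_rfl⟩
    rw [hη.zero] at h2
    exact ⟨γ 0, hγ0, h2.trans h1.symm⟩
  · rintro _ ⟨p, hp, rfl⟩
    exact ⟨fun s ↦ η s p, by simpa only [hη.zero] using hp, hcurve p hp, rfl⟩

/-- The Hamiltonian is transported by its flow via the conformal factor. -/
theorem IsContactFlow.hamiltonian_apply (h : IsContactFlow α χ η) (hα : IsContactForm α) (u : ℝ)
    (x : M) : χ (η u x) = conformalFactor α (η u) x * χ x := by
  have h1 := h.isPosPath.form_velocity_comp hα h.isPosPath.contMDiff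
    (θ := fun s ↦ u - s) (θ' := -1) (t := 0) (by simpa using (hasDerivAt_id (0 : ℝ)).const_sub u) x
  -- The path η_{u-s} ∘ η_s does not depend on s, so its speed at s = 0 is zero. The composition
  -- formula expresses that speed as -χ(η_u x) + factor · χ(x).
  have h2 : (fun (s : ℝ) (p : M) ↦ η (u - s) (η s p)) = fun _ ↦ η u := by
    funext s p
    rw [← h.add, sub_add_cancel]
  rw [h2, h.form_velocity hα, h.form_velocity hα] at h1
  have h3 : η (u - 0) (η 0 x) = η u x := by rw [sub_zero, h.zero]
  have h4 := (form_congr (α := α) h3 (LegendrianOrder.velocity (n := n) (fun _ ↦ η u) 0 x)).trans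
    (form_velocity_const (η u) 0 x)
  simp only [sub_zero, h.zero] at h1 h4
  linarith

variable [Nonempty Λ]

/-- The time-`t` Reeb translate of a Legendrian submanifold belongs to its isotopy class, and in
the orderable case it lies at Lorentzian distance `t`. -/
theorem IsOrderable.lorentzianDistance_reebImage {L : Set M}
    (ho : IsOrderable Λ α (isotopyClass Λ α L)) (hα : IsContactForm α) {L₀ : Set M}
    (hL₀ : L₀ ∈ isotopyClass Λ α L) {t : ℝ} (ht : 0 ≤ t) (h : ReebFlowDefinedOn α t L₀) :
    reebImage α t L₀ ∈ isotopyClass Λ α L ∧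
      lorentzianDistance Λ α L₀ (reebImage α t L₀) = ENNReal.ofReal t := by
  obtain ⟨f, hf, hfL⟩ := exists_embedding_of_mem_isotopyClass hL₀
  have hK : IsCompact L₀ := hfL ▸ isCompact_range hf.contMDiff.continuous
  have hne : Nonempty L₀ := by rw [← hfL]; infer_instance
  obtain ⟨χ, η, hη, hχ1, hR⟩ := hα.exists_flow_of_reeb hK ht h
  rw [hR]
  have hθd : ∀ s, HasDerivAt (fun s ↦ t * s) t s := fun s ↦ by
    simpa using (hasDerivAt_id s).const_mul t
  have hφ : IsPosPath α (fun s ↦ η (t * s)) :=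
    hη.isPosPath.reparam (θ := fun s ↦ t * s) (contDiff_const.mul contDiff_id)
  have hφv : ∀ s x, α (η (t * s) x) (velocity (n := n) (fun s ↦ η (t * s)) s x) =
      t * χ (η (t * s) x) := fun s x ↦ by
    rw [form_velocity_reparam hη.isPosPath.contMDiff (θ := fun s ↦ t * s) (hθd s),
      hη.form_velocity hα]
  have h0 : ∀ x, η (t * 0) x = x := fun x ↦ by rw [mul_zero, hη.zero]
  have h1 : η (t * 1) '' L₀ = η t '' L₀ := by rw [mul_one]
  refine ⟨hα.mem_isotopyClass_of_isotopy hL₀ (hφ.isContactPath.comp_embedding hf) ?_ ?_,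
    le_antisymm ?_ ?_⟩
  · simp only [h0, hfL]
  · rw [← h1, ← hfL, ← range_comp]; rfl
  · rw [lorentzianDistance]
    split_ifs
    swap
    · exact zero_le
    refine iSup_le fun φ ↦ iSup_le fun hφ ↦ iSup_le fun hpos ↦ iSup_le fun hφ0 ↦
      iSup_le fun hφ1 ↦ ENNReal.ofReal_le_ofReal ?_
    by_contra! hlt
    have hmc := continuous_iInf_form_velocity hα hφ.contMDiff hK
    have hmle := fun t x hx ↦ iInf_form_velocity_le hα hφ.contMDiff hK t (x := x) hx
    set m : ℝ → ℝ := fun t ↦ ⨅ p : L₀, α (φ t p) (velocity φ t (p : M)) with hm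
    have hm0 : ∀ t ∈ Icc (0 : ℝ) 1, 0 ≤ m t := fun t ht ↦ le_ciInf fun p ↦ hpos t ht p
    obtain ⟨s, hs, hs0, hs1, hsd⟩ := exists_smooth_slope_le hmc hm0 ht hlt
    have hθd : ∀ r, HasDerivAt (fun r ↦ -s r) (-deriv s r) r := fun r ↦
      (hs.differentiable (by simp) r).hasDerivAt.neg
    -- The competitor is followed while flowing back by time s(r). Since s(1) = t, the end of the
    -- path returns to L₀.
    have hζ := hη.isPosPath.comp_contactPath hφ (θ := fun r ↦ -s r) hs.neg
    have hkey : ∀ r ∈ Icc (0 : ℝ) 1, ∀ x ∈ L₀,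
        conformalFactor α (η (-s r)) (φ r x) * (m r - deriv s r) ≤
          α (η (-s r) (φ r x)) (velocity (n := n) (fun r x ↦ η (-s r) (φ r x)) r x) := by
      intro r hr x hx
      rw [hη.isPosPath.form_velocity_comp hα hφ.contMDiff (θ := fun r ↦ -s r) (hθd r) x,
        -- Gain and loss now carry the same conformal factor, which can be divided out; this makes
        -- the bound exactly t. The competitor may leave the region where χ = 1, but χ ≤ 1 is
        -- enough.
        hη.form_velocity hα, hη.hamiltonian_apply hα]
      have h2 := hη.isPosPath.conformalFactor_pos hα (-s r) (φ r x)
      have h3 := mul_le_mul_of_nonneg_left (hmle r x hx) h2.le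
      have h4 := mul_le_mul_of_nonneg_left
        (mul_le_mul_of_nonneg_left (hη.le_one (φ r x)) (hsd r hr).1) h2.le
      linarith
    have hzero := ho.form_velocity_eq_zero hα hL₀ hζ (by simp [hs0, hη.zero, hφ0]) (by
        rw [← image_image (η (-s 1)) (φ 1), hφ1, image_image, hs1]
        simp [← hη.add, hη.zero]) fun r hr x hx ↦
      (mul_nonneg (hη.isPosPath.conformalFactor_pos hα _ _).le
        (sub_nonneg.2 (hsd r hr).2.1)).trans (hkey r hr x hx)
    have hle : ∫ r in (0 : ℝ)..1, m r ≤ ∫ r in (0 : ℝ)..1, deriv s r := by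
      refine intervalIntegral.integral_mono_on_of_le_Ioo zero_le_one (hmc.intervalIntegrable _ _)
        ((hs.continuous_deriv (by simp)).intervalIntegrable _ _) fun r hr ↦ ?_
      obtain ⟨x, hx⟩ := hne
      have h2 := hkey r ⟨hr.1.le, hr.2.le⟩ x hx
      rw [hzero r hr x hx] at h2
      exact sub_nonpos.1 (nonpos_of_mul_nonpos_right h2
        (hη.isPosPath.conformalFactor_pos hα _ _))
    rw [intervalIntegral.integral_deriv_eq_sub (fun r _ ↦ hs.differentiable (by simp) r)
      ((hs.continuous_deriv (by simp)).intervalIntegrable _ _), hs0, hs1, sub_zero] at hle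
    exact absurd hlt (not_lt.2 hle)
  -- The rescaled cut-off flow is a competitor whose speed is constantly t along L₀, because χ = 1
  -- on the Reeb orbits from L₀.
  · have h2 := hφ.ofReal_integral_le hf hfL h0 h1 fun s _ x ↦ by
      rw [hφv]
      exact mul_nonneg ht (hη.nonneg _)
    have h3 : ∫ s in (0 : ℝ)..1, ⨅ p : L₀, α (η (t * s) p)
        (velocity (n := n) (fun s ↦ η (t * s)) s (p : M)) = t := by
      have h4 : EqOn (fun s ↦ ⨅ p : L₀, α (η (t * s) p)
          (velocity (n := n) (fun s ↦ η (t * s)) s (p : M))) (fun _ ↦ t) (uIcc 0 1) := by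
        intro s hs
        rw [uIcc_of_le zero_le_one] at hs
        have h5 : ∀ p : L₀, α (η (t * s) p)
            (velocity (n := n) (fun s ↦ η (t * s)) s (p : M)) = t := fun p ↦ by
          rw [hφv, hχ1 p p.2 _ ⟨mul_nonneg ht hs.1, mul_le_of_le_one_right ht hs.2⟩, mul_one]
        simp only [h5, ciInf_const]
      rw [intervalIntegral.integral_congr h4]
      simp
    rwa [h3] at h2

end Reeb

end LegendrianOrder

end

theorem mainTheorem9 (n : ℕ)
    {M : Type*} [TopologicalSpace M] [T2Space M] [SecondCountableTopology M]
    [ChartedSpace (EuclideanSpace ℝ (Fin (2 * n + 1))) M] [IsManifold (𝓡 (2 * n + 1)) ∞ M]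
    (α : ∀ x : M, TangentSpace (𝓡 (2 * n + 1)) x →L[ℝ] ℝ)
    (hα : LegendrianOrder.IsContactForm α)
    {Λ : Type*} [TopologicalSpace Λ] [CompactSpace Λ] [ConnectedSpace Λ]
    [ChartedSpace (EuclideanSpace ℝ (Fin n)) Λ] [IsManifold (𝓡 n) ∞ Λ]
    (L : Set M)
    (hL : ∃ f : Λ → M, LegendrianOrder.IsLegendrianEmbedding α f ∧ Set.range f = L) :
    (LegendrianOrder.IsOrderable Λ α (LegendrianOrder.isotopyClass Λ α L) ↔
      ∀ L₀ ∈ LegendrianOrder.isotopyClass Λ α L, ∀ L₁ ∈ LegendrianOrder.isotopyClass Λ α L,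
        LegendrianOrder.lorentzianDistance Λ α L₀ L₁ < ⊤) ∧
    (LegendrianOrder.IsOrderable Λ α (LegendrianOrder.isotopyClass Λ α L) →
      ∀ L₀ ∈ LegendrianOrder.isotopyClass Λ α L, ∀ t : ℝ, 0 ≤ t →
        LegendrianOrder.ReebFlowDefinedOn α t L₀ →
          LegendrianOrder.reebImage α t L₀ ∈ LegendrianOrder.isotopyClass Λ α L ∧
          LegendrianOrder.lorentzianDistance Λ α L₀ (LegendrianOrder.reebImage α t L₀) =
            ENNReal.ofReal t) := by
  have : Nonempty Λ := ConnectedSpace.toNonempty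
  exact ⟨⟨fun ho _ h₀ _ h₁ ↦ ho.lorentzianDistance_lt_top hα h₀ h₁,
    -- Finiteness on the diagonal already gives orderability.
    fun h ↦ hα.isOrderable_of_lt_top fun L₀ h₀ ↦ h L₀ h₀ L₀ h₀⟩,
    fun ho _ h₀ _ ht h ↦ ho.lorentzianDistance_reebImage hα h₀ ht h⟩
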